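/- **Theorem (weak-type $(1,1)$ estimate for $T_{km}$).** Let $d\ge 0$, let $s_0\ge s_1\ge\dots\ge s_d\ge 1$ be integers, $N=s_0+\dots+s_d$, and let $B$ be a real $N\times N$ matrix which, in the block decomposition of sizes $s_0,\dots,s_d$, has as its only possibly nonzero blocks the blocks $B_k$ ($1\le k\le d$), of size $s_{k-1}\times s_k$ and rank $s_k$, placed immediately above the block diagonal. On $\mathbb R^{N+1}$, with points $z=(x,t)$ and Lebesgue measure $|\cdot|$, put $F(\tau)=\exp(-\tau B^T)$, $$(x,t)\circ(y,\tau)=(y+F(\tau)x,\;t+\tau),\qquad (x,t)^{-1}=(-F(-t)x,-t),$$ $$\delta_r=\mathrm{diag}(rI_{s_0},r^3I_{s_1},\dots,r^{2d+1}I_{s_d},r^2),\qquad Q=s_0+3s_1+\dots+(2d+1)s_d .$$ Let $\|0\|=0$ and, for $z\ne0$, let $\|z\|$ be the unique $\rho>0$ with $|\delta_{1/\rho}z|=1$, where $|\cdot|$ is the Euclidean norm. For a real harmonic polynomial $Y$ on $\mathbb R^{N+1}$, homogeneous of degree $m\ge 1$, with $\int_{S^N}Y^2\,d\sigma=1$ ($\sigma$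 the surface measure of the Euclidean unit sphere $S^N$) — for instance any member $Y=Y_{km}$ of an orthonormal system of spherical harmonics — put $$K(z)=\frac{Y(\delta_{1/\|z\|}z)}{\|z\|^{Q+2}}\quad (z\neq 0),\qquad K(0)=0.$$ There are constants $c>0$, $\beta\in(0,1]$ and $M>1$, depending only on $s_0,\dots,s_d$ and $B$, such that for every $m\ge1$ and every $Y$ as above the following holds with $c_m=c\,m^{\frac{N+1}{2}}$. 1. (Hörmander's condition.) For all $z,\zeta,\eta$ with $\|\eta^{-1}\circ z\|\ge M\|\zeta^{-1}\circ z\|$ and $\eta\ne z$, $$|K(\eta^{-1}\circ\zeta)-K(\eta^{-1}\circ z)|\le c_m\frac{\|\zeta^{-1}\circ z\|^\beta}{\|\eta^{-1}\circ z\|^{Q+2+\beta}},\qquad |K(\zeta^{-1}\circ\eta)-K(z^{-1}\circ\eta)|\le c_m\frac{\|\zeta^{-1}\circ z\|^\beta}{\|\eta^{-1}\circ z\|^{Q+2+\beta}}.$$ 2. (Weak type $(1,1)$ with the same constant.) If $m=2$, assume in addition that $K$ has the vanishing property $\int_{a<\|\zeta\|<b}K(\zeta)\,d\zeta=0$ for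 all $0<a<b$. Then for every $f\in L^1(\mathbb R^{N+1})$ the principal value $$Tf(z)=\lim_{\varepsilon\to0^+}\int_{\|\zeta^{-1}\circ z\|>\varepsilon}K(\zeta^{-1}\circ z)f(\zeta)\,d\zeta$$ exists for almost every $z$, $Tf$ is measurable, and for all $\lambda>0$ $$|\{z\in\mathbb R^{N+1}:|Tf(z)|>\lambda\}|\le\frac{c_m}{\lambda}\int_{\mathbb R^{N+1}}|f(z)|\,dz .$$ -/

import Mathlib

open MeasureTheory Filter Topology

noncomputable section

namespace KFP

/-- Index set of the space variables `x₁, …, x_N`, grouped into blocks of sizes `s₀, …, s_d`. -/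
abbrev SpaceIdx {d : ℕ} (s : Fin (d + 1) → ℕ) : Type := Σ k : Fin (d + 1), Fin (s k)

/-- Index set of the coordinates of `ℝ^{N+1}`: `some p` are the space variables and `none` is the
time variable. -/
abbrev Idx {d : ℕ} (s : Fin (d + 1) → ℕ) : Type := Option (SpaceIdx s)

/-- The space `ℝ^{N+1}`, `N = s₀ + ⋯ + s_d`, with Lebesgue measure `volume`. -/
abbrev Pt {d : ℕ} (s : Fin (d + 1) → ℕ) : Type := EuclideanSpace ℝ (Idx s)

/-- The number `N = s₀ + ⋯ + s_d` of space variables. -/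
def spaceDim {d : ℕ} (s : Fin (d + 1) → ℕ) : ℕ := ∑ k, s k

/-- The structural assumption on `B`: the only nonzero blocks are the blocks
`B_{k+1}`, `0 ≤ k < d`, of size `s_k × s_{k+1}` just above the block diagonal, and `B_{k+1}`
has rank `s_{k+1}`; the block sizes are positive and nonincreasing. -/
structure IsKolmogorovMatrix {d : ℕ} (s : Fin (d + 1) → ℕ)
    (B : Matrix (SpaceIdx s) (SpaceIdx s) ℝ) : Prop where
  pos : ∀ k, 0 < s k
  anti : Antitone s
  zero_off : ∀ p q : SpaceIdx s, (q.1 : ℕ) ≠ (p.1 : ℕ) + 1 → B p q = 0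
  rank_block : ∀ k : Fin d,
    (Matrix.of fun (i : Fin (s k.castSucc)) (j : Fin (s k.succ)) =>
      B ⟨k.castSucc, i⟩ ⟨k.succ, j⟩).rank = s k.succ

/-- `F(τ) = exp(-τ Bᵀ)`. -/
def flow {d : ℕ} {s : Fin (d + 1) → ℕ} (B : Matrix (SpaceIdx s) (SpaceIdx s) ℝ) (τ : ℝ) :
    Matrix (SpaceIdx s) (SpaceIdx s) ℝ :=
  NormedSpace.exp (-τ • B.transpose)

/-- The space part `x` of a point `z = (x, t)`. -/
def spacePart {d : ℕ} {s : Fin (d + 1) → ℕ} (z : Pt s) : SpaceIdx s → ℝ := fun p => z (some p)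

/-- The point `(x, t)`. -/
def mkPt {d : ℕ} {s : Fin (d + 1) → ℕ} (x : SpaceIdx s → ℝ) (t : ℝ) : Pt s :=
  WithLp.toLp 2 fun i => i.elim t x

/-- The group law `(x, t) ∘ (y, τ) = (y + F(τ) x, t + τ)`. -/
def op {d : ℕ} {s : Fin (d + 1) → ℕ} (B : Matrix (SpaceIdx s) (SpaceIdx s) ℝ) (z w : Pt s) :
    Pt s :=
  mkPt (spacePart w + (flow B (w none)).mulVec (spacePart z)) (z none + w none)

/-- The group inverse `(x, t)⁻¹ = (-F(-t) x, -t)`. -/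
def inv {d : ℕ} {s : Fin (d + 1) → ℕ} (B : Matrix (SpaceIdx s) (SpaceIdx s) ℝ) (z : Pt s) :
    Pt s :=
  mkPt (-(flow B (-(z none))).mulVec (spacePart z)) (-(z none))

/-- The homogeneity exponents: `2k+1` for the variables of block `k`, and `2` for time. -/
def expo {d : ℕ} {s : Fin (d + 1) → ℕ} : Idx s → ℕ
  | none => 2
  | some p => 2 * (p.1 : ℕ) + 1

/-- `Q = s₀ + 3 s₁ + ⋯ + (2d+1) s_d`. -/
def homDim {d : ℕ} (s : Fin (d + 1) → ℕ) : ℕ := ∑ k : Fin (d + 1), (2 * (k : ℕ) + 1) * s k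

/-- The dilations `δ_r = diag(r I_{s₀}, r³ I_{s₁}, …, r^{2d+1} I_{s_d}, r²)`. -/
def dil {d : ℕ} {s : Fin (d + 1) → ℕ} (r : ℝ) (z : Pt s) : Pt s :=
  WithLp.toLp 2 fun i => r ^ expo i * z i

/-- Existence and uniqueness of the homogeneous norm. -/
theorem existsUnique_homNorm {d : ℕ} {s : Fin (d + 1) → ℕ} {z : Pt s} (hz : z ≠ 0) :
    ∃! ρ : ℝ, 0 < ρ ∧ ∑ i, z i ^ 2 / ρ ^ (2 * expo i) = 1 := by
  have ha : ∀ i : Idx s, 1 ≤ expo i := by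
    intro i
    cases i <;> simp [expo]
  obtain ⟨i₀, hi₀⟩ : ∃ i, z i ≠ 0 := by
    by_contra! h
    exact hz (by ext i; simpa using h i)
  have anti : ∀ ρ₁ ρ₂ : ℝ, 0 < ρ₁ → ρ₁ < ρ₂ →
      ∑ i, z i ^ 2 / ρ₂ ^ (2 * expo i) < ∑ i, z i ^ 2 / ρ₁ ^ (2 * expo i) := by
    intro ρ₁ ρ₂ h1 h12
    refine Finset.sum_lt_sum (fun i _ => ?_) ⟨i₀, Finset.mem_univ _, ?_⟩
    · gcongr
    · have hp : 0 < z i₀ ^ 2 := by positivity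
      have : ρ₁ ^ (2 * expo i₀) < ρ₂ ^ (2 * expo i₀) :=
        pow_lt_pow_left₀ h12 h1.le (by have := ha i₀; omega)
      exact div_lt_div_of_pos_left hp (by positivity) this
  set ρ₁ : ℝ := min 1 |z i₀| with hρ₁
  have hρ₁pos : 0 < ρ₁ := lt_min one_pos (abs_pos.mpr hi₀)
  set S : ℝ := ∑ i, z i ^ 2 with hS
  have hS0 : 0 ≤ S := Finset.sum_nonneg fun i _ => sq_nonneg _
  set ρ₂ : ℝ := max 1 S with hρ₂
  have hρ₂one : 1 ≤ ρ₂ := le_max_left _ _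
  have h12 : ρ₁ ≤ ρ₂ := (min_le_left _ _).trans hρ₂one
  have low : 1 ≤ ∑ i, z i ^ 2 / ρ₁ ^ (2 * expo i) := by
    have h : z i₀ ^ 2 / ρ₁ ^ (2 * expo i₀) ≤ ∑ i, z i ^ 2 / ρ₁ ^ (2 * expo i) :=
      Finset.single_le_sum (f := fun i => z i ^ 2 / ρ₁ ^ (2 * expo i))
        (fun i _ => by positivity) (Finset.mem_univ i₀)
    refine le_trans ?_ h
    rw [one_le_div (by positivity)]
    calc ρ₁ ^ (2 * expo i₀) ≤ ρ₁ ^ 2 :=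
          pow_le_pow_of_le_one hρ₁pos.le (min_le_left _ _) (by have := ha i₀; omega)
      _ ≤ |z i₀| ^ 2 := pow_le_pow_left₀ hρ₁pos.le (min_le_right _ _) 2
      _ = z i₀ ^ 2 := sq_abs _
  have high : ∑ i, z i ^ 2 / ρ₂ ^ (2 * expo i) ≤ 1 := by
    calc ∑ i, z i ^ 2 / ρ₂ ^ (2 * expo i) ≤ ∑ i, z i ^ 2 / ρ₂ := by
          refine Finset.sum_le_sum fun i _ => ?_
          have : ρ₂ ≤ ρ₂ ^ (2 * expo i) :=
            le_self_pow₀ hρ₂one (by have := ha i; omega)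
          gcongr
      _ = S / ρ₂ := by rw [Finset.sum_div]
      _ ≤ 1 := by
          rw [div_le_one (by linarith)]
          exact le_max_right _ _
  have cont : ContinuousOn (fun ρ : ℝ => ∑ i, z i ^ 2 / ρ ^ (2 * expo i)) (Set.Icc ρ₁ ρ₂) := by
    refine continuousOn_finsetSum _ fun i _ => ?_
    refine ContinuousOn.div continuousOn_const (by fun_prop) fun x hx => ?_
    have : 0 < x := hρ₁pos.trans_le hx.1
    positivity
  obtain ⟨ρ, hρ, hval⟩ := intermediate_value_Icc' h12 cont ⟨high, low⟩
  refine ⟨ρ, ⟨hρ₁pos.trans_le hρ.1, hval⟩, ?_⟩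
  rintro σ ⟨hσ, hσv⟩
  have hρpos : 0 < ρ := hρ₁pos.trans_le hρ.1
  have hval' : ∑ i, z i ^ 2 / ρ ^ (2 * expo i) = 1 := hval
  rcases lt_trichotomy σ ρ with h | h | h
  · have := anti σ ρ hσ h
    linarith
  · exact h
  · have := anti ρ σ hρpos h
    linarith

open Classical in
/-- The homogeneous norm: `‖0‖ = 0`, and for `z ≠ 0` the unique `ρ > 0` with
`∑ i, z_i² / ρ^{2 a_i} = 1`. -/
def homNorm {d : ℕ} {s : Fin (d + 1) → ℕ} (z : Pt s) : ℝ :=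
  if hz : z = 0 then 0 else (existsUnique_homNorm hz).exists.choose

/-- A solid harmonic of degree `m` on `ℝ^{N+1}` whose restriction to the Euclidean unit sphere has
norm one in `L²` for the surface measure; these are the possible members `Y_{km}` of an orthonormal
system of spherical harmonics. -/
structure IsNormalizedSolidHarmonic {d : ℕ} (s : Fin (d + 1) → ℕ) (m : ℕ)
    (Y : MvPolynomial (Idx s) ℝ) : Prop where
  homogeneous : Y.IsHomogeneous m
  harmonic : ∑ i, MvPolynomial.pderiv i (MvPolynomial.pderiv i Y) = 0
  norm_one : ∫ ω : Metric.sphere (0 : Pt s) 1,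
    (MvPolynomial.eval (fun i => (ω : Pt s) i) Y) ^ 2
      ∂((volume : Measure (Pt s)).toSphere) = 1

/-- The kernel `K(z) = Y(z') / ‖z‖^{Q+2}`, where `z' = δ_{1/‖z‖} z`. -/
def kernel {d : ℕ} {s : Fin (d + 1) → ℕ} (Y : MvPolynomial (Idx s) ℝ) (z : Pt s) : ℝ :=
  MvPolynomial.eval (fun i => dil (homNorm z)⁻¹ z i) Y / homNorm z ^ (homDim s + 2)

/-- The truncated singular integral `∫_{‖ζ⁻¹ ∘ z‖ > ε} K(ζ⁻¹ ∘ z) f(ζ) dζ`. -/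
def truncInt {d : ℕ} {s : Fin (d + 1) → ℕ} (B : Matrix (SpaceIdx s) (SpaceIdx s) ℝ)
    (Y : MvPolynomial (Idx s) ℝ) (f : Pt s → ℝ) (z : Pt s) (ε : ℝ) : ℝ :=
  ∫ ζ in {ζ : Pt s | ε < homNorm (op B (inv B ζ) z)}, kernel Y (op B (inv B ζ) z) * f ζ

/-- The singular integral `T f(z) = p.v. ∫ K(ζ⁻¹ ∘ z) f(ζ) dζ`, the limit of the truncated
integrals as `ε → 0+`. -/
def singInt {d : ℕ} {s : Fin (d + 1) → ℕ} (B : Matrix (SpaceIdx s) (SpaceIdx s) ℝ)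
    (Y : MvPolynomial (Idx s) ℝ) (f : Pt s → ℝ) (z : Pt s) : ℝ :=
  limUnder (𝓝[>] (0 : ℝ)) (truncInt B Y f z)

/-- `K` satisfies the regularity (Hörmander) condition with constant `C`, exponent `β` and
separation constant `M`. -/
def HormanderCondition {d : ℕ} {s : Fin (d + 1) → ℕ} (B : Matrix (SpaceIdx s) (SpaceIdx s) ℝ)
    (K : Pt s → ℝ) (C β M : ℝ) : Prop :=
  ∀ z ζ η : Pt s,
    M * homNorm (op B (inv B ζ) z) ≤ homNorm (op B (inv B η) z) →
      |K (op B (inv B η) ζ) - K (op B (inv B η) z)| ≤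
          C * (homNorm (op B (inv B ζ) z) ^ β /
            homNorm (op B (inv B η) z) ^ ((homDim s : ℝ) + 2 + β)) ∧
      |K (op B (inv B ζ) η) - K (op B (inv B z) η)| ≤
          C * (homNorm (op B (inv B ζ) z) ^ β /
            homNorm (op B (inv B η) z) ^ ((homDim s : ℝ) + 2 + β))

/-- The vanishing property of a kernel: its integral over every homogeneous annulus
`{a < ‖ζ‖ < b}` is zero. -/
def VanishingMean {d : ℕ} {s : Fin (d + 1) → ℕ} (K : Pt s → ℝ) : Prop :=
  ∀ a b : ℝ, 0 < a → a < b → ∫ ζ in {ζ : Pt s | a < homNorm ζ ∧ homNorm ζ < b}, K ζ = 0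

end KFP

end

/-!
The proof has three independent parts.

**Analysis on groups with a gauge.** Let `G` be a group with a measure `μ` that is invariant under
right translations and inversion, and let `N` be a gauge: `N (u v)` and `N (v u)` are at most
`N u + κ N v`, and `μ {N < r} = V r ^ D` (`IsGauge`). A kernel `K` of size `N ^ (-D)`, with
differences `|K (w v) - K w|` and `|K (v w) - K w|` of size `N v / N w ^ (D + 1)`, and with vanishing
integrals over the annuli `a < N ≤ b` (`IsSingularKernel`) decomposes into dyadic pieces which are
almost orthogonal, so that the Cotlar–Stein argument bounds the truncated convolutions on `L²`
uniformly (`IsSingularKernel.norm_convOp_le`). A Calderón–Zygmund decomposition, based on a Vitali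
selection of gauge balls, then gives the weak type `(1, 1)` bound for the maximal truncation
`sup_ε |K_ε * f|` (`IsGauge.exists_measure_maximal_truncation_le`). On functions that are Lipschitz
for the gauge the principal value exists at every point; density and the maximal bound give almost
everywhere existence on `L¹` (`IsSingularKernel.ae_exists_tendsto`).

**The Kolmogorov group.** With `op` and `inv` as operations `ℝ^{N+1}` is a topological group for
which Lebesgue measure is invariant, since `det (exp (-τ Bᵀ)) = 1`. The dilations are automorphisms,
and the homogeneous norm grows at most linearly in the Euclidean distance away from the origin; so
scaling to the unit sphere turns the smoothness of the group law into the gauge inequalities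
(`exists_isGauge_homNorm`), and a Lipschitz bound `A` for `Y` on the Euclidean unit ball into the
kernel estimates with constant `C A` (`exists_kernel_regularity`). These yield Hörmander's condition
with exponent `β = 1`. The integral of the kernel over an annulus is a radial factor times
`∫ Y ∑ aᵢ ωᵢ² dσ`, where `∑ aᵢ ωᵢ²` is the Jacobian of homogeneous polar coordinates
(`setIntegral_kernel`). It vanishes for `m ∉ {0, 2}`, because a quadratic form restricted to the
sphere is a sum of harmonics of degrees `0` and `2`.

**Growth in the degree.** Everything is thus reduced to the Lipschitz constant of a normalised solid
harmonic `Y` of degree `m` on the unit ball of `ℝ^n`, `n = N + 1`, which has to be `O(m ^ (n / 2))`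
(`exists_isLipschitzOnBall`). Put `G(p) = ∫ p(x) exp (-|x|²/2) dx`. Integration by parts,
`G(∂ᵢ p) = G(xᵢ p)`, and Euler's identity give `∑ G((∂ᵢ Y)²) = m G(Y²)`. The derivatives `∂ᵢ Y` are
harmonic of degree `m - 1`; the reproducing kernel of that space is rotation invariant, so on the
sphere its diagonal is a multiple of the dimension (`evalE_sq_mul_gaussInt_le`). The dimension is at
most `2 m ^ (n - 2)`, because Laplace's equation determines a harmonic polynomial from its
coefficients of degree at most one in a single variable. Polar coordinates relate `G` to integrals
over the sphere, and the powers of `m` add up to `|∂ᵢ Y|² ≤ C m ^ n`.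
-/

noncomputable section

namespace KFP

set_option linter.unusedSectionVars false

/-! ### Almost orthogonality of operators -/

section CotlarStein

variable {ι : Type*}

/-- The product `γ(x₁,x₂) γ(x₂,x₃) ⋯` over the consecutive pairs of a word. -/
def chainProd (γ : ι → ι → ℝ) : List ι → ℝ
  | [] => 1
  | [_] => 1
  | i :: j :: l => γ i j * chainProd γ (j :: l)

/-- The product `γ(x₁,x₂)² γ(x₃,x₄)² ⋯` over disjoint pairs of letters, with a factor `Γ` for an
unpaired last letter. -/
def pairProd (γ : ι → ι → ℝ) (Γ : ℝ) : List ι → ℝ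
  | [] => 1
  | [_] => Γ
  | i :: j :: l => γ i j ^ 2 * pairProd γ Γ l

/-- The sum of `F` over all words of length `n`. -/
def wordSum [Fintype ι] {M : Type*} [AddCommMonoid M] : ℕ → (List ι → M) → M
  | 0, F => F []
  | n + 1, F => ∑ i, wordSum n fun l => F (i :: l)

theorem pairProd_mul_pairProd_tail (γ : ι → ι → ℝ) (Γ : ℝ) (i : ι) (l : List ι) :
    pairProd γ Γ (i :: l) * pairProd γ Γ l = Γ * chainProd γ (i :: l) ^ 2 := by
  induction l generalizing i with
  | nil => simp [pairProd, chainProd]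
  | cons j l ih =>
    have := ih j
    simp only [pairProd, chainProd] at this ⊢
    calc _ = γ i j ^ 2 * (pairProd γ Γ (j :: l) * pairProd γ Γ l) := by ring
      _ = _ := by rw [this]; ring

theorem chainProd_nonneg {γ : ι → ι → ℝ} (h : ∀ i j, 0 ≤ γ i j) (l : List ι) :
    0 ≤ chainProd γ l := by
  induction l with
  | nil => simp [chainProd]
  | cons i l ih =>
    cases l with
    | nil => simp [chainProd]
    | cons j l => exact mul_nonneg (h i j) ih

theorem pairProd_nonneg {γ : ι → ι → ℝ} {Γ : ℝ} (hΓ : 0 ≤ Γ) :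
    ∀ l : List ι, 0 ≤ pairProd γ Γ l
  | [] => by simp [pairProd]
  | [_] => by simpa [pairProd]
  | i :: j :: l => mul_nonneg (sq_nonneg _) (pairProd_nonneg hΓ l)

variable {H : Type*} [NormedAddCommGroup H] [InnerProductSpace ℝ H] [CompleteSpace H]

/-- `S†` or `S` according to the flag. -/
def flagAdj (S : H →L[ℝ] H) : Bool → (H →L[ℝ] H)
  | true => star S
  | false => S

/-- The alternating product `T₁† T₂ T₃† ⋯` along a word, starting with an adjoint if the flag is
set. -/
def altProd (T : ι → H →L[ℝ] H) : Bool → List ι → (H →L[ℝ] H)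
  | _, [] => 1
  | b, i :: l => flagAdj (T i) b * altProd T (!b) l

/-- Grouping the letters of a word into consecutive pairs, each pair being bounded by almost
orthogonality. -/
theorem norm_altProd_le {T : ι → H →L[ℝ] H} {γ : ι → ι → ℝ} {Γ : ℝ}
    (hT : ∀ i, ‖T i‖ ≤ Γ) (h1 : ∀ i j, ‖star (T i) * T j‖ ≤ γ i j ^ 2)
    (h2 : ∀ i j, ‖T i * star (T j)‖ ≤ γ i j ^ 2) :
    ∀ (b : Bool) (l : List ι), ‖altProd T b l‖ ≤ pairProd γ Γ l
  | b, [] => by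
    exact ContinuousLinearMap.norm_id_le
  | b, [i] => by
    simp only [altProd, pairProd, mul_one]
    cases b
    · exact hT i
    · exact (norm_star (T i)).trans_le (hT i)
  | b, i :: j :: l => by
    have ih := norm_altProd_le hT h1 h2 b l
    have e : altProd T b (i :: j :: l) =
        (flagAdj (T i) b * flagAdj (T j) (!b)) * altProd T b l := by
      simp [altProd, mul_assoc]
    rw [e]
    refine (norm_mul_le _ _).trans
      (mul_le_mul ?_ ih (norm_nonneg _) (sq_nonneg _))
    cases b
    · exact h2 i j
    · exact h1 i j

/-- The geometric mean of the two pairings, one starting at the first letter and one at the second,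
turns the bounds `γ²` for pairs into `γ` for each transition. -/
theorem norm_altProd_cons_le {T : ι → H →L[ℝ] H} {γ : ι → ι → ℝ} {Γ : ℝ}
    (hΓ : 0 ≤ Γ) (hγ : ∀ i j, 0 ≤ γ i j)
    (hT : ∀ i, ‖T i‖ ≤ Γ) (h1 : ∀ i j, ‖star (T i) * T j‖ ≤ γ i j ^ 2)
    (h2 : ∀ i j, ‖T i * star (T j)‖ ≤ γ i j ^ 2) (b : Bool) (i : ι) (l : List ι) :
    ‖altProd T b (i :: l)‖ ≤ Γ * chainProd γ (i :: l) := by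
  have A := norm_altProd_le hT h1 h2 b (i :: l)
  have B : ‖altProd T b (i :: l)‖ ≤ Γ * pairProd γ Γ l := by
    refine (norm_mul_le _ _).trans
      (mul_le_mul ?_ (norm_altProd_le hT h1 h2 _ l) (norm_nonneg _) hΓ)
    cases b
    · exact hT i
    · exact (norm_star (T i)).trans_le (hT i)
  refine le_of_sq_le_sq ?_ (mul_nonneg hΓ (chainProd_nonneg hγ _))
  calc ‖altProd T b (i :: l)‖ ^ 2 = ‖altProd T b (i :: l)‖ * ‖altProd T b (i :: l)‖ := sq _
    _ ≤ pairProd γ Γ (i :: l) * (Γ * pairProd γ Γ l) :=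
        mul_le_mul A B (norm_nonneg _) (pairProd_nonneg hΓ _)
    _ = Γ * (pairProd γ Γ (i :: l) * pairProd γ Γ l) := by ring
    _ = _ := by rw [pairProd_mul_pairProd_tail]; ring

variable [Fintype ι]

theorem wordSum_mono {n : ℕ} {F F' : List ι → ℝ} (h : ∀ l, F l ≤ F' l) :
    wordSum n F ≤ wordSum n F' := by
  induction n generalizing F F' with
  | zero => exact h []
  | succ n ih => exact Finset.sum_le_sum fun i _ => ih fun l => h _

theorem wordSum_mul_left {R : Type*} [NonUnitalNonAssocSemiring R] (n : ℕ) (c : R)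
    (F : List ι → R) :
    wordSum n (fun l => c * F l) = c * wordSum n F := by
  induction n generalizing F with
  | zero => rfl
  | succ n ih => simp only [wordSum, ih, Finset.mul_sum]

theorem norm_wordSum_le {M : Type*} [SeminormedAddCommGroup M] (n : ℕ) (F : List ι → M) :
    ‖wordSum n F‖ ≤ wordSum n fun l => ‖F l‖ := by
  induction n generalizing F with
  | zero => exact le_rfl
  | succ n ih => exact (norm_sum_le _ _).trans (Finset.sum_le_sum fun i _ => ih _)

theorem wordSum_chainProd_le {γ : ι → ι → ℝ} {Γ : ℝ} (hγ : ∀ i j, 0 ≤ γ i j)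
    (hrow : ∀ i, ∑ j, γ i j ≤ Γ) (hΓ : 0 ≤ Γ) (n : ℕ) (i : ι) :
    wordSum n (fun l => chainProd γ (i :: l)) ≤ Γ ^ n := by
  induction n generalizing i with
  | zero => simp [wordSum, chainProd]
  | succ n ih =>
    simp only [wordSum, chainProd, wordSum_mul_left]
    calc ∑ j, γ i j * wordSum n (fun l => chainProd γ (j :: l)) ≤ ∑ j, γ i j * Γ ^ n :=
          Finset.sum_le_sum fun j _ => mul_le_mul_of_nonneg_left (ih j) (hγ i j)
      _ = (∑ j, γ i j) * Γ ^ n := by rw [Finset.sum_mul]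
      _ ≤ Γ * Γ ^ n := by gcongr; exact hrow i
      _ = Γ ^ (n + 1) := by ring

/-- The alternating power `S† S S† ⋯` with `n` factors. -/
def altPow (S : H →L[ℝ] H) : Bool → ℕ → (H →L[ℝ] H)
  | _, 0 => 1
  | b, n + 1 => flagAdj S b * altPow S (!b) n

theorem altPow_two_mul (S : H →L[ℝ] H) (n : ℕ) : altPow S true (2 * n) = (star S * S) ^ n := by
  induction n with
  | zero => simp [altPow]
  | succ n ih =>
    rw [pow_succ', ← ih, show 2 * (n + 1) = 2 * n + 1 + 1 by ring]
    simp [altPow, flagAdj, mul_assoc]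

theorem altPow_sum (T : ι → H →L[ℝ] H) (b : Bool) (n : ℕ) :
    altPow (∑ i, T i) b n = wordSum n (altProd T b) := by
  induction n generalizing b with
  | zero => rfl
  | succ n ih =>
    have h : flagAdj (∑ i, T i) b = ∑ i, flagAdj (T i) b := by
      cases b <;> simp [flagAdj]
    simp only [altPow, wordSum, altProd, wordSum_mul_left, ← ih, h, Finset.sum_mul]

/-- **Cotlar–Stein lemma** for finite sums. The `2n`-th power of `‖∑ T i‖` is the norm of an
alternating product of `2n` sums; each of the resulting words is bounded by the geometric mean of
the two ways of pairing neighbouring letters, and the number of words enters only through a factor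
that is negligible as `n → ∞`. -/
theorem norm_sum_le_of_almost_orthogonal {T : ι → H →L[ℝ] H} {γ : ι → ι → ℝ} {Γ : ℝ}
    (hΓ : 0 < Γ) (hγ : ∀ i j, 0 ≤ γ i j) (hrow : ∀ i, ∑ j, γ i j ≤ Γ)
    (h1 : ∀ i j, ‖star (T i) * T j‖ ≤ γ i j ^ 2)
    (h2 : ∀ i j, ‖T i * star (T j)‖ ≤ γ i j ^ 2) :
    ‖∑ i, T i‖ ≤ Γ := by
  have hT : ∀ i, ‖T i‖ ≤ Γ := by
    intro i
    have : ‖T i‖ ^ 2 ≤ γ i i ^ 2 := by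
      rw [sq, ← CStarRing.norm_star_mul_self]; exact h1 i i
    exact (le_of_sq_le_sq this (hγ i i)).trans
      ((Finset.single_le_sum (fun j _ => hγ i j) (Finset.mem_univ i)).trans (hrow i))
  set S := ∑ i, T i with hS
  have key : ∀ n, ‖altPow S true (n + 1)‖ ≤ Fintype.card ι * Γ ^ (n + 1) := by
    intro n
    rw [hS, altPow_sum]
    refine (norm_wordSum_le _ _).trans ?_
    calc ∑ i, wordSum n (fun l => ‖altProd T true (i :: l)‖)
        ≤ ∑ i : ι, Γ * Γ ^ n := by
          refine Finset.sum_le_sum fun i _ => ?_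
          refine (wordSum_mono fun l => norm_altProd_cons_le hΓ.le hγ hT h1 h2 true i l).trans ?_
          rw [wordSum_mul_left]
          exact mul_le_mul_of_nonneg_left (wordSum_chainProd_le hγ hrow hΓ.le n i) hΓ.le
      _ = _ := by simp [pow_succ']
  have pow_bound : ∀ k : ℕ, (‖S‖ / Γ) ^ (2 * 2 ^ k) ≤ Fintype.card ι := by
    intro k
    have sa : IsSelfAdjoint (star S * S) := IsSelfAdjoint.star_mul_self S
    have e : ‖S‖ ^ (2 * 2 ^ k) = ‖altPow S true (2 * 2 ^ k)‖ := by
      have h := congrArg NNReal.toReal (IsSelfAdjoint.nnnorm_pow_two_pow (E := H →L[ℝ] H) sa k)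
      simp only [coe_nnnorm, NNReal.coe_pow] at h
      have hs : ‖star S * S‖ = ‖S‖ * ‖S‖ := CStarRing.norm_star_mul_self
      rw [altPow_two_mul, h, hs, ← sq, ← pow_mul]
    obtain ⟨n, hn⟩ : ∃ n, 2 * 2 ^ k = n + 1 := 
      ⟨2 * 2 ^ k - 1, by have := Nat.one_le_two_pow (n := k); omega⟩
    rw [div_pow, e, div_le_iff₀ (by positivity), hn]
    exact key n
  by_contra hlt
  push Not at hlt
  have h1 : 1 < ‖S‖ / Γ := by rwa [one_lt_div hΓ]
  have ht : Tendsto (fun k : ℕ => (‖S‖ / Γ) ^ (2 * 2 ^ k)) atTop atTop := by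
    refine (tendsto_pow_atTop_atTop_of_one_lt h1).comp ?_
    refine tendsto_atTop_mono (fun k => ?_) tendsto_id
    have := Nat.lt_two_pow_self (n := k)
    simp only [id]; omega
  obtain ⟨k, hk⟩ := (ht.eventually_gt_atTop (Fintype.card ι : ℝ)).exists
  exact absurd (pow_bound k) (not_le.mpr hk)

end CotlarStein

/-! ### Groups with a homogeneous gauge: coverings and the maximal function -/

section Gauge

open scoped ENNReal

/-- A gauge on a group with an invariant measure: a continuous function `N ≥ 0` that grows by at
most a multiple of `N v` under multiplication by `v` on either side, whose sublevel sets shrink to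
the identity and have measure `V r ^ D`. -/
structure IsGauge {G : Type*} [Group G] [TopologicalSpace G] [MeasurableSpace G] (μ : Measure G)
    (N : G → ℝ) (κ V : ℝ) (D : ℕ) : Prop where
  nonneg : ∀ u, 0 ≤ N u
  continuous : Continuous N
  map_one : N 1 = 0
  one_le : 1 ≤ κ
  mul_le : ∀ u v, N (u * v) ≤ N u + κ * N v
  mul_le' : ∀ u v, N (v * u) ≤ N u + κ * N v
  inv_le : ∀ u, N u⁻¹ ≤ κ * N u
  V_pos : 0 < V
  D_pos : 0 < D
  volume_lt : ∀ r, 0 < r → μ {u | N u < r} = ENNReal.ofReal (V * r ^ D)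
  small : ∀ U ∈ 𝓝 (1 : G), ∃ r, 0 < r ∧ {u | N u < r} ⊆ U

/-- The gauge ball of centre `z` and radius `r`. -/
def gball {G : Type*} [Group G] (N : G → ℝ) (z : G) (r : ℝ) : Set G := {ζ | N (ζ⁻¹ * z) < r}

variable {G : Type*} [Group G] [TopologicalSpace G] [IsTopologicalGroup G]
  [MeasurableSpace G] [BorelSpace G] {μ : Measure G}
  {N : G → ℝ} {κ V : ℝ} {D : ℕ}

theorem gball_mono {z : G} {r r' : ℝ} (h : r ≤ r') : gball N z r ⊆ gball N z r' :=
  fun _ hζ => lt_of_lt_of_le hζ h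

theorem measurePreserving_inv_mul [SecondCountableTopology G] [μ.IsMulRightInvariant]
    [μ.IsInvInvariant] (z : G) : MeasurePreserving (fun ζ : G => ζ⁻¹ * z) μ μ :=
  (measurePreserving_mul_right μ z).comp (Measure.measurePreserving_inv μ)

/-- The substitution `u = ζ⁻¹ z`. -/
theorem measurableEmbedding_inv_mul [SecondCountableTopology G] (z : G) :
    MeasurableEmbedding (fun ζ : G => ζ⁻¹ * z) :=
  ((MeasurableEquiv.inv G).trans (MeasurableEquiv.mulRight z)).measurableEmbedding

namespace IsGauge

variable (hN : IsGauge μ N κ V D)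
include hN

theorem kappa_pos : 0 < κ := lt_of_lt_of_le one_pos hN.one_le

theorem isOpen_gball (z : G) (r : ℝ) : IsOpen (gball N z r) :=
  isOpen_lt (hN.continuous.comp (by fun_prop)) continuous_const

theorem measurableSet_gball (z : G) (r : ℝ) : MeasurableSet (gball N z r) :=
  (hN.isOpen_gball z r).measurableSet

theorem mem_gball_self (z : G) {r : ℝ} (hr : 0 < r) : z ∈ gball N z r := by
  simpa [gball, hN.map_one] using hr

theorem measure_gball [SecondCountableTopology G] [μ.IsMulRightInvariant] [μ.IsInvInvariant]
    (z : G) {r : ℝ} (hr : 0 < r) : μ (gball N z r) = ENNReal.ofReal (V * r ^ D) := by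
  rw [← hN.volume_lt r hr]
  exact (measurePreserving_inv_mul z).measure_preimage
    (isOpen_lt hN.continuous continuous_const).measurableSet.nullMeasurableSet

theorem le_mul_right (w v : G) : N w ≤ N (w * v) + κ ^ 2 * N v := by
  have h := hN.mul_le (w * v) v⁻¹
  rw [mul_inv_cancel_right] at h
  nlinarith [hN.inv_le v, hN.kappa_pos]

theorem le_mul_left (w v : G) : N w ≤ N (v * w) + κ ^ 2 * N v := by
  have h := hN.mul_le' (v * w) v⁻¹
  rw [inv_mul_cancel_left] at h
  nlinarith [hN.inv_le v, hN.kappa_pos]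

/-- Two balls that meet are contained in fixed enlargements of each other when their radii are
comparable. -/
theorem gball_subset_of_inter {x y : G} {r s : ℝ} (hs : 0 < s)
    (h : (gball N x r ∩ gball N y s).Nonempty) (hrs : r ≤ 2 * s) :
    gball N x r ⊆ gball N y (5 * κ ^ 2 * s) := by
  obtain ⟨p, hpx, hpy⟩ := h
  intro q hq
  simp only [gball, Set.mem_ofPred_eq] at *
  have e : q⁻¹ * y = (q⁻¹ * x) * ((x⁻¹ * p) * (p⁻¹ * y)) := by group
  have h1 := hN.mul_le (q⁻¹ * x) ((x⁻¹ * p) * (p⁻¹ * y))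
  have h2 := hN.mul_le (x⁻¹ * p) (p⁻¹ * y)
  have h3 := hN.inv_le (p⁻¹ * x)
  rw [show (p⁻¹ * x)⁻¹ = x⁻¹ * p by group] at h3
  rw [← e] at h1
  have hk := hN.one_le
  have h4 : N (x⁻¹ * p * (p⁻¹ * y)) ≤ κ * (3 * s) := by nlinarith
  have h5 : κ * N (x⁻¹ * p * (p⁻¹ * y)) ≤ κ * (κ * (3 * s)) :=
    mul_le_mul_of_nonneg_left h4 (by linarith)
  nlinarith [mul_le_mul hk hk zero_le_one (by linarith : (0:ℝ) ≤ κ)]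

/-- **Vitali selection at a level.** At each point where some ball average of `h` exceeds `a`, a
nearly maximal such ball is chosen; a disjoint subfamily is extracted whose enlargements cover. -/
theorem exists_selection [TopologicalSpace.SeparableSpace G] {h : G → ℝ≥0∞} (hh : ∫⁻ ζ, h ζ ∂μ ≠ ∞) {a : ℝ}
    (ha : 0 < a) :
    ∃ (u : Set G) (rad : G → ℝ), u.Countable ∧
      u.PairwiseDisjoint (fun y => gball N y (rad y)) ∧
      (∀ y ∈ u, 0 < rad y ∧
        ENNReal.ofReal (a * rad y ^ D) < ∫⁻ ζ in gball N y (rad y), h ζ ∂μ ∧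
        ∀ r, 2 * rad y ≤ r → ∫⁻ ζ in gball N y r, h ζ ∂μ ≤ ENNReal.ofReal (a * r ^ D)) ∧
      {z | ∃ r, 0 < r ∧ ENNReal.ofReal (a * r ^ D) < ∫⁻ ζ in gball N z r, h ζ ∂μ} ⊆
        ⋃ y ∈ u, gball N y (5 * κ ^ 2 * rad y) := by
  set P : G → ℝ → Prop := fun z r =>
    0 < r ∧ ENNReal.ofReal (a * r ^ D) < ∫⁻ ζ in gball N z r, h ζ ∂μ with hP
  set I : ℝ := (∫⁻ ζ, h ζ ∂μ).toReal with hI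
  set R : ℝ := max 1 (I / a) with hR
  have bdd : ∀ z r, P z r → r ≤ R := by
    rintro z r ⟨hr, h1⟩
    have h2 : ENNReal.ofReal (a * r ^ D) < ∫⁻ ζ, h ζ ∂μ :=
      h1.trans_le (setLIntegral_le_lintegral _ _)
    have h3 : a * r ^ D < I := (ENNReal.ofReal_lt_iff_lt_toReal (by positivity) hh).1 h2
    rcases le_total r 1 with h | h
    · exact h.trans (le_max_left _ _)
    · refine le_trans ?_ (le_max_right _ _)
      rw [le_div_iff₀ ha]
      have : r ≤ r ^ D := le_self_pow₀ h hN.D_pos.ne'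
      nlinarith
  -- more than half the supremum of the admissible radii, so that twice the radius is inadmissible
  have choice : ∀ z, ∃ r, (∃ r', P z r') → P z r ∧ ∀ r', 2 * r ≤ r' → ¬ P z r' := by
    intro z
    by_cases hz : ∃ r', P z r'
    · obtain ⟨r₀, h₀⟩ := hz
      have hne : {r | P z r}.Nonempty := ⟨r₀, h₀⟩
      have hb : BddAbove {r | P z r} := ⟨R, fun r hr => bdd z r hr⟩
      have hs : 0 < sSup {r | P z r} := h₀.1.trans_le (le_csSup hb h₀)
      obtain ⟨r, hr, hlt⟩ := exists_lt_of_lt_csSup hne (half_lt_self hs)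
      refine ⟨r, fun _ => ⟨hr, fun r' hr' hP' => ?_⟩⟩
      have := le_csSup hb hP'
      linarith
    · exact ⟨0, fun h => absurd h hz⟩
  choose rad hrad using choice
  set t : Set G := {z | ∃ r, P z r} with ht
  obtain ⟨u, hut, hdisj, hcov⟩ := Vitali.exists_disjoint_subfamily_covering_enlargement
    (fun y => gball N y (rad y)) t rad 2 one_lt_two (fun z hz => (hrad z hz).1.1.le) R
    (fun z hz => bdd z _ (hrad z hz).1)
    (fun z hz => ⟨z, hN.mem_gball_self z (hrad z hz).1.1⟩)
  refine ⟨u, rad, ?_, hdisj, ?_, ?_⟩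
  · exact hdisj.countable_of_isOpen (fun y _ => hN.isOpen_gball y _)
      fun y hy => ⟨y, hN.mem_gball_self y (hrad y (hut hy)).1.1⟩
  · intro y hy
    obtain ⟨h1, h2⟩ := hrad y (hut hy)
    refine ⟨h1.1, h1.2, fun r hr => ?_⟩
    have := h2 r hr
    simp only [hP, not_and, not_lt] at this
    exact this (by linarith [h1.1])
  · intro z hz
    obtain ⟨y, hy, hyi, hyr⟩ := hcov z hz
    refine Set.mem_biUnion hy ?_
    exact hN.gball_subset_of_inter (hrad y (hut hy)).1.1 hyi hyr
      (hN.mem_gball_self z (hrad z hz).1.1)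

/-- The total size of disjoint balls on which the averages of `h` exceed `a`. -/
theorem tsum_selection_le {h : G → ℝ≥0∞} {a : ℝ} (ha : 0 < a) {u : Set G} {rad : G → ℝ}
    (hu : u.Countable) (hdisj : u.PairwiseDisjoint (fun y => gball N y (rad y)))
    (hrad : ∀ y ∈ u, 0 < rad y ∧
      ENNReal.ofReal (a * rad y ^ D) < ∫⁻ ζ in gball N y (rad y), h ζ ∂μ) :
    ∑' y : u, ENNReal.ofReal (rad y ^ D) ≤ ENNReal.ofReal a⁻¹ * ∫⁻ ζ, h ζ ∂μ := by
  have := hu.to_subtype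
  calc ∑' y : u, ENNReal.ofReal (rad y ^ D)
      ≤ ∑' y : u, ENNReal.ofReal a⁻¹ * ∫⁻ ζ in gball N (y : G) (rad y), h ζ ∂μ := by
        refine ENNReal.tsum_le_tsum fun y => ?_
        rw [show rad y ^ D = a⁻¹ * (a * rad y ^ D) by field_simp,
          ENNReal.ofReal_mul (by positivity)]
        gcongr
        exact (hrad y y.2).2.le
    _ = ENNReal.ofReal a⁻¹ * ∫⁻ ζ in ⋃ y : u, gball N (y : G) (rad y), h ζ ∂μ := by
        rw [ENNReal.tsum_mul_left, lintegral_iUnion (fun y => hN.measurableSet_gball _ _)]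
        exact fun x y hxy => hdisj x.2 y.2 (fun h => hxy (Subtype.ext h))
    _ ≤ _ := mul_le_mul_right (setLIntegral_le_lintegral _ _) _

variable [SecondCountableTopology G] [μ.IsMulRightInvariant] [μ.IsInvInvariant]

theorem measure_iUnion_enlarged_le {u : Set G} {rad : G → ℝ} (hu : u.Countable)
    (hrad : ∀ y ∈ u, 0 < rad y) {L : ℝ} (hL : 0 < L) :
    μ (⋃ y ∈ u, gball N y (L * rad y)) ≤
      ENNReal.ofReal (V * L ^ D) * ∑' y : u, ENNReal.ofReal (rad y ^ D) := by
  refine (measure_biUnion_le μ hu _).trans ?_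
  rw [← ENNReal.tsum_mul_left]
  refine ENNReal.tsum_le_tsum fun y => ?_
  have h1 := hrad y y.2
  have h2 := hN.V_pos
  rw [hN.measure_gball _ (by positivity), ← ENNReal.ofReal_mul (by positivity)]
  exact ENNReal.ofReal_le_ofReal (by rw [mul_pow]; linarith)

/-- Weak type `(1,1)` of the maximal function. -/
theorem measure_maximal_le {h : G → ℝ≥0∞} (hh : ∫⁻ ζ, h ζ ∂μ ≠ ∞) {a : ℝ} (ha : 0 < a) :
    μ {z | ∃ r, 0 < r ∧ ENNReal.ofReal (a * r ^ D) < ∫⁻ ζ in gball N z r, h ζ ∂μ} ≤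
      ENNReal.ofReal (V * (5 * κ ^ 2) ^ D / a) * ∫⁻ ζ, h ζ ∂μ := by
  obtain ⟨u, rad, hu, hdisj, hrad, hcov⟩ := hN.exists_selection hh ha
  have hk := hN.kappa_pos
  have hV := hN.V_pos
  refine (measure_mono hcov).trans
    ((hN.measure_iUnion_enlarged_le hu (fun y hy => (hrad y hy).1) (by positivity)).trans ?_)
  rw [div_eq_mul_inv, ENNReal.ofReal_mul (p := V * (5 * κ ^ 2) ^ D) (by positivity), mul_assoc]
  refine mul_le_mul_right ?_ _
  exact hN.tsum_selection_le ha hu hdisj fun y hy => ⟨(hrad y hy).1, (hrad y hy).2.1⟩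

theorem exists_gball_subset {z : G} {U : Set G} (hU : U ∈ 𝓝 z) :
    ∃ r, 0 < r ∧ gball N z r ⊆ U := by
  have hc : ContinuousAt (fun u : G => z * u⁻¹) 1 := by fun_prop
  have : (fun u : G => z * u⁻¹) ⁻¹' U ∈ 𝓝 (1 : G) := hc (by simpa using hU)
  obtain ⟨r, hr, hsub⟩ := hN.small _ this
  refine ⟨r, hr, fun ζ hζ => ?_⟩
  have := hsub (show ζ⁻¹ * z ∈ {u | N u < r} from hζ)
  simpa using this

variable [LocallyCompactSpace G] [NormalSpace G] [μ.Regular]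

/-- One half of the Lebesgue differentiation theorem: a function is a.e. bounded by `a / V` where
all of its ball averages are. -/
theorem ae_abs_le_of_averages_le {f : G → ℝ} (hf : Integrable f μ) {a : ℝ} (ha : 0 < a) :
    ∀ᵐ z ∂μ, (∀ r, 0 < r → ∫⁻ ζ in gball N z r, ‖f ζ‖ₑ ∂μ ≤ ENNReal.ofReal (a * r ^ D)) →
      |f z| ≤ a / V := by
  have hV := hN.V_pos
  have hk := hN.kappa_pos
  have key : ∀ δ : ℝ, 0 < δ → μ {z | (∀ r, 0 < r → ∫⁻ ζ in gball N z r, ‖f ζ‖ₑ ∂μ ≤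
      ENNReal.ofReal (a * r ^ D)) ∧ a / V + 2 * δ < |f z|} = 0 := by
    intro δ hδ
    set C : ℝ := V * (5 * κ ^ 2) ^ D / (δ * V / 2) + δ⁻¹ with hC
    have hCpos : 0 < C := by positivity
    -- with `g` continuous and close to `f` in `L¹`, the exceptional set lies where the maximal
    -- function of `f - g`, or `|f - g|` itself, is large
    have bound : ∀ η : ℝ, 0 < η → μ {z | (∀ r, 0 < r → ∫⁻ ζ in gball N z r, ‖f ζ‖ₑ ∂μ ≤
        ENNReal.ofReal (a * r ^ D)) ∧ a / V + 2 * δ < |f z|} ≤ ENNReal.ofReal (C * η) := by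
      intro η hη
      obtain ⟨g, -, hfg, hgc, hgi⟩ := hf.exists_hasCompactSupport_integral_sub_le hη
      have hI : ∫⁻ ζ, ‖f ζ - g ζ‖ₑ ∂μ ≤ ENNReal.ofReal η := by
        refine le_trans (le_of_eq ?_) (ENNReal.ofReal_le_ofReal hfg)
        exact (ofReal_integral_norm_eq_lintegral_enorm (hf.sub hgi)).symm
      have sub : {z | (∀ r, 0 < r → ∫⁻ ζ in gball N z r, ‖f ζ‖ₑ ∂μ ≤
          ENNReal.ofReal (a * r ^ D)) ∧ a / V + 2 * δ < |f z|} ⊆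
          {z | ∃ r, 0 < r ∧ ENNReal.ofReal (δ * V / 2 * r ^ D) <
            ∫⁻ ζ in gball N z r, ‖f ζ - g ζ‖ₑ ∂μ} ∪ {z | ENNReal.ofReal δ ≤ ‖f z - g z‖ₑ} := by
        rintro z ⟨hz1, hz2⟩
        by_cases hd : δ ≤ |f z - g z|
        · right
          simpa [Real.enorm_eq_ofReal_abs] using ENNReal.ofReal_le_ofReal hd
        left
        push Not at hd
        have hgz : a / V + δ < |g z| := by
          have := abs_sub_abs_le_abs_sub (f z) (g z)
          linarith
        obtain ⟨r, hr, hsub⟩ := hN.exists_gball_subset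
          ((isOpen_lt continuous_const (continuous_abs.comp hgc)).mem_nhds hgz)
        refine ⟨r, hr, ?_⟩
        have h1 : ENNReal.ofReal (a * r ^ D + δ * V * r ^ D) ≤
            ∫⁻ ζ in gball N z r, ‖g ζ‖ₑ ∂μ := by
          calc ENNReal.ofReal (a * r ^ D + δ * V * r ^ D)
              = ENNReal.ofReal (a / V + δ) * μ (gball N z r) := by
                rw [hN.measure_gball z hr, ← ENNReal.ofReal_mul (by positivity)]
                congr 1; field_simp
            _ = ∫⁻ _ in gball N z r, ENNReal.ofReal (a / V + δ) ∂μ := by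
                rw [setLIntegral_const]
            _ ≤ _ := by
                refine setLIntegral_mono' (hN.measurableSet_gball z r) fun ζ hζ => ?_
                rw [Real.enorm_eq_ofReal_abs]
                exact ENNReal.ofReal_le_ofReal (hsub hζ).le
        have h2 : ∫⁻ ζ in gball N z r, ‖g ζ‖ₑ ∂μ ≤
            ENNReal.ofReal (a * r ^ D) + ∫⁻ ζ in gball N z r, ‖f ζ - g ζ‖ₑ ∂μ := by
          refine le_trans ?_ (add_le_add_left (hz1 r hr) _)
          rw [← lintegral_add_left' hf.1.enorm.restrict]
          refine lintegral_mono fun ζ => ?_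
          calc ‖g ζ‖ₑ = ‖f ζ - (f ζ - g ζ)‖ₑ := by rw [sub_sub_cancel]
            _ ≤ _ := enorm_sub_le
        have h3 := h1.trans h2
        rw [ENNReal.ofReal_add (by positivity) (by positivity)] at h3
        have h4 := (ENNReal.add_le_add_iff_left ENNReal.ofReal_ne_top).1 h3
        refine lt_of_lt_of_le ?_ h4
        refine (ENNReal.ofReal_lt_ofReal_iff (by positivity)).2 ?_
        have : 0 < δ * V * r ^ D := by positivity
        nlinarith
      refine (measure_mono sub).trans ((measure_union_le _ _).trans ?_)
      rw [hC, add_mul, ENNReal.ofReal_add (by positivity) (by positivity)]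
      refine add_le_add ?_ ?_
      · refine (hN.measure_maximal_le (ne_top_of_le_ne_top ENNReal.ofReal_ne_top hI)
          (by positivity)).trans ?_
        rw [ENNReal.ofReal_mul (by positivity)]
        gcongr
      · have := meas_ge_le_lintegral_div (μ := μ) (f := fun z => ‖f z - g z‖ₑ)
          (hf.sub hgi).1.enorm (ε := ENNReal.ofReal δ) (by simpa using hδ)
          ENNReal.ofReal_ne_top
        refine this.trans ?_
        rw [mul_comm, ENNReal.ofReal_mul hη.le, ENNReal.ofReal_inv_of_pos hδ, ← div_eq_mul_inv]
        gcongr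
    refine le_antisymm (ENNReal.le_of_forall_pos_le_add fun ε hε _ => ?_) bot_le
    refine (bound (ε / C) (by positivity)).trans ?_
    rw [mul_div_cancel₀ _ hCpos.ne', zero_add, ENNReal.ofReal_coe_nnreal]
  have all : ∀ᵐ z ∂μ, ∀ n : ℕ, ¬ ((∀ r, 0 < r → ∫⁻ ζ in gball N z r, ‖f ζ‖ₑ ∂μ ≤
      ENNReal.ofReal (a * r ^ D)) ∧ a / V + 2 * (1 / ((n : ℝ) + 1)) < |f z|) := by
    rw [ae_all_iff]
    intro n
    rw [ae_iff]
    simpa using key (1 / ((n : ℝ) + 1)) (by positivity)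
  filter_upwards [all] with z hz hav
  refine le_of_forall_pos_le_add fun ε hε => ?_
  obtain ⟨n, hn⟩ := exists_nat_one_div_lt (half_pos hε)
  have := hz n
  simp only [not_and, not_lt] at this
  have := this hav
  linarith

end IsGauge

end Gauge

/-! ### Calderón–Zygmund decomposition -/

section CalderonZygmund

open scoped ENNReal

theorem aestronglyMeasurable_of_hasSum {α ι : Type*} [MeasurableSpace α] {μ : Measure α}
    [Countable ι] {F : ι → α → ℝ} {Φ : α → ℝ} (hF : ∀ i, AEStronglyMeasurable (F i) μ)
    (h : ∀ x, HasSum (fun i => F i x) (Φ x)) : AEStronglyMeasurable Φ μ := by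
  refine aestronglyMeasurable_of_tendsto_ae (u := (atTop : Filter (Finset ι)))
    (f := fun s x => ∑ i ∈ s, F i x) (fun s => ?_) (Eventually.of_forall fun x => h x)
  exact Finset.aestronglyMeasurable_fun_sum s fun i _ => hF i

/-- Functions supported on disjoint sets can be summed pointwise. -/
theorem summable_of_pairwise_disjoint {α ι : Type*} {A : ι → Set α}
    (hA : Pairwise (Function.onFun Disjoint A)) {F : ι → α → ℝ}
    (hF : ∀ i x, x ∉ A i → F i x = 0) (x : α) : Summable fun i => F i x := by
  by_cases h : ∃ i, x ∈ A i
  · obtain ⟨i, hi⟩ := h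
    refine (hasSum_single (f := fun i => F i x) i fun j hj => hF j x fun hjx => ?_).summable
    exact Set.disjoint_left.1 (hA hj) hjx hi
  · push Not at h
    have : (fun i => F i x) = fun _ => 0 := funext fun i => hF i x (h i)
    rw [this]; exact summable_zero

variable {G : Type*} [Group G] [TopologicalSpace G] [IsTopologicalGroup G]
  [MeasurableSpace G] [BorelSpace G] {μ : Measure G}
  {N : G → ℝ} {κ V : ℝ} {D : ℕ} [SecondCountableTopology G] [μ.IsMulRightInvariant]
  [μ.IsInvInvariant] [LocallyCompactSpace G] [NormalSpace G] [μ.Regular]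

/-- **Calderón–Zygmund decomposition.** The balls `B_y` come from Vitali selection at level `a`;
the enlarged balls are made disjoint into sets `Q_y`, and `b_y = f 1_{Q_y} - c_y 1_{B_y}`. Spreading
the mass of `f 1_{Q_y}` over the small ball `B_y` rather than over `Q_y` keeps the good part
bounded although `Q_y` may have small measure. -/
theorem IsGauge.exists_calderonZygmund (hN : IsGauge μ N κ V D) {f : G → ℝ}
    (hf : Integrable f μ) {a : ℝ} (ha : 0 < a) :
    ∃ (u : Set G) (R : G → ℝ) (b : u → G → ℝ) (g : G → ℝ), u.Countable ∧ (∀ y ∈ u, 0 < R y) ∧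
      ∑' y : u, ENNReal.ofReal (R y ^ D) ≤
        ENNReal.ofReal ((5 * κ ^ 2) ^ D / a) * ∫⁻ ζ, ‖f ζ‖ₑ ∂μ ∧
      (∀ y, Integrable (b y) μ) ∧ (∀ (y : u) ζ, ζ ∉ gball N (y : G) (R y) → b y ζ = 0) ∧
      (∀ y, ∫ ζ, b y ζ ∂μ = 0) ∧
      ∑' y, ∫⁻ ζ, ‖b y ζ‖ₑ ∂μ ≤ 2 * ∫⁻ ζ, ‖f ζ‖ₑ ∂μ ∧
      Integrable g μ ∧ ∫⁻ ζ, ‖g ζ‖ₑ ∂μ ≤ ∫⁻ ζ, ‖f ζ‖ₑ ∂μ ∧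
      (∀ᵐ z ∂μ, |g z| ≤ 2 * (5 * κ ^ 2) ^ D / V * a) ∧
      ∀ ζ, HasSum (fun y => b y ζ) (f ζ - g ζ) := by
  have hfin : ∫⁻ ζ, ‖f ζ‖ₑ ∂μ ≠ ∞ := hf.2.ne
  obtain ⟨u, rad, hu, hdisj, hrad, hcov⟩ := hN.exists_selection hfin ha
  have hk := hN.one_le
  have hV := hN.V_pos
  set Λ : ℝ := 5 * κ ^ 2 with hΛ
  have hΛ5 : 5 ≤ Λ := by nlinarith
  have hcu := hu.to_subtype
  obtain ⟨e, he⟩ := exists_injective_nat u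
  set Bs : u → Set G := fun y => gball N (y : G) (rad y) with hBs
  set Bl : u → Set G := fun y => gball N (y : G) (Λ * rad y) with hBl
  -- first come, first served, in the order given by an enumeration of the balls
  set Q : u → Set G := fun y => Bl y \ ⋃ y' ∈ {y' : u | e y' < e y}, Bl y' with hQ
  have hpos : ∀ y : u, 0 < rad y := fun y => (hrad y y.2).1
  have hBsm : ∀ y, MeasurableSet (Bs y) := fun y => hN.measurableSet_gball _ _
  have hBlm : ∀ y, MeasurableSet (Bl y) := fun y => hN.measurableSet_gball _ _
  have hQm : ∀ y, MeasurableSet (Q y) := fun y =>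
    (hBlm y).diff (MeasurableSet.biUnion (Set.to_countable _) fun y' _ => hBlm y')
  have hBsd : Pairwise (Function.onFun Disjoint Bs) := fun x y hxy =>
    hdisj x.2 y.2 fun h => hxy (Subtype.ext h)
  have hQd : Pairwise (Function.onFun Disjoint Q) := by
    have aux : ∀ x y : u, e x < e y → Disjoint (Q x) (Q y) := by
      intro x y hxy
      refine Set.disjoint_left.2 fun ζ hx hy => hy.2 ?_
      exact Set.mem_biUnion (show x ∈ {y' : u | e y' < e y} from hxy) hx.1
    intro x y hxy
    rcases lt_or_gt_of_ne (fun h => hxy (he h)) with h | h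
    · exact aux x y h
    · exact (aux y x h).symm
  have hBsBl : ∀ y, Bs y ⊆ Bl y := fun y => gball_mono (by nlinarith [hpos y])
  set E : Set G := ⋃ y, Q y with hE
  have hEm : MeasurableSet E := MeasurableSet.iUnion hQm
  have hBlE : ∀ y, Bl y ⊆ E := by
    intro y ζ hζ
    have hne : ∃ n, ∃ y : u, e y = n ∧ ζ ∈ Bl y := ⟨_, y, rfl, hζ⟩
    classical
    obtain ⟨y₀, h0, h1⟩ := Nat.find_spec hne
    refine Set.mem_iUnion.2 ⟨y₀, h1, fun h => ?_⟩
    obtain ⟨y', hy', hm⟩ := Set.mem_iUnion₂.1 h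
    have hy'' : e y' < Nat.find hne := by rw [← h0]; exact hy'
    exact Nat.find_min hne hy'' ⟨y', rfl, hm⟩
  -- the mass of `f` on `Q y`, spread evenly over the small ball
  set c : u → ℝ := fun y => (∫ ζ in Q y, f ζ ∂μ) / (V * rad y ^ D) with hc
  have hBsμ : ∀ y, μ (Bs y) = ENNReal.ofReal (V * rad y ^ D) := fun y =>
    hN.measure_gball _ (hpos y)
  have hcμ : ∀ y, ‖c y‖ₑ * μ (Bs y) ≤ ∫⁻ ζ in Q y, ‖f ζ‖ₑ ∂μ := by
    intro y
    have hp : 0 < V * rad y ^ D := mul_pos hV (pow_pos (hpos y) _)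
    calc ‖c y‖ₑ * μ (Bs y) = ‖∫ ζ in Q y, f ζ ∂μ‖ₑ := by
          rw [hBsμ, Real.enorm_eq_ofReal_abs, ← ENNReal.ofReal_mul (abs_nonneg _), hc, abs_div,
            abs_of_pos hp, div_mul_cancel₀ _ hp.ne', Real.enorm_eq_ofReal_abs]
      _ ≤ _ := enorm_integral_le_lintegral_enorm _
  have hcb : ∀ y, |c y| ≤ Λ ^ D / V * a := by
    intro y
    have hp : 0 < V * rad y ^ D := mul_pos hV (pow_pos (hpos y) _)
    have h1 := hcμ y
    have h2 : ∫⁻ ζ in Q y, ‖f ζ‖ₑ ∂μ ≤ ENNReal.ofReal (a * (Λ * rad y) ^ D) :=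
      (lintegral_mono_set Set.sdiff_subset).trans
        ((hrad y y.2).2.2 _ (by nlinarith [hpos y]))
    have h3 := h1.trans h2
    have hr := hpos y
    rw [hBsμ, Real.enorm_eq_ofReal_abs, ← ENNReal.ofReal_mul (abs_nonneg _),
      ENNReal.ofReal_le_ofReal_iff (by positivity), ← le_div_iff₀ hp] at h3
    refine h3.trans (le_of_eq ?_)
    rw [mul_pow]; field_simp
  set F1 : u → G → ℝ := fun y => (Q y).indicator f with hF1
  set F2 : u → G → ℝ := fun y => (Bs y).indicator fun _ => c y with hF2
  have hF1i : ∀ y, Integrable (F1 y) μ := fun y => hf.indicator (hQm y)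
  have hF2i : ∀ y, Integrable (F2 y) μ := fun y =>
    (integrable_indicator_iff (hBsm y)).2
      (integrableOn_const (by rw [hBsμ]; exact ENNReal.ofReal_ne_top) (by simp))
  have hF1n : ∀ y, ∫⁻ ζ, ‖F1 y ζ‖ₑ ∂μ = ∫⁻ ζ in Q y, ‖f ζ‖ₑ ∂μ := by
    intro y
    rw [← lintegral_indicator (hQm y)]
    exact lintegral_congr fun ζ => enorm_indicator_eq_indicator_enorm _ _
  have hF2n : ∀ y, ∫⁻ ζ, ‖F2 y ζ‖ₑ ∂μ = ‖c y‖ₑ * μ (Bs y) := by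
    intro y
    rw [← setLIntegral_const, ← lintegral_indicator (hBsm y)]
    exact lintegral_congr fun ζ => enorm_indicator_eq_indicator_enorm _ _
  have hS1 : ∀ ζ, HasSum (fun y => F1 y ζ) (E.indicator f ζ) := by
    intro ζ
    by_cases h : ζ ∈ E
    · obtain ⟨y, hy⟩ := Set.mem_iUnion.1 h
      have e1 : E.indicator f ζ = F1 y ζ := by
        rw [Set.indicator_of_mem h, hF1]; exact (Set.indicator_of_mem hy f).symm
      rw [e1]
      refine hasSum_single y fun y' hy' => Set.indicator_of_notMem (fun h' => ?_) _
      exact Set.disjoint_left.1 (hQd hy') h' hy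
    · rw [Set.indicator_of_notMem h]
      have : (fun y => F1 y ζ) = fun _ => 0 := funext fun y =>
        Set.indicator_of_notMem (fun h' => h (Set.mem_iUnion.2 ⟨y, h'⟩)) _
      rw [this]; exact hasSum_zero
  have hS2 : ∀ ζ, HasSum (fun y => F2 y ζ) (∑' y, F2 y ζ) := fun ζ =>
    (summable_of_pairwise_disjoint hBsd (fun y ζ h => Set.indicator_of_notMem h _) ζ).hasSum
  have hS2m : AEStronglyMeasurable (fun ζ => ∑' y, F2 y ζ) μ :=
    aestronglyMeasurable_of_hasSum (fun y => (hF2i y).1) hS2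
  have hsumQ : ∑' y, ∫⁻ ζ in Q y, ‖f ζ‖ₑ ∂μ = ∫⁻ ζ in E, ‖f ζ‖ₑ ∂μ :=
    (lintegral_iUnion hQm hQd _).symm
  set g : G → ℝ := fun ζ => Eᶜ.indicator f ζ + ∑' y, F2 y ζ with hg
  have hgm : AEStronglyMeasurable g μ := (hf.indicator hEm.compl).1.add hS2m
  have hgn : ∫⁻ ζ, ‖g ζ‖ₑ ∂μ ≤ ∫⁻ ζ, ‖f ζ‖ₑ ∂μ := by
    calc ∫⁻ ζ, ‖g ζ‖ₑ ∂μ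
        ≤ ∫⁻ ζ, (Eᶜ.indicator (fun ζ => ‖f ζ‖ₑ) ζ + ∑' y, ‖F2 y ζ‖ₑ) ∂μ := by
          refine lintegral_mono fun ζ => (enorm_add_le _ _).trans ?_
          refine add_le_add (le_of_eq (enorm_indicator_eq_indicator_enorm _ _)) ?_
          exact enorm_tsum_le_tsum_enorm
      _ = ∫⁻ ζ in Eᶜ, ‖f ζ‖ₑ ∂μ + ∑' y, ‖c y‖ₑ * μ (Bs y) := by
          rw [lintegral_add_left' (hf.1.enorm.indicator hEm.compl),
            lintegral_indicator hEm.compl,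
            lintegral_tsum fun y => (hF2i y).1.enorm]
          simp_rw [hF2n]
      _ ≤ ∫⁻ ζ in Eᶜ, ‖f ζ‖ₑ ∂μ + ∫⁻ ζ in E, ‖f ζ‖ₑ ∂μ := by
          rw [← hsumQ]
          gcongr with y
          exact hcμ y
      _ = ∫⁻ ζ, ‖f ζ‖ₑ ∂μ := by rw [add_comm, lintegral_add_compl _ hEm]
  refine ⟨u, fun y => Λ * rad y, fun y ζ => F1 y ζ - F2 y ζ, g, hu,
    fun y hy => mul_pos (by linarith) (hrad y hy).1, ?_, fun y => (hF1i y).sub (hF2i y),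
    ?_, ?_, ?_, ⟨hgm, lt_of_le_of_lt hgn hf.2⟩, hgn, ?_, ?_⟩
  · have h := hN.tsum_selection_le ha hu hdisj fun y hy => ⟨(hrad y hy).1, (hrad y hy).2.1⟩
    rw [div_eq_mul_inv, ENNReal.ofReal_mul (p := Λ ^ D) (by positivity), mul_assoc]
    refine le_trans (le_of_eq ?_) (mul_le_mul_right h _)
    rw [← ENNReal.tsum_mul_left]
    refine tsum_congr fun y => ?_
    rw [mul_pow, ENNReal.ofReal_mul (by positivity)]
  · intro y ζ hζ
    have h1 : ζ ∉ Q y := fun h => hζ h.1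
    have h2 : ζ ∉ Bs y := fun h => hζ (hBsBl y h)
    simp [hF1, hF2, h1, h2]
  · intro y
    have hp : 0 < V * rad y ^ D := mul_pos hV (pow_pos (hpos y) _)
    rw [integral_sub (hF1i y) (hF2i y), hF1, hF2]
    simp only [integral_indicator (hQm y), integral_indicator (hBsm y)]
    rw [setIntegral_const, Measure.real, hBsμ, ENNReal.toReal_ofReal hp.le, smul_eq_mul,
      mul_div_cancel₀ _ hp.ne', sub_self]
  · calc ∑' y, ∫⁻ ζ, ‖F1 y ζ - F2 y ζ‖ₑ ∂μ
        ≤ ∑' y, 2 * ∫⁻ ζ in Q y, ‖f ζ‖ₑ ∂μ := by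
          refine ENNReal.tsum_le_tsum fun y => ?_
          calc ∫⁻ ζ, ‖F1 y ζ - F2 y ζ‖ₑ ∂μ ≤ ∫⁻ ζ, (‖F1 y ζ‖ₑ + ‖F2 y ζ‖ₑ) ∂μ :=
                lintegral_mono fun ζ => enorm_sub_le
            _ = ∫⁻ ζ in Q y, ‖f ζ‖ₑ ∂μ + ‖c y‖ₑ * μ (Bs y) := by
                rw [lintegral_add_left' (hF1i y).1.enorm, hF1n, hF2n]
            _ ≤ _ := by rw [two_mul]; gcongr; exact hcμ y
      _ = 2 * ∫⁻ ζ in E, ‖f ζ‖ₑ ∂μ := by rw [ENNReal.tsum_mul_left, hsumQ]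
      _ ≤ _ := mul_le_mul_right (setLIntegral_le_lintegral _ _) _
  · filter_upwards [hN.ae_abs_le_of_averages_le hf ha] with z hz
    have h2 : |∑' y, F2 y z| ≤ Λ ^ D / V * a := by
      by_cases h : ∃ y, z ∈ Bs y
      · obtain ⟨y, hy⟩ := h
        rw [tsum_eq_single y fun y' hy' => Set.indicator_of_notMem
          (fun h' => Set.disjoint_left.1 (hBsd hy') h' hy) _]
        simpa [hF2, hy] using hcb y
      · push Not at h
        have : (fun y => F2 y z) = fun _ => 0 := funext fun y =>
          Set.indicator_of_notMem (h y) _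
        rw [this]; simp; positivity
    have h1 : |Eᶜ.indicator f z| ≤ Λ ^ D / V * a := by
      by_cases h : z ∈ E
      · rw [Set.indicator_of_notMem (by simpa using h)]; simp; positivity
      · rw [Set.indicator_of_mem (by simpa using h)]
        refine (hz fun r hr => ?_).trans ?_
        · by_contra hlt
          push Not at hlt
          obtain ⟨y, hy, hzy⟩ := Set.mem_iUnion₂.1 (hcov ⟨r, hr, hlt⟩)
          exact h (hBlE ⟨y, hy⟩ hzy)
        · have : (1 : ℝ) ≤ Λ ^ D := one_le_pow₀ (by linarith)
          rw [div_mul_eq_mul_div]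
          gcongr
          nlinarith
    calc |g z| ≤ |Eᶜ.indicator f z| + |∑' y, F2 y z| := abs_add_le _ _
      _ ≤ Λ ^ D / V * a + Λ ^ D / V * a := add_le_add h1 h2
      _ = 2 * Λ ^ D / V * a := by ring
  · intro ζ
    have h := (hS1 ζ).sub (hS2 ζ)
    have e1 : f ζ - g ζ = E.indicator f ζ - ∑' y, F2 y ζ := by
      rw [hg]
      by_cases hζ : ζ ∈ E <;> simp [hζ]
    rw [e1]; exact h

end CalderonZygmund

/-! ### Convolution operators on `L²` -/

section ConvolutionOperators

open scoped ENNReal RealInnerProductSpace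

variable {G : Type*} [Group G] [TopologicalSpace G] [IsTopologicalGroup G]
  [MeasurableSpace G] [BorelSpace G] {μ : Measure G}
  [SecondCountableTopology G] [μ.IsMulRightInvariant] [μ.IsInvInvariant]

/-- The convolution `∫ k(ζ⁻¹ z) f(ζ) dζ`. -/
def conv (μ : Measure G) (k f : G → ℝ) (z : G) : ℝ := ∫ ζ, k (ζ⁻¹ * z) * f ζ ∂μ

/-- Right translation `f ↦ f(· u⁻¹)` on `L²`. -/
def rtrans (μ : Measure G) [μ.IsMulRightInvariant] (u : G) : Lp ℝ 2 μ →ₗᵢ[ℝ] Lp ℝ 2 μ :=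
  Lp.compMeasurePreservingₗᵢ ℝ (fun z => z * u⁻¹) (measurePreserving_mul_right μ u⁻¹)

theorem coeFn_rtrans (u : G) (f : Lp ℝ 2 μ) : rtrans μ u f =ᵐ[μ] fun z => f (z * u⁻¹) :=
  Lp.coeFn_compMeasurePreserving f (measurePreserving_mul_right μ u⁻¹)

theorem inner_rtrans_rtrans (u v : G) (f g : Lp ℝ 2 μ) :
    ⟪rtrans μ u f, rtrans μ v g⟫ = ⟪rtrans μ (u * v⁻¹) f, g⟫ := by
  rw [L2.inner_def, L2.inner_def]
  have hv := measurePreserving_mul_right μ v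
  rw [← hv.integral_comp (MeasurableEquiv.mulRight v).measurableEmbedding]
  refine integral_congr_ae ?_
  have h1 := hv.quasiMeasurePreserving.ae_eq_comp (coeFn_rtrans (μ := μ) u f)
  have h2 := hv.quasiMeasurePreserving.ae_eq_comp (coeFn_rtrans (μ := μ) v g)
  filter_upwards [h1, h2, coeFn_rtrans (μ := μ) (u * v⁻¹) f] with z h1 h2 h3
  simp only [Function.comp_apply] at h1 h2
  rw [h1, h2, h3]
  simp [mul_assoc]

theorem rtrans_one (f : Lp ℝ 2 μ) : rtrans μ 1 f = f := by
  refine Lp.ext ?_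
  filter_upwards [coeFn_rtrans (μ := μ) 1 f] with z hz
  simpa using hz

theorem inner_rtrans_left (u : G) (f g : Lp ℝ 2 μ) :
    ⟪rtrans μ u f, g⟫ = ⟪f, rtrans μ u⁻¹ g⟫ := by
  have h := inner_rtrans_rtrans (μ := μ) 1 u⁻¹ f g
  rw [rtrans_one] at h
  rw [h]; simp

variable [LocallyCompactSpace G] [T2Space G] [μ.Regular]

theorem continuous_rtrans (f : Lp ℝ 2 μ) : Continuous fun u => rtrans μ u f := by
  let F : C(G, C(G, G)) := ContinuousMap.curry ⟨fun p : G × G => p.2 * p.1⁻¹, by fun_prop⟩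
  have hF : ∀ u, MeasurePreserving (F u) μ μ := fun u => measurePreserving_mul_right μ u⁻¹
  exact Continuous.compMeasurePreservingLp (f := fun _ : G => f) (g := F) continuous_const
    F.continuous hF ENNReal.ofNat_ne_top

theorem integrable_smul_rtrans {k : G → ℝ} (hk : Integrable k μ) (f : Lp ℝ 2 μ) :
    Integrable (fun u => k u • rtrans μ u f) μ := by
  refine (hk.norm.mul_const ‖f‖).mono' (hk.1.smul (continuous_rtrans f).aestronglyMeasurable)
    (Eventually.of_forall fun u => ?_)
  rw [norm_smul, LinearIsometry.norm_map]

/-- Convolution with an integrable kernel as an operator on `L²`, the superposition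
`∫ k(u) R_u du` of right translations. -/
def convOp {k : G → ℝ} (hk : Integrable k μ) : Lp ℝ 2 μ →L[ℝ] Lp ℝ 2 μ :=
  LinearMap.mkContinuous
    { toFun := fun f => ∫ u, k u • rtrans μ u f ∂μ
      map_add' := fun f g => by
        simp only [map_add, smul_add]
        exact integral_add (integrable_smul_rtrans hk f) (integrable_smul_rtrans hk g)
      map_smul' := fun c f => by
        simp only [map_smul, RingHom.id_apply, ← integral_smul, smul_comm c] }
    (∫ u, |k u| ∂μ) fun f => by
      refine (norm_integral_le_integral_norm _).trans (le_of_eq ?_)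
      simp only [norm_smul, LinearIsometry.norm_map, Real.norm_eq_abs, integral_mul_const]

theorem convOp_apply {k : G → ℝ} (hk : Integrable k μ) (f : Lp ℝ 2 μ) :
    convOp hk f = ∫ u, k u • rtrans μ u f ∂μ := rfl

theorem inner_convOp_left {k : G → ℝ} (hk : Integrable k μ) (f g : Lp ℝ 2 μ) :
    ⟪convOp hk f, g⟫ = ∫ u, k u * ⟪rtrans μ u f, g⟫ ∂μ := by
  rw [convOp_apply, real_inner_comm, ← integral_inner (integrable_smul_rtrans hk f)]
  refine integral_congr_ae (Eventually.of_forall fun u => ?_)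
  simp only [inner_smul_right, real_inner_comm]

theorem inner_convOp_right {k : G → ℝ} (hk : Integrable k μ) (f g : Lp ℝ 2 μ) :
    ⟪f, convOp hk g⟫ = ∫ u, k u * ⟪f, rtrans μ u g⟫ ∂μ := by
  rw [real_inner_comm, inner_convOp_left]
  simp only [real_inner_comm]

theorem star_convOp {k : G → ℝ} (hk : Integrable k μ) :
    star (convOp hk) = convOp (k := fun u => k u⁻¹) hk.comp_inv := by
  rw [ContinuousLinearMap.star_eq_adjoint, eq_comm, ContinuousLinearMap.eq_adjoint_iff]
  intro f g
  rw [inner_convOp_left, inner_convOp_right, ← integral_inv_eq_self]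
  refine integral_congr_ae (Eventually.of_forall fun u => ?_)
  simp [inner_rtrans_left]

theorem convOp_sum {ι : Type*} (s : Finset ι) {k : ι → G → ℝ} (hk : ∀ i, Integrable (k i) μ)
    {K : G → ℝ} (hK : Integrable K μ) (e : ∀ u, K u = ∑ i ∈ s, k i u) :
    convOp hK = ∑ i ∈ s, convOp (hk i) := by
  ext1 f
  rw [_root_.sum_apply]
  simp only [convOp_apply]
  rw [← integral_finsetSum _ fun i _ => integrable_smul_rtrans (hk i) f]
  simp only [e, Finset.sum_smul]

/-- Almost orthogonality: if `l` has integral zero and lives where the `L¹` modulus of continuity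
of `k` is at most `ω`, then `T_k† T_l` has norm at most `ω ‖l‖₁`. -/
theorem norm_star_convOp_mul_convOp_le {k l : G → ℝ} (hk : Integrable k μ) (hl : Integrable l μ)
    (hl0 : ∫ u, l u ∂μ = 0) {ω : ℝ} (hω : 0 ≤ ω)
    (hmod : ∀ u, l u ≠ 0 → ∫⁻ w, ‖k (w * u) - k w‖ₑ ∂μ ≤ ENNReal.ofReal ω) :
    ‖star (convOp hk) * convOp hl‖ ≤ ω * ∫ u, |l u| ∂μ := by
  have hI : 0 ≤ ∫ u, |l u| ∂μ := integral_nonneg fun _ => abs_nonneg _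
  refine ContinuousLinearMap.opNorm_le_of_re_inner_le (by positivity) fun f g hf hg => ?_
  have e0 : ⟪(star (convOp hk) * convOp hl) f, g⟫ = ⟪convOp hl f, convOp hk g⟫ := by
    rw [ContinuousLinearMap.star_eq_adjoint, mul_apply_eq_comp,
      ContinuousLinearMap.adjoint_inner_left]
  rw [RCLike.re_to_real, e0]
  set Φ : G → ℝ := fun w => ⟪rtrans μ w f, g⟫ with hΦ
  have hΦb : ∀ w, |Φ w| ≤ ‖f‖ * ‖g‖ := fun w => by
    refine (abs_real_inner_le_norm _ _).trans (le_of_eq ?_)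
    rw [LinearIsometry.norm_map]
  have hΦc : Continuous Φ := (continuous_rtrans f).inner continuous_const
  have ki : ∀ u, Integrable (fun w => k (w⁻¹ * u) * Φ w) μ := fun u =>
    Integrable.mul_bdd (c := ‖f‖ * ‖g‖)
      ((measurePreserving_inv_mul u).integrable_comp_of_integrable hk)
      hΦc.aestronglyMeasurable (Eventually.of_forall fun w => hΦb w)
  set c : ℝ := ∫ w, k (w⁻¹ * 1) * Φ w ∂μ with hc
  have e1 : ∀ u, ⟪rtrans μ u f, convOp hk g⟫ = ∫ w, k (w⁻¹ * u) * Φ w ∂μ := by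
    intro u
    rw [inner_convOp_right,
      ← (measurePreserving_inv_mul u).integral_comp (measurableEmbedding_inv_mul u)]
    refine integral_congr_ae (Eventually.of_forall fun w => ?_)
    simp [inner_rtrans_rtrans, hΦ]
  have e2 : ⟪convOp hl f, convOp hk g⟫ =
      ∫ u, l u * ∫ w, (k (w⁻¹ * u) * Φ w - k (w⁻¹ * 1) * Φ w) ∂μ ∂μ := by
    have hi : Integrable (fun u => l u * ⟪rtrans μ u f, convOp hk g⟫) μ := by
      refine Integrable.mul_bdd (c := ‖f‖ * ‖convOp hk g‖) hl
        ((continuous_rtrans f).inner continuous_const).aestronglyMeasurable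
        (Eventually.of_forall fun w => ?_)
      refine (abs_real_inner_le_norm _ _).trans (le_of_eq ?_)
      rw [LinearIsometry.norm_map]
    have : ∫ u, l u * c ∂μ = 0 := by rw [integral_mul_const, hl0, zero_mul]
    rw [inner_convOp_left, ← sub_zero (∫ u, l u * _ ∂μ), ← this,
      ← integral_sub hi (hl.mul_const c)]
    refine integral_congr_ae (Eventually.of_forall fun u => ?_)
    simp only
    rw [e1, integral_sub (ki u) (ki 1)]
    ring
  rw [e2]
  refine (le_abs_self _).trans ?_
  rw [← Real.norm_eq_abs]
  refine (norm_integral_le_of_norm_le (g := fun u => |l u| * (ω * (‖f‖ * ‖g‖)))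
    (hl.norm.mul_const _) (Eventually.of_forall fun u => ?_)).trans (le_of_eq ?_)
  · rw [norm_mul, Real.norm_eq_abs]
    by_cases hu : l u = 0
    · simp [hu]
    refine mul_le_mul_of_nonneg_left ?_ (abs_nonneg _)
    have h3 : ∫⁻ w, ‖k (w⁻¹ * u) - k (w⁻¹ * 1)‖ₑ ∂μ ≤ ENNReal.ofReal ω := by
      refine le_trans (le_of_eq ?_) (hmod u hu)
      rw [← (Measure.measurePreserving_inv μ).lintegral_comp_emb
        (MeasurableEquiv.inv G).measurableEmbedding (fun w => ‖k (w * u) - k w‖ₑ)]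
      simp
    have hd : Integrable (fun w => k (w⁻¹ * u) - k (w⁻¹ * 1)) μ :=
      ((measurePreserving_inv_mul u).integrable_comp_of_integrable hk).sub
        ((measurePreserving_inv_mul 1).integrable_comp_of_integrable hk)
    calc ‖∫ w, (k (w⁻¹ * u) * Φ w - k (w⁻¹ * 1) * Φ w) ∂μ‖
        ≤ ∫ w, |k (w⁻¹ * u) - k (w⁻¹ * 1)| * (‖f‖ * ‖g‖) ∂μ := by
          refine norm_integral_le_of_norm_le (hd.norm.mul_const _)
            (Eventually.of_forall fun w => ?_)
          rw [← sub_mul, norm_mul, Real.norm_eq_abs, Real.norm_eq_abs]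
          exact mul_le_mul_of_nonneg_left (hΦb w) (abs_nonneg _)
      _ = (∫ w, ‖k (w⁻¹ * u) - k (w⁻¹ * 1)‖ ∂μ) * (‖f‖ * ‖g‖) := by
          rw [integral_mul_const]; rfl
      _ ≤ ω * (‖f‖ * ‖g‖) := by
          refine mul_le_mul_of_nonneg_right ?_ (by positivity)
          rw [← ENNReal.ofReal_le_ofReal_iff hω, ofReal_integral_norm_eq_lintegral_enorm hd]
          exact h3
  · rw [integral_mul_const, hf, hg]; ring

end ConvolutionOperators

/-! ### Singular kernels and their dyadic pieces -/

section SingularKernel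

open scoped ENNReal RealInnerProductSpace

/-- A kernel of homogeneous type with constants normalised to one: size `N⁻ᴰ`, Lipschitz
regularity under left and right multiplication, and vanishing integrals over annuli. -/
structure IsSingularKernel {G : Type*} [Group G] [MeasurableSpace G] (μ : Measure G) (N : G → ℝ)
    (D : ℕ) (M : ℝ) (K : G → ℝ) : Prop where
  measurable : Measurable K
  size : ∀ u, |K u| ≤ (N u ^ D)⁻¹
  right : ∀ w v, M * N v ≤ N w → |K (w * v) - K w| ≤ N v / N w ^ (D + 1)
  left : ∀ w v, M * N v ≤ N w → |K (v * w) - K w| ≤ N v / N w ^ (D + 1)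
  cancel : ∀ a b, 0 < a → a < b → ∫ u in {u | a < N u ∧ N u ≤ b}, K u ∂μ = 0

/-- The restriction of a kernel to the annulus `a < N ≤ b`. -/
def annK {G : Type*} (N K : G → ℝ) (a b : ℝ) : G → ℝ := {u | a < N u ∧ N u ≤ b}.indicator K

theorem pow_sub_pow_mul_le {x y : ℝ} (hy : 0 ≤ y) (hxy : y ≤ x) (n : ℕ) :
    (x ^ n - y ^ n) * x ≤ n * (x - y) * x ^ n := by
  induction n with
  | zero => simp
  | succ n ih =>
    have h1 : y ^ n ≤ x ^ n := pow_le_pow_left₀ hy hxy n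
    have hx : 0 ≤ x := hy.trans hxy
    push_cast
    calc (x ^ (n + 1) - y ^ (n + 1)) * x
        = (x ^ n - y ^ n) * x * x + (x - y) * y ^ n * x := by ring
      _ ≤ n * (x - y) * x ^ n * x + (x - y) * x ^ n * x := by
          have h2 : 0 ≤ x - y := by linarith
          gcongr
      _ = _ := by ring

/-- Two kernels values at nearby points `w`, `w'` after restriction to an annulus: either both
vanish, or both are unrestricted, or `w` is close to the boundary of the annulus. -/
theorem annK_sub_annK_cases {G : Type*} {N K : G → ℝ} {D : ℕ}
    (size : ∀ u, |K u| ≤ (N u ^ D)⁻¹) {L M δ r : ℝ} {w w' : G} (hr : 0 < r) (hδ : 0 ≤ δ)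
    (hM : M * δ ≤ r / 2) (h1 : |N w' - N w| ≤ L * δ)
    (h2 : M * δ ≤ N w → |K w' - K w| ≤ δ / N w ^ (D + 1)) :
    annK N K r (2 * r) w' - annK N K r (2 * r) w = 0 ∨
    (|annK N K r (2 * r) w' - annK N K r (2 * r) w| ≤ δ * (2 / r) ^ (D + 1) ∧ N w < 4 * r) ∨
    (|annK N K r (2 * r) w' - annK N K r (2 * r) w| ≤ (r ^ D)⁻¹ ∧
      (|N w - r| ≤ L * δ ∨ |N w - 2 * r| ≤ L * δ)) := by
  have hK : ∀ u, r < N u → |K u| ≤ (r ^ D)⁻¹ := fun u hu => (size u).trans (by gcongr)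
  rw [abs_le] at h1
  by_cases hw : r < N w ∧ N w ≤ 2 * r <;> by_cases hw' : r < N w' ∧ N w' ≤ 2 * r
  · right; left
    have a1 : annK N K r (2 * r) w = K w := Set.indicator_of_mem (s := {u | r < N u ∧ N u ≤ _}) hw _
    have a2 : annK N K r (2 * r) w' = K w' :=
      Set.indicator_of_mem (s := {u | r < N u ∧ N u ≤ _}) hw' _
    rw [a1, a2]
    refine ⟨(h2 (by linarith)).trans ?_, by linarith⟩
    rw [div_eq_mul_inv, ← inv_div r 2, inv_pow]
    gcongr
    linarith
  · right; right
    have a1 : annK N K r (2 * r) w = K w := Set.indicator_of_mem (s := {u | r < N u ∧ N u ≤ _}) hw _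
    have a2 : annK N K r (2 * r) w' = 0 :=
      Set.indicator_of_notMem (s := {u | r < N u ∧ N u ≤ _}) hw' _
    rw [a1, a2, zero_sub, abs_neg]
    refine ⟨hK w hw.1, ?_⟩
    rw [abs_le, abs_le]
    by_cases h : r < N w'
    · right
      have : 2 * r < N w' := by by_contra h'; exact hw' ⟨h, not_lt.1 h'⟩
      constructor <;> linarith
    · left
      constructor <;> linarith
  · right; right
    have a1 : annK N K r (2 * r) w = 0 :=
      Set.indicator_of_notMem (s := {u | r < N u ∧ N u ≤ _}) hw _
    have a2 : annK N K r (2 * r) w' = K w' :=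
      Set.indicator_of_mem (s := {u | r < N u ∧ N u ≤ _}) hw' _
    rw [a1, a2, sub_zero]
    refine ⟨hK w' hw'.1, ?_⟩
    rw [abs_le, abs_le]
    by_cases h : r < N w
    · right
      have : 2 * r < N w := by by_contra h'; exact hw ⟨h, not_lt.1 h'⟩
      constructor <;> linarith
    · left
      constructor <;> linarith
  · left
    have a1 : annK N K r (2 * r) w = 0 :=
      Set.indicator_of_notMem (s := {u | r < N u ∧ N u ≤ _}) hw _
    have a2 : annK N K r (2 * r) w' = 0 :=
      Set.indicator_of_notMem (s := {u | r < N u ∧ N u ≤ _}) hw' _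
    rw [a1, a2, sub_zero]

variable {G : Type*} [Group G] [TopologicalSpace G] [IsTopologicalGroup G]
  [MeasurableSpace G] [BorelSpace G] {μ : Measure G}
  {N : G → ℝ} {κ V : ℝ} {D : ℕ} {M : ℝ} {K : G → ℝ}

theorem IsGauge.measurableSet_annulus (hN : IsGauge μ N κ V D) (a b : ℝ) :
    MeasurableSet {u | a < N u ∧ N u ≤ b} :=
  (measurableSet_lt measurable_const hN.continuous.measurable).inter
    (measurableSet_le hN.continuous.measurable measurable_const)

/-- A shell of relative thickness `h / a` around `{N = a}` has measure `O(h / a)` relative to the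
ball: this is the price of sharp truncations. -/
theorem IsGauge.measure_shell_le (hN : IsGauge μ N κ V D) {a h : ℝ} (ha : 0 < a) (hh : 0 < h)
    (h2 : 2 * h ≤ a) :
    μ {u | |N u - a| ≤ h} ≤ ENNReal.ofReal (3 * V * D * 2 ^ D * a ^ D * (h / a)) := by
  have hV := hN.V_pos
  have hm : MeasurableSet {u | N u < a - h} :=
    (isOpen_lt hN.continuous continuous_const).measurableSet
  have hsub : {u | |N u - a| ≤ h} ⊆ {u | N u < a + 2 * h} \ {u | N u < a - h} := by
    intro u hu
    have hu' : |N u - a| ≤ h := hu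
    rw [abs_le] at hu'
    refine ⟨show N u < a + 2 * h by linarith, fun h' => ?_⟩
    have : N u < a - h := h'
    linarith
  refine (measure_mono hsub).trans ?_
  rw [measure_sdiff (fun u hu => ?_) hm.nullMeasurableSet, hN.volume_lt _ (by linarith),
    hN.volume_lt _ (by linarith), ← ENNReal.ofReal_sub _ (by
      have : 0 < a - h := by linarith
      positivity)]
  · refine ENNReal.ofReal_le_ofReal ?_
    have h3 := pow_sub_pow_mul_le (x := a + 2 * h) (y := a - h) (by linarith) (by linarith) D
    have h4 : (a + 2 * h) ^ D ≤ (2 * a) ^ D := pow_le_pow_left₀ (by linarith) (by linarith) _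
    have h5 : 0 ≤ (a + 2 * h) ^ D - (a - h) ^ D :=
      sub_nonneg.2 (pow_le_pow_left₀ (by linarith) (by linarith) _)
    have h6 : ((a + 2 * h) ^ D - (a - h) ^ D) * a ≤ D * (3 * h) * (2 * a) ^ D := by
      calc _ ≤ ((a + 2 * h) ^ D - (a - h) ^ D) * (a + 2 * h) := by gcongr; linarith
        _ ≤ D * (a + 2 * h - (a - h)) * (a + 2 * h) ^ D := h3
        _ ≤ _ := by
          rw [show a + 2 * h - (a - h) = 3 * h by ring]
          gcongr
    rw [← mul_sub]
    calc V * ((a + 2 * h) ^ D - (a - h) ^ D)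
        = V * (((a + 2 * h) ^ D - (a - h) ^ D) * a) / a := by field_simp
      _ ≤ V * (D * (3 * h) * (2 * a) ^ D) / a := by gcongr
      _ = _ := by rw [mul_pow]; field_simp
  · rw [hN.volume_lt _ (by linarith)]; exact ENNReal.ofReal_ne_top
  · have hu' : N u < a - h := hu
    exact show N u < a + 2 * h by linarith

namespace IsSingularKernel

variable (hN : IsGauge μ N κ V D) (hK : IsSingularKernel μ N D M K)
include hN hK

theorem measurable_annK (a b : ℝ) : Measurable (annK N K a b) :=
  hK.measurable.indicator (hN.measurableSet_annulus a b)

theorem abs_annK_le {a : ℝ} (ha : 0 < a) (b : ℝ) (u : G) : |annK N K a b u| ≤ (a ^ D)⁻¹ := by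
  by_cases hu : u ∈ {u | a < N u ∧ N u ≤ b}
  · rw [annK, Set.indicator_of_mem hu]
    have h1 : a < N u := hu.1
    exact (hK.size u).trans (by gcongr)
  · rw [annK, Set.indicator_of_notMem hu, abs_zero]; positivity

theorem lintegral_annK_le {a b : ℝ} (ha : 0 < a) (hb : 0 < b) :
    ∫⁻ u, ‖annK N K a b u‖ₑ ∂μ ≤ ENNReal.ofReal ((a ^ D)⁻¹ * (V * (2 * b) ^ D)) := by
  have hV := hN.V_pos
  calc ∫⁻ u, ‖annK N K a b u‖ₑ ∂μ
      ≤ ∫⁻ u, {u | N u < 2 * b}.indicator (fun _ => ENNReal.ofReal (a ^ D)⁻¹) u ∂μ := by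
        refine lintegral_mono fun u => ?_
        by_cases hu : u ∈ {u | N u < 2 * b}
        · rw [Set.indicator_of_mem hu, Real.enorm_eq_ofReal_abs]
          exact ENNReal.ofReal_le_ofReal (hK.abs_annK_le hN ha b u)
        · have : annK N K a b u = 0 := Set.indicator_of_notMem
            (fun h => hu (show N u < 2 * b by have : N u ≤ b := h.2; linarith)) _
          simp [this]
    _ ≤ ENNReal.ofReal (a ^ D)⁻¹ * μ {u | N u < 2 * b} := lintegral_indicator_const_le _ _
    _ = _ := by
        rw [hN.volume_lt _ (by positivity), ← ENNReal.ofReal_mul (by positivity)]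

theorem integrable_annK {a b : ℝ} (ha : 0 < a) (hb : 0 < b) : Integrable (annK N K a b) μ :=
  ⟨(hK.measurable_annK hN a b).aestronglyMeasurable,
    (hK.lintegral_annK_le hN ha hb).trans_lt ENNReal.ofReal_lt_top⟩

theorem integral_abs_annK_le {r : ℝ} (hr : 0 < r) :
    ∫ u, |annK N K r (2 * r) u| ∂μ ≤ V * 4 ^ D := by
  have hV := hN.V_pos
  rw [← ENNReal.ofReal_le_ofReal_iff (by positivity)]
  refine (le_of_eq (ofReal_integral_norm_eq_lintegral_enorm
    (hK.integrable_annK hN hr (by positivity)))).trans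
    ((hK.lintegral_annK_le hN hr (by positivity)).trans (le_of_eq ?_))
  congr 1
  rw [show 2 * (2 * r) = 4 * r by ring, mul_pow]
  field_simp

theorem integral_annK {a b : ℝ} (ha : 0 < a) (hab : a < b) : ∫ u, annK N K a b u ∂μ = 0 := by
  rw [← hK.cancel a b ha hab, annK, integral_indicator (hN.measurableSet_annulus a b)]

/-- `L¹` continuity of a dyadic piece of the kernel under a map that moves points by at most a
multiple of `δ`. -/
theorem lintegral_annK_comp_sub_le {σ : G → G} (hσ : MeasurePreserving σ μ μ)
    (hσe : MeasurableEmbedding σ) {L δ r : ℝ} (hL1 : 1 ≤ L) (hM1 : 1 ≤ M) (hr : 0 < r)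
    (hδ : 0 < δ) (h1 : ∀ w, |N (σ w) - N w| ≤ L * δ)
    (h2 : ∀ w, M * δ ≤ N w → |K (σ w) - K w| ≤ δ / N w ^ (D + 1)) :
    ∫⁻ w, ‖annK N K r (2 * r) (σ w) - annK N K r (2 * r) w‖ₑ ∂μ ≤
      ENNReal.ofReal (V * 16 ^ D * (8 + 12 * D) * (L + M) * (δ / r)) := by
  have hV := hN.V_pos
  have hLM : 0 < L + M := by linarith
  have h16 : (4 : ℝ) ^ D ≤ 16 ^ D := pow_le_pow_left₀ (by norm_num) (by norm_num) _
  by_cases hs : 4 * (L + M) * δ ≤ r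
  · have hL : L * δ ≤ r / 4 := by nlinarith
    have hM : M * δ ≤ r / 4 := by nlinarith
    set S1 : Set G := {u | N u < 4 * r}
    set S2 : Set G := {u | |N u - r| ≤ L * δ}
    set S3 : Set G := {u | |N u - 2 * r| ≤ L * δ}
    have mS1 : MeasurableSet S1 := (isOpen_lt hN.continuous continuous_const).measurableSet
    have mS2 : MeasurableSet S2 :=
      measurableSet_le ((hN.continuous.measurable.sub_const _).norm) measurable_const
    set c1 : ℝ := δ * (2 / r) ^ (D + 1)
    set c2 : ℝ := (r ^ D)⁻¹
    have pt : ∀ w, ‖annK N K r (2 * r) (σ w) - annK N K r (2 * r) w‖ₑ ≤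
        S1.indicator (fun _ => ENNReal.ofReal c1) w +
        (S2.indicator (fun _ => ENNReal.ofReal c2) w +
          S3.indicator (fun _ => ENNReal.ofReal c2) w) := by
      intro w
      rcases annK_sub_annK_cases (w := w) (w' := σ w) hK.size hr hδ.le
        (by linarith) (h1 w) (h2 w) with h | ⟨h, hw⟩ | ⟨h, hw | hw⟩
      · rw [h]; simp
      · rw [Set.indicator_of_mem (show w ∈ S1 from hw), Real.enorm_eq_ofReal_abs]
        exact (ENNReal.ofReal_le_ofReal h).trans le_self_add
      · rw [Set.indicator_of_mem (show w ∈ S2 from hw), Real.enorm_eq_ofReal_abs]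
        exact (ENNReal.ofReal_le_ofReal h).trans (le_self_add.trans le_add_self)
      · rw [Set.indicator_of_mem (show w ∈ S3 from hw), Real.enorm_eq_ofReal_abs]
        exact (ENNReal.ofReal_le_ofReal h).trans (le_add_self.trans le_add_self)
    have hc1 : 0 ≤ c1 := by positivity
    have hc2 : 0 ≤ c2 := by positivity
    calc _ ≤ ∫⁻ w, (S1.indicator (fun _ => ENNReal.ofReal c1) w +
        (S2.indicator (fun _ => ENNReal.ofReal c2) w +
          S3.indicator (fun _ => ENNReal.ofReal c2) w)) ∂μ := lintegral_mono pt
      _ = ∫⁻ w, S1.indicator (fun _ => ENNReal.ofReal c1) w ∂μ +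
          (∫⁻ w, S2.indicator (fun _ => ENNReal.ofReal c2) w ∂μ +
            ∫⁻ w, S3.indicator (fun _ => ENNReal.ofReal c2) w ∂μ) := by
          rw [lintegral_add_left (measurable_const.indicator mS1),
            lintegral_add_left (measurable_const.indicator mS2)]
      _ ≤ ENNReal.ofReal c1 * μ S1 + (ENNReal.ofReal c2 * μ S2 + ENNReal.ofReal c2 * μ S3) := by
          gcongr <;> exact lintegral_indicator_const_le _ _
      _ ≤ ENNReal.ofReal c1 * ENNReal.ofReal (V * (4 * r) ^ D) +
          (ENNReal.ofReal c2 * ENNReal.ofReal (3 * V * D * 2 ^ D * r ^ D * (L * δ / r)) +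
          ENNReal.ofReal c2 *
            ENNReal.ofReal (3 * V * D * 2 ^ D * (2 * r) ^ D * (L * δ / (2 * r)))) := by
          gcongr
          · exact (hN.volume_lt _ (by positivity)).le
          · exact hN.measure_shell_le hr (by positivity) (by linarith)
          · exact hN.measure_shell_le (by positivity) (by positivity) (by linarith)
      _ ≤ _ := by
          rw [← ENNReal.ofReal_mul hc1, ← ENNReal.ofReal_mul hc2, ← ENNReal.ofReal_mul hc2,
            ← ENNReal.ofReal_add (by positivity) (by positivity),
            ← ENNReal.ofReal_add (by positivity) (by positivity)]
          refine ENNReal.ofReal_le_ofReal ?_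
          have e1 : c1 * (V * (4 * r) ^ D) = 2 * (V * 8 ^ D * (δ / r)) := by
            simp only [c1]
            rw [show (8 : ℝ) = 2 * 4 by norm_num, mul_pow, mul_pow, div_pow, pow_succ, pow_succ]
            field_simp
          have e2 : c2 * (3 * V * D * 2 ^ D * r ^ D * (L * δ / r)) =
              3 * V * D * 2 ^ D * L * (δ / r) := by
            simp only [c2]; field_simp
          have e3 : c2 * (3 * V * D * 2 ^ D * (2 * r) ^ D * (L * δ / (2 * r))) =
              3 / 2 * V * D * 4 ^ D * L * (δ / r) := by
            simp only [c2]
            rw [show (4 : ℝ) = 2 * 2 by norm_num, mul_pow, mul_pow]; field_simp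
          rw [e1, e2, e3]
          have p8 : (8 : ℝ) ^ D ≤ 16 ^ D := pow_le_pow_left₀ (by norm_num) (by norm_num) _
          have p2 : (2 : ℝ) ^ D ≤ 16 ^ D := pow_le_pow_left₀ (by norm_num) (by norm_num) _
          have q1 : 2 * (V * 8 ^ D * (δ / r)) ≤ V * 16 ^ D * 8 * (L + M) * (δ / r) := by
            calc 2 * (V * 8 ^ D * (δ / r)) = V * 8 ^ D * 2 * 1 * (δ / r) := by ring
              _ ≤ V * 16 ^ D * 8 * (L + M) * (δ / r) := by gcongr <;> linarith
          have q2 : 3 * V * D * 2 ^ D * L * (δ / r) ≤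
              V * 16 ^ D * (6 * D) * (L + M) * (δ / r) := by
            calc 3 * V * D * 2 ^ D * L * (δ / r) = V * 2 ^ D * (3 * D) * L * (δ / r) := by ring
              _ ≤ _ := by gcongr <;> linarith
          have q3 : 3 / 2 * V * D * 4 ^ D * L * (δ / r) ≤
              V * 16 ^ D * (6 * D) * (L + M) * (δ / r) := by
            calc 3 / 2 * V * D * 4 ^ D * L * (δ / r)
                = V * 4 ^ D * (3 / 2 * D) * L * (δ / r) := by ring
              _ ≤ _ := by gcongr <;> linarith
          calc _ ≤ V * 16 ^ D * 8 * (L + M) * (δ / r) + (V * 16 ^ D * (6 * D) * (L + M) * (δ / r)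
                + V * 16 ^ D * (6 * D) * (L + M) * (δ / r)) := add_le_add q1 (add_le_add q2 q3)
            _ = _ := by ring
  · push Not at hs
    have hi := hK.lintegral_annK_le hN hr (b := 2 * r) (by positivity)
    calc _ ≤ ∫⁻ w, (‖annK N K r (2 * r) (σ w)‖ₑ + ‖annK N K r (2 * r) w‖ₑ) ∂μ :=
          lintegral_mono fun w => enorm_sub_le
      _ = ∫⁻ w, ‖annK N K r (2 * r) w‖ₑ ∂μ + ∫⁻ w, ‖annK N K r (2 * r) w‖ₑ ∂μ := by
          rw [lintegral_add_right _ (hK.measurable_annK hN _ _).enorm,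
            hσ.lintegral_comp_emb hσe (fun w => ‖annK N K r (2 * r) w‖ₑ)]
      _ ≤ _ := by
          refine (add_le_add hi hi).trans ?_
          rw [← ENNReal.ofReal_add (by positivity) (by positivity)]
          refine ENNReal.ofReal_le_ofReal ?_
          have e : (r ^ D)⁻¹ * (V * (2 * (2 * r)) ^ D) = V * 4 ^ D := by
            rw [show 2 * (2 * r) = 4 * r by ring, mul_pow]; field_simp
          have h3 : 1 ≤ 4 * ((L + M) * (δ / r)) := by
            rw [mul_div_assoc', mul_div_assoc', one_le_div hr]; linarith
          rw [e]
          calc V * 4 ^ D + V * 4 ^ D = V * 4 ^ D * 2 * 1 := by ring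
            _ ≤ V * 16 ^ D * 2 * (4 * ((L + M) * (δ / r))) := by gcongr
            _ = V * 16 ^ D * 8 * ((L + M) * (δ / r)) := by ring
            _ ≤ V * 16 ^ D * (8 + 12 * D) * ((L + M) * (δ / r)) := by
                gcongr
                have : (0 : ℝ) ≤ D := by positivity
                linarith
            _ = _ := by ring

end IsSingularKernel

end SingularKernel

/-! ### Uniform `L²` bounds for truncated singular integrals -/

section L2Bound

open scoped ENNReal RealInnerProductSpace

theorem sum_geometric_two_sided_le (n i : ℕ) :
    ∑ j ∈ Finset.range n, (3 / 4 : ℝ) ^ ((i - j) + (j - i)) ≤ 8 := by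
  have geo : ∀ m, ∑ j ∈ Finset.range m, (3 / 4 : ℝ) ^ j ≤ 4 := fun m => by
    rw [geom_sum_eq (by norm_num)]
    have : (0 : ℝ) < (3 / 4) ^ m := by positivity
    rw [div_le_iff_of_neg (by norm_num)]
    linarith
  calc ∑ j ∈ Finset.range n, (3 / 4 : ℝ) ^ ((i - j) + (j - i))
      ≤ ∑ j ∈ Finset.range (i + 1 + n), (3 / 4 : ℝ) ^ ((i - j) + (j - i)) :=
        Finset.sum_le_sum_of_subset_of_nonneg (Finset.range_mono (by omega))
          fun _ _ _ => by positivity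
    _ = ∑ j ∈ Finset.range (i + 1), (3 / 4 : ℝ) ^ (i + 1 - 1 - j) +
        ∑ j ∈ Finset.range n, (3 / 4 : ℝ) ^ j * (3 / 4) := by
        rw [Finset.sum_range_add]
        congr 1
        · refine Finset.sum_congr rfl fun j hj => ?_
          congr 1
          have := Finset.mem_range.1 hj
          omega
        · refine Finset.sum_congr rfl fun j _ => ?_
          rw [← pow_succ]
          congr 1
          omega
    _ ≤ 4 + 4 * (3 / 4) := by
        rw [Finset.sum_range_reflect (fun k => (3 / 4 : ℝ) ^ k) (i + 1), ← Finset.sum_mul]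
        gcongr
        · exact geo _
        · exact geo _
    _ ≤ 8 := by norm_num

variable {G : Type*} [Group G] [TopologicalSpace G] [IsTopologicalGroup G]
  [MeasurableSpace G] [BorelSpace G] {μ : Measure G}
  {N : G → ℝ} {κ V : ℝ} {D : ℕ} {M : ℝ} {K : G → ℝ}
  [SecondCountableTopology G] [μ.IsMulRightInvariant] [μ.IsInvInvariant]

theorem measurePreserving_mul_left_of_inv (v : G) :
    MeasurePreserving (fun w : G => v * w) μ μ := by
  have h := (Measure.measurePreserving_inv μ).comp (measurePreserving_inv_mul (μ := μ) v⁻¹)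
  convert h using 1
  ext w; simp

theorem IsGauge.abs_mul_right_sub_le (hN : IsGauge μ N κ V D) (w v : G) :
    |N (w * v) - N w| ≤ κ ^ 2 * N v := by
  have h1 := hN.mul_le w v
  have h2 := hN.le_mul_right w v
  have h3 := mul_le_mul_of_nonneg_right (mul_le_mul_of_nonneg_right hN.one_le hN.kappa_pos.le)
    (hN.nonneg v)
  rw [abs_le]
  constructor <;> nlinarith

theorem IsGauge.abs_mul_left_sub_le (hN : IsGauge μ N κ V D) (w v : G) :
    |N (v * w) - N w| ≤ κ ^ 2 * N v := by
  have h1 := hN.mul_le' w v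
  have h2 := hN.le_mul_left w v
  have h3 := mul_le_mul_of_nonneg_right (mul_le_mul_of_nonneg_right hN.one_le hN.kappa_pos.le)
    (hN.nonneg v)
  rw [abs_le]
  constructor <;> nlinarith

namespace IsSingularKernel

variable (hN : IsGauge μ N κ V D) (hK : IsSingularKernel μ N D M K) (hM : 1 ≤ M)
include hN hK hM

theorem lintegral_annK_mul_right_sub_le {r δ : ℝ} (hr : 0 < r) (hδ : 0 < δ) {v : G}
    (hv : N v ≤ δ) :
    ∫⁻ w, ‖annK N K r (2 * r) (w * v) - annK N K r (2 * r) w‖ₑ ∂μ ≤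
      ENNReal.ofReal (V * 16 ^ D * (8 + 12 * D) * (κ ^ 2 + M) * (δ / r)) := by
  refine hK.lintegral_annK_comp_sub_le hN (measurePreserving_mul_right μ v)
    (MeasurableEquiv.mulRight v).measurableEmbedding (one_le_pow₀ hN.one_le) hM hr hδ
    (fun w => (hN.abs_mul_right_sub_le w v).trans (by gcongr)) fun w hw => ?_
  have := hN.nonneg w
  exact (hK.right w v ((mul_le_mul_of_nonneg_left hv (by linarith)).trans hw)).trans
    (by gcongr)

theorem lintegral_annK_mul_left_sub_le {r δ : ℝ} (hr : 0 < r) (hδ : 0 < δ) {v : G}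
    (hv : N v ≤ δ) :
    ∫⁻ w, ‖annK N K r (2 * r) (v * w) - annK N K r (2 * r) w‖ₑ ∂μ ≤
      ENNReal.ofReal (V * 16 ^ D * (8 + 12 * D) * (κ ^ 2 + M) * (δ / r)) := by
  refine hK.lintegral_annK_comp_sub_le hN (measurePreserving_mul_left_of_inv v)
    (MeasurableEquiv.mulLeft v).measurableEmbedding (one_le_pow₀ hN.one_le) hM hr hδ
    (fun w => (hN.abs_mul_left_sub_le w v).trans (by gcongr)) fun w hw => ?_
  have := hN.nonneg w
  exact (hK.left w v ((mul_le_mul_of_nonneg_left hv (by linarith)).trans hw)).trans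
    (by gcongr)

variable [LocallyCompactSpace G] [T2Space G] [μ.Regular]

/-- The two almost orthogonality estimates between dyadic pieces of the kernel. -/
theorem almost_orthogonal {r s : ℝ} (hr : 0 < r) (hs : 0 < s) :
    ‖star (convOp (hK.integrable_annK hN hr (b := 2 * r) (by positivity))) *
        convOp (hK.integrable_annK hN hs (b := 2 * s) (by positivity))‖ ≤
      V * 16 ^ D * (8 + 12 * D) * (κ ^ 2 + M) * (2 * s / r) * (V * 4 ^ D) ∧
    ‖convOp (hK.integrable_annK hN hr (b := 2 * r) (by positivity)) *
        star (convOp (hK.integrable_annK hN hs (b := 2 * s) (by positivity)))‖ ≤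
      V * 16 ^ D * (8 + 12 * D) * (κ ^ 2 + M) * (2 * s / r) * (V * 4 ^ D) := by
  have hV := hN.V_pos
  have hki := hK.integrable_annK hN hr (b := 2 * r) (by positivity)
  have hli := hK.integrable_annK hN hs (b := 2 * s) (by positivity)
  have hsupp : ∀ u, annK N K s (2 * s) u ≠ 0 → N u ≤ 2 * s := fun u hu => by
    by_contra h
    exact hu (Set.indicator_of_notMem (fun h' => h h'.2) _)
  set ω : ℝ := V * 16 ^ D * (8 + 12 * D) * (κ ^ 2 + M) * (2 * s / r) with hω
  have hω0 : 0 ≤ ω := by have : 0 ≤ M := by linarith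
                         positivity
  have hl1 := hK.integral_abs_annK_le hN hs
  have hl0 := hK.integral_annK hN hs (b := 2 * s) (by linarith)
  constructor
  · refine (norm_star_convOp_mul_convOp_le hki hli hl0 hω0 fun u hu => ?_).trans
      (mul_le_mul_of_nonneg_left hl1 hω0)
    exact hK.lintegral_annK_mul_right_sub_le hN hM hr (by positivity) (hsupp u hu)
  -- the second estimate is the first one for the reflected kernels `u ↦ K (u⁻¹)`
  · have e : convOp hki * star (convOp hli) =
        star (convOp (k := fun u => annK N K r (2 * r) u⁻¹) hki.comp_inv) *
          convOp (k := fun u => annK N K s (2 * s) u⁻¹) hli.comp_inv := by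
      rw [← star_convOp hki, ← star_convOp hli, star_star]
    rw [e]
    refine (norm_star_convOp_mul_convOp_le hki.comp_inv hli.comp_inv ?_ hω0
      fun u hu => ?_).trans (mul_le_mul_of_nonneg_left ?_ hω0)
    · rw [integral_inv_eq_self (fun u => annK N K s (2 * s) u)]; exact hl0
    · refine le_trans (le_of_eq ?_)
        (hK.lintegral_annK_mul_left_sub_le hN hM hr (by positivity) (v := u⁻¹) (hsupp _ hu))
      rw [← (Measure.measurePreserving_inv μ).lintegral_comp_emb
        (MeasurableEquiv.inv G).measurableEmbedding
        (fun w => ‖annK N K r (2 * r) (u⁻¹ * w) - annK N K r (2 * r) w‖ₑ)]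
      simp
    · rw [integral_inv_eq_self (fun u => |annK N K s (2 * s) u|)]; exact hl1

/-- Uniform `L²` operator bound for the kernel restricted to `ε < N ≤ 2ⁿ ε`. -/
theorem norm_convOp_le {ε : ℝ} (hε : 0 < ε) (n : ℕ) :
    ‖convOp (hK.integrable_annK hN hε (b := 2 ^ n * ε) (by positivity))‖ ≤
      √(V * 16 ^ D * (8 + 12 * D) * (κ ^ 2 + M) * 2 * (V * 4 ^ D)) * 8 := by
  have hV := hN.V_pos
  set C : ℝ := V * 16 ^ D * (8 + 12 * D) * (κ ^ 2 + M) * 2 * (V * 4 ^ D) with hC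
  have hκ := hN.kappa_pos
  have hC0 : 0 < C := by have : 0 < M := by linarith
                         positivity
  have hr : ∀ i : ℕ, 0 < 2 ^ i * ε := fun i => by positivity
  have hi : ∀ i : ℕ, Integrable (annK N K (2 ^ i * ε) (2 * (2 ^ i * ε))) μ := fun i =>
    hK.integrable_annK hN (hr i) (by have := hr i; positivity)
  have tele : ∀ u, annK N K ε (2 ^ n * ε) u =
      ∑ i : Fin n, annK N K (2 ^ (i : ℕ) * ε) (2 * (2 ^ (i : ℕ) * ε)) u := by
    intro u
    rw [Fin.sum_univ_eq_sum_range (fun i => annK N K (2 ^ i * ε) (2 * (2 ^ i * ε)) u) n]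
    induction n with
    | zero =>
      simp only [pow_zero, one_mul, Finset.range_zero, Finset.sum_empty]
      exact Set.indicator_of_notMem (fun h => absurd (h.1.trans_le h.2) (lt_irrefl _)) _
    | succ n ih =>
      rw [Finset.sum_range_succ, ← ih]
      have h1 : ε ≤ 2 ^ n * ε := le_mul_of_one_le_left hε.le (one_le_pow₀ one_le_two)
      have e : (2 : ℝ) ^ (n + 1) * ε = 2 * (2 ^ n * ε) := by ring
      have h2 := hr n
      simp only [annK, Set.indicator_apply, Set.mem_ofPred_eq, e]
      by_cases a1 : N u ≤ 2 ^ n * ε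
      · simp [a1, not_lt.2 a1, a1.trans (by linarith : 2 ^ n * ε ≤ 2 * (2 ^ n * ε))]
      · push Not at a1
        simp [not_le.2 a1, a1, h1.trans_lt a1]
  rw [convOp_sum Finset.univ (fun i : Fin n => hi i) _ tele]
  -- almost orthogonality gives the factor `2 ^ (-|i - j|)`, whose square root is below `3 / 4`
  have hstep : ∀ i j : ℕ, j ≤ i → C * (2 ^ j * ε / (2 ^ i * ε)) ≤
      (√C * (3 / 4) ^ ((i - j) + (j - i))) ^ 2 := by
    intro i j hij
    rw [mul_pow, Real.sq_sqrt hC0.le, mul_div_mul_right _ _ hε.ne', Nat.sub_eq_zero_of_le hij,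
      add_zero, ← pow_mul, mul_comm (i - j) 2, pow_mul]
    refine mul_le_mul_of_nonneg_left ?_ hC0.le
    obtain ⟨k, rfl⟩ := Nat.exists_eq_add_of_le hij
    rw [Nat.add_sub_cancel_left, pow_add, ← div_div, div_self (by positivity), one_div,
      ← inv_pow]
    exact pow_le_pow_left₀ (by norm_num) (by norm_num) _
  have horth : ∀ i j : ℕ, j ≤ i →
      ‖star (convOp (hi i)) * convOp (hi j)‖ ≤ (√C * (3 / 4) ^ ((i - j) + (j - i))) ^ 2 ∧
      ‖convOp (hi i) * star (convOp (hi j))‖ ≤ (√C * (3 / 4) ^ ((i - j) + (j - i))) ^ 2 := by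
    intro i j hij
    have h := hK.almost_orthogonal hN hM (hr i) (hr j)
    have e : V * 16 ^ D * (8 + 12 * D) * (κ ^ 2 + M) * (2 * (2 ^ j * ε) / (2 ^ i * ε)) *
        (V * 4 ^ D) = C * (2 ^ j * ε / (2 ^ i * ε)) := by rw [hC]; ring
    rw [e] at h
    exact ⟨h.1.trans (hstep i j hij), h.2.trans (hstep i j hij)⟩
  have hsymm : ∀ i j : ℕ, (i - j) + (j - i) = (j - i) + (i - j) := fun i j => add_comm _ _
  have hnorm_star : ∀ S : Lp ℝ 2 μ →L[ℝ] Lp ℝ 2 μ, ‖star S‖ = ‖S‖ := fun S => norm_star S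
  refine norm_sum_le_of_almost_orthogonal
    (γ := fun i j : Fin n => √C * (3 / 4) ^ (((i : ℕ) - j) + ((j : ℕ) - i)))
    (by positivity) (fun i j => by positivity) (fun i => ?_) (fun i j => ?_) (fun i j => ?_)
  · rw [← Finset.mul_sum,
      Fin.sum_univ_eq_sum_range (fun j => (3 / 4 : ℝ) ^ (((i : ℕ) - j) + (j - i))) n]
    exact mul_le_mul_of_nonneg_left (sum_geometric_two_sided_le n i) (Real.sqrt_nonneg _)
  · rcases le_total (j : ℕ) i with h | h
    · exact (horth i j h).1
    · have h1 := (horth j i h).1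
      rw [hsymm, ← hnorm_star, star_mul, star_star] at h1
      exact h1
  · rcases le_total (j : ℕ) i with h | h
    · exact (horth i j h).2
    · have h1 := (horth j i h).2
      rw [hsymm, ← hnorm_star, star_mul, star_star] at h1
      exact h1

end IsSingularKernel

section Functions

variable [LocallyCompactSpace G] [T2Space G] [μ.Regular]

theorem integrable_conv_kernel {k f : G → ℝ} (hk : Integrable k μ) (hf : Integrable f μ) :
    Integrable (fun p : G × G => k p.1 * f (p.2 * p.1⁻¹)) (μ.prod μ) := by
  have hp : MeasurePreserving (fun p : G × G => (p.1, p.2 * p.1⁻¹)) (μ.prod μ) (μ.prod μ) :=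
    (MeasurePreserving.id μ).skew_product (g := fun a b => b * a⁻¹) (by fun_prop)
      (Eventually.of_forall fun u => (measurePreserving_mul_right μ u⁻¹).map_eq)
  exact hp.integrable_comp_of_integrable (hk.mul_prod hf)

theorem conv_eq_integral (k f : G → ℝ) (z : G) :
    conv μ k f z = ∫ u, k u * f (z * u⁻¹) ∂μ := by
  rw [conv, ← (measurePreserving_inv_mul z).integral_comp (measurableEmbedding_inv_mul z)
    (fun u => k u * f (z * u⁻¹))]
  simp

theorem integrable_conv {k f : G → ℝ} (hk : Integrable k μ) (hf : Integrable f μ) :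
    Integrable (conv μ k f) μ := by
  have := (integrable_conv_kernel hk hf).integral_prod_right
  exact this.congr (Eventually.of_forall fun z => (conv_eq_integral k f z).symm)

theorem abs_conv_le {k f : G → ℝ} (hk : Integrable k μ) {b : ℝ}
    (hb : ∀ᵐ z ∂μ, |f z| ≤ b) (z : G) : |conv μ k f z| ≤ (∫ u, |k u| ∂μ) * b := by
  have hi := (measurePreserving_inv_mul z).integrable_comp_of_integrable hk
  calc |conv μ k f z| ≤ ∫ ζ, |k (ζ⁻¹ * z)| * b ∂μ := by
        rw [← Real.norm_eq_abs, conv]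
        refine norm_integral_le_of_norm_le (hi.norm.mul_const b) ?_
        filter_upwards [hb] with ζ hζ
        rw [norm_mul]
        exact mul_le_mul_of_nonneg_left hζ (norm_nonneg _)
    _ = _ := by
        rw [integral_mul_const,
          (measurePreserving_inv_mul z).integral_comp (measurableEmbedding_inv_mul z)
            (fun u => |k u|)]

theorem memLp_two_of_bounded {f : G → ℝ} (hf : Integrable f μ) {b : ℝ}
    (hb : ∀ᵐ z ∂μ, |f z| ≤ b) : MemLp f 2 μ := by
  rw [memLp_two_iff_integrable_sq hf.1]
  refine (hf.norm.mul_const b).mono' (hf.1.pow 2) ?_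
  filter_upwards [hb] with z hz
  rw [norm_pow, sq]
  exact mul_le_mul_of_nonneg_left hz (norm_nonneg _)

/-- The operator `convOp` is convolution. -/
theorem inner_convOp_toLp {k f g : G → ℝ} (hk : Integrable k μ) (hf : Integrable f μ) {b : ℝ}
    (hb : ∀ z, |f z| ≤ b) (hf2 : MemLp f 2 μ) (hg : Integrable g μ) (hg2 : MemLp g 2 μ) :
    ⟪convOp hk hf2.toLp, hg2.toLp⟫ = ∫ z, conv μ k f z * g z ∂μ := by
  have e1 : ∀ u, ⟪rtrans μ u hf2.toLp, hg2.toLp⟫ = ∫ z, f (z * u⁻¹) * g z ∂μ := by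
    intro u
    rw [L2.inner_def]
    refine integral_congr_ae ?_
    have h1 := (measurePreserving_mul_right μ u⁻¹).quasiMeasurePreserving.ae_eq_comp
      hf2.coeFn_toLp
    filter_upwards [coeFn_rtrans u hf2.toLp, h1, hg2.coeFn_toLp] with z h1 h2 h3
    simp only [Function.comp_apply] at h2
    rw [h1, h2, h3]
    simp [mul_comm]
  rw [inner_convOp_left]
  simp only [e1, ← integral_const_mul]
  rw [integral_integral_swap]
  · refine integral_congr_ae (Eventually.of_forall fun z => ?_)
    simp only
    rw [conv_eq_integral, ← integral_mul_const]
    simp only [mul_assoc]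
  · have hb0 : 0 ≤ b := (abs_nonneg _).trans (hb 1)
    refine ((hk.norm.mul_prod hg.norm).mul_const b).mono' ?_ (Eventually.of_forall fun p => ?_)
    · have h1 := (integrable_conv_kernel hk hf).1.mul (hg.1.comp_snd (μ := μ))
      refine h1.congr (Eventually.of_forall fun p => ?_)
      simp [Function.uncurry, mul_assoc]
    · simp only [Function.uncurry, norm_mul]
      have := hb (p.2 * p.1⁻¹)
      rw [← Real.norm_eq_abs] at this
      calc ‖k p.1‖ * (‖f (p.2 * p.1⁻¹)‖ * ‖g p.2‖) ≤ ‖k p.1‖ * (b * ‖g p.2‖) := by gcongr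
        _ = _ := by ring

theorem conv_congr {k f f' : G → ℝ} (h : f =ᵐ[μ] f') : conv μ k f = conv μ k f' := by
  ext z
  refine integral_congr_ae ?_
  filter_upwards [h] with ζ hζ
  rw [hζ]

/-- An operator bound for `convOp` is an `L²` bound for convolution. -/
theorem integral_conv_sq_le {k f : G → ℝ} (hk : Integrable k μ) (hf : Integrable f μ) {b : ℝ}
    (hb : ∀ᵐ z ∂μ, |f z| ≤ b) :
    ∫ z, conv μ k f z ^ 2 ∂μ ≤ ‖convOp hk‖ ^ 2 * ∫ z, f z ^ 2 ∂μ := by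
  -- a representative that is bounded everywhere
  set f' : G → ℝ := fun z => max (-|b|) (min |b| (f z)) with hf'
  have hff' : f =ᵐ[μ] f' := by
    filter_upwards [hb] with z hz
    have h1 := abs_le.1 (hz.trans (le_abs_self b))
    simp [hf', h1.1, h1.2]
  have hb' : ∀ z, |f' z| ≤ |b| := fun z => by
    rw [abs_le]
    exact ⟨le_max_left _ _, max_le (by linarith [abs_nonneg b]) (min_le_left _ _)⟩
  have hfi : Integrable f' μ := hf.congr hff'
  have e2 : ∫ z, f z ^ 2 ∂μ = ∫ z, f' z ^ 2 ∂μ := integral_congr_ae (by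
    filter_upwards [hff'] with z hz
    rw [hz])
  rw [conv_congr hff', e2]
  set c := conv μ k f' with hc
  have hf2 : MemLp f' 2 μ := memLp_two_of_bounded hfi (Eventually.of_forall hb')
  have hci : Integrable c μ := integrable_conv hk hfi
  have hc2 : MemLp c 2 μ := memLp_two_of_bounded hci
    (Eventually.of_forall fun z => abs_conv_le hk (Eventually.of_forall hb') z)
  have nsq : ∀ {h : G → ℝ} (hh : MemLp h 2 μ), ‖hh.toLp‖ ^ 2 = ∫ z, h z ^ 2 ∂μ := by
    intro h hh
    rw [← real_inner_self_eq_norm_sq, L2.inner_def]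
    refine integral_congr_ae ?_
    filter_upwards [hh.coeFn_toLp] with z hz
    simp [hz, sq]
  have h1 := inner_convOp_toLp hk hfi hb' hf2 hci hc2
  have h2 : ‖hc2.toLp‖ ^ 2 ≤ ‖convOp hk‖ * ‖hf2.toLp‖ * ‖hc2.toLp‖ := by
    calc ‖hc2.toLp‖ ^ 2 = ⟪convOp hk hf2.toLp, hc2.toLp⟫ := by
          rw [h1, nsq hc2]; simp only [← hc, sq]
      _ ≤ ‖convOp hk hf2.toLp‖ * ‖hc2.toLp‖ := real_inner_le_norm _ _
      _ ≤ _ := mul_le_mul_of_nonneg_right ((convOp hk).le_opNorm _) (norm_nonneg _)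
  have h3 : ‖hc2.toLp‖ ≤ ‖convOp hk‖ * ‖hf2.toLp‖ := by
    rcases eq_or_lt_of_le (norm_nonneg hc2.toLp) with h0 | h0
    · rw [← h0]; positivity
    · rw [sq] at h2; exact le_of_mul_le_mul_right h2 h0
  rw [← nsq hc2, ← nsq hf2, ← mul_pow]
  exact pow_le_pow_left₀ (norm_nonneg _) h3 2

end Functions

end L2Bound

/-! ### Maximal truncations: the bounded part -/

section GoodPart

open scoped ENNReal

variable {G : Type*} [Group G] [TopologicalSpace G] [IsTopologicalGroup G]
  [MeasurableSpace G] [BorelSpace G] {μ : Measure G}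
  {N : G → ℝ} {κ V : ℝ} {D : ℕ} {M : ℝ} {K : G → ℝ}

/-- Decomposition of `{N ≥ r}` into dyadic annuli. -/
theorem IsGauge.lintegral_tail_le (hN : IsGauge μ N κ V D) {r : ℝ} (hr : 0 < r) :
    ∫⁻ u in {u | r ≤ N u}, ENNReal.ofReal (1 / N u ^ (D + 1)) ∂μ ≤
      ENNReal.ofReal (V * 2 ^ (D + 1) / r) := by
  have hV := hN.V_pos
  set A : ℕ → Set G := fun i => {u | 2 ^ i * r ≤ N u ∧ N u < 2 * (2 ^ i * r)}
  have hA : ∀ i, MeasurableSet (A i) := fun i =>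
    (measurableSet_le measurable_const hN.continuous.measurable).inter
      (measurableSet_lt hN.continuous.measurable measurable_const)
  have cover : {u | r ≤ N u} ⊆ ⋃ i, A i := by
    intro u hu
    have hu' : r ≤ N u := hu
    obtain ⟨i, h1, h2⟩ := exists_nat_pow_near ((one_le_div hr).2 hu') one_lt_two
    refine Set.mem_iUnion.2 ⟨i, (le_div_iff₀ hr).1 h1, ?_⟩
    have := (div_lt_iff₀ hr).1 h2
    rw [pow_succ] at this
    linarith
  have piece : ∀ i, ∫⁻ u in A i, ENNReal.ofReal (1 / N u ^ (D + 1)) ∂μ ≤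
      ENNReal.ofReal (V * 2 ^ D / r * (1 / 2) ^ i) := by
    intro i
    have hp : 0 < 2 ^ i * r := by positivity
    calc ∫⁻ u in A i, ENNReal.ofReal (1 / N u ^ (D + 1)) ∂μ
        ≤ ∫⁻ _ in A i, ENNReal.ofReal (1 / (2 ^ i * r) ^ (D + 1)) ∂μ := by
          refine setLIntegral_mono' (hA i) fun u hu => ENNReal.ofReal_le_ofReal ?_
          have : 2 ^ i * r ≤ N u := hu.1
          gcongr
      _ ≤ ENNReal.ofReal (1 / (2 ^ i * r) ^ (D + 1)) * μ {u | N u < 2 * (2 ^ i * r)} := by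
          rw [setLIntegral_const]
          gcongr
          exact fun u hu => hu.2
      _ = _ := by
          rw [hN.volume_lt _ (by positivity), ← ENNReal.ofReal_mul (by positivity)]
          congr 1
          rw [mul_pow 2, pow_succ, one_div_pow]
          field_simp
  calc _ ≤ ∫⁻ u in ⋃ i, A i, ENNReal.ofReal (1 / N u ^ (D + 1)) ∂μ := lintegral_mono_set cover
    _ ≤ ∑' i, ∫⁻ u in A i, ENNReal.ofReal (1 / N u ^ (D + 1)) ∂μ := lintegral_iUnion_le _ _
    _ ≤ ∑' i : ℕ, ENNReal.ofReal (V * 2 ^ D / r * (1 / 2) ^ i) := ENNReal.tsum_le_tsum piece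
    _ = ENNReal.ofReal (V * 2 ^ (D + 1) / r) := by
        rw [← ENNReal.ofReal_tsum_of_nonneg (fun i => by positivity)
          (summable_geometric_two.mul_left _), tsum_mul_left, tsum_geometric_two]
        congr 1
        ring

/-- The kernel restricted to `N > ε`. -/
def tailK {G : Type*} (N K : G → ℝ) (ε : ℝ) : G → ℝ := {u | ε < N u}.indicator K

variable [SecondCountableTopology G] [μ.IsMulRightInvariant] [μ.IsInvInvariant]

namespace IsSingularKernel

variable (hN : IsGauge μ N κ V D) (hK : IsSingularKernel μ N D M K)
include hN hK

theorem measurable_tailK (ε : ℝ) : Measurable (tailK N K ε) :=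
  hK.measurable.indicator (measurableSet_lt measurable_const hN.continuous.measurable)

theorem abs_tailK_le {ε : ℝ} (hε : 0 < ε) (u : G) : |tailK N K ε u| ≤ (ε ^ D)⁻¹ := by
  by_cases hu : u ∈ {u | ε < N u}
  · rw [tailK, Set.indicator_of_mem hu]
    have h1 : ε < N u := hu
    exact (hK.size u).trans (by gcongr)
  · rw [tailK, Set.indicator_of_notMem hu, abs_zero]; positivity

theorem integrable_tailK_mul {ε : ℝ} (hε : 0 < ε) {f : G → ℝ} (hf : Integrable f μ) (z : G) :
    Integrable (fun ζ => tailK N K ε (ζ⁻¹ * z) * f ζ) μ :=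
  hf.bdd_mul (c := (ε ^ D)⁻¹)
    ((hK.measurable_tailK hN ε).comp (by fun_prop)).aestronglyMeasurable
    (Eventually.of_forall fun _ => hK.abs_tailK_le hN hε _)

theorem integrable_annK_mul {ε : ℝ} (hε : 0 < ε) (R : ℝ) {f : G → ℝ} (hf : Integrable f μ)
    (z : G) : Integrable (fun ζ => annK N K ε R (ζ⁻¹ * z) * f ζ) μ :=
  hf.bdd_mul (c := (ε ^ D)⁻¹)
    ((hK.measurable_annK hN ε R).comp (by fun_prop)).aestronglyMeasurable
    (Eventually.of_forall fun _ => hK.abs_annK_le hN hε _ _)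

theorem conv_tailK_add {ε : ℝ} (hε : 0 < ε) {f g : G → ℝ} (hf : Integrable f μ)
    (hg : Integrable g μ) (z : G) :
    conv μ (tailK N K ε) (fun ζ => f ζ + g ζ) z =
      conv μ (tailK N K ε) f z + conv μ (tailK N K ε) g z := by
  simp only [conv, mul_add]
  exact integral_add (hK.integrable_tailK_mul hN hε hf z) (hK.integrable_tailK_mul hN hε hg z)

theorem tendsto_conv_annK {ε : ℝ} (hε : 0 < ε) {f : G → ℝ} (hf : Integrable f μ) (z : G) :
    Tendsto (fun n : ℕ => conv μ (annK N K ε (2 ^ n)) f z) atTop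
      (𝓝 (conv μ (tailK N K ε) f z)) := by
  refine tendsto_integral_of_dominated_convergence (fun ζ => (ε ^ D)⁻¹ * ‖f ζ‖)
    (fun n => (hK.integrable_annK_mul hN hε _ hf z).1) (hf.norm.const_mul _)
    (fun n => Eventually.of_forall fun ζ => ?_) (Eventually.of_forall fun ζ => ?_)
  · rw [norm_mul]
    exact mul_le_mul_of_nonneg_right (hK.abs_annK_le hN hε _ _) (norm_nonneg _)
  · refine Tendsto.mul_const _ (tendsto_const_nhds.congr' ?_)
    filter_upwards [(tendsto_pow_atTop_atTop_of_one_lt (one_lt_two (α := ℝ))).eventually_ge_atTop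
      (N (ζ⁻¹ * z))] with n hn
    simp [tailK, annK, Set.indicator_apply, hn]

/-- Comparison of two truncations at points whose distance is small relative to `ε`. -/
theorem abs_annK_mul_sub_le {ε₀ ε R δ : ℝ} (hε₀ : 0 < ε₀) (hε : ε₀ ≤ ε) (hR : ε ≤ R) {v : G}
    (hvδ : N v ≤ δ) (h1 : κ ^ 2 * δ ≤ ε / 2) (h2 : M * δ ≤ ε) (hM : 1 ≤ M) {p : G}
    (hp : ε < N p) :
    |annK N K ε₀ R (p * v) - annK N K ε R p| ≤
      δ * (1 / N p ^ (D + 1)) + {u | N u < 2 * ε}.indicator (fun _ => (2 / ε) ^ D) p +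
        {u | N u < 2 * R}.indicator (fun _ => (2 / R) ^ D) p := by
  have hεp : 0 < ε := hε₀.trans_le hε
  have hRp : 0 < R := hεp.trans_le hR
  have hδ0 : 0 ≤ δ := (hN.nonneg v).trans hvδ
  have hNp : 0 < N p := hεp.trans hp
  have hd := abs_le.1 ((hN.abs_mul_right_sub_le p v).trans
    (mul_le_mul_of_nonneg_left hvδ (sq_nonneg κ)))
  have i1 : 0 ≤ {u | N u < 2 * ε}.indicator (fun _ => (2 / ε) ^ D) p :=
    Set.indicator_nonneg (fun _ _ => by positivity) _
  have i2 : 0 ≤ {u | N u < 2 * R}.indicator (fun _ => (2 / R) ^ D) p :=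
    Set.indicator_nonneg (fun _ _ => by positivity) _
  have i3 : 0 ≤ δ * (1 / N p ^ (D + 1)) := by positivity
  have Kle : ∀ u s, 0 < s → s / 2 ≤ N u → |K u| ≤ (2 / s) ^ D := fun u s hs hu => by
    refine (hK.size u).trans ?_
    rw [← inv_pow]
    refine pow_le_pow_left₀ (inv_nonneg.2 (hN.nonneg u)) ?_ _
    rw [← inv_div s 2]
    exact inv_anti₀ (by positivity) hu
  by_cases hin : ε₀ < N (p * v) ∧ N (p * v) ≤ R <;> by_cases hpR : N p ≤ R
  · have a1 : annK N K ε₀ R (p * v) = K (p * v) := Set.indicator_of_mem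
      (s := {u | ε₀ < N u ∧ N u ≤ R}) hin _
    have a2 : annK N K ε R p = K p := Set.indicator_of_mem
      (s := {u | ε < N u ∧ N u ≤ R}) ⟨hp, hpR⟩ _
    rw [a1, a2]
    have h3 := hK.right p v (by nlinarith)
    have h4 : N v / N p ^ (D + 1) ≤ δ * (1 / N p ^ (D + 1)) := by
      rw [mul_one_div]; gcongr
    linarith
  · have a1 : annK N K ε₀ R (p * v) = K (p * v) := Set.indicator_of_mem
      (s := {u | ε₀ < N u ∧ N u ≤ R}) hin _
    have a2 : annK N K ε R p = 0 := Set.indicator_of_notMem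
      (s := {u | ε < N u ∧ N u ≤ R}) (fun h => hpR h.2) _
    push Not at hpR
    rw [a1, a2, sub_zero]
    rw [Set.indicator_of_mem (s := {u | N u < 2 * R}) (show N p < 2 * R by linarith [hin.2])]
    have := Kle (p * v) R hRp (by linarith)
    linarith
  · have a1 : annK N K ε₀ R (p * v) = 0 := Set.indicator_of_notMem
      (s := {u | ε₀ < N u ∧ N u ≤ R}) hin _
    have a2 : annK N K ε R p = K p := Set.indicator_of_mem
      (s := {u | ε < N u ∧ N u ≤ R}) ⟨hp, hpR⟩ _
    rw [a1, a2, zero_sub, abs_neg]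
    by_cases hl : ε₀ < N (p * v)
    · have hr : R < N (p * v) := by by_contra h; exact hin ⟨hl, not_lt.1 h⟩
      rw [Set.indicator_of_mem (s := {u | N u < 2 * R}) (show N p < 2 * R by linarith)]
      have := Kle p R hRp (by linarith)
      linarith
    · push Not at hl
      rw [Set.indicator_of_mem (s := {u | N u < 2 * ε}) (show N p < 2 * ε by linarith)]
      have := Kle p ε hεp (by linarith)
      linarith
  · have a1 : annK N K ε₀ R (p * v) = 0 := Set.indicator_of_notMem
      (s := {u | ε₀ < N u ∧ N u ≤ R}) hin _
    have a2 : annK N K ε R p = 0 := Set.indicator_of_notMem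
      (s := {u | ε < N u ∧ N u ≤ R}) (fun h => hpR h.2) _
    rw [a1, a2, sub_zero, abs_zero]
    linarith

/-- Cotlar's inequality for a bounded function: up to an error controlled by the bound, a
truncation at `z` is dominated by a finer truncation at any nearby point `w`, after removal of the
part of `g` close to `z`. -/
theorem abs_conv_annK_le {ε₀ ε R : ℝ} (hε₀ : 0 < ε₀) (hε : ε₀ ≤ ε) (hR : ε ≤ R) (hM : 1 ≤ M)
    {g : G → ℝ} (hg : Integrable g μ) {b : ℝ} (hb : ∀ᵐ z ∂μ, |g z| ≤ b) {z w : G}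
    (hw : w ∈ gball N z (ε / (2 * κ ^ 3 * M))) :
    |conv μ (annK N K ε R) g z| ≤ |conv μ (annK N K ε₀ R) g w| +
      |conv μ (annK N K ε₀ R) ({ζ | N (ζ⁻¹ * z) ≤ ε}.indicator g) w| +
      V * (2 ^ (D + 1) + 2 * 4 ^ D) * b := by
  have hV := hN.V_pos
  have hκ := hN.one_le
  have hεp : 0 < ε := hε₀.trans_le hε
  have hRp : 0 < R := hεp.trans_le hR
  have hb0 : 0 ≤ b ∨ μ = 0 := by
    by_cases h : μ = 0
    · exact Or.inr h
    · left
      have := ae_neBot.2 h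
      obtain ⟨z, hz⟩ := hb.exists
      exact (abs_nonneg _).trans hz
  rcases hb0 with hb0 | h0
  swap
  · exfalso
    have := hN.volume_lt 1 one_pos
    rw [h0] at this
    simp at this
    linarith
  set B : Set G := {ζ | N (ζ⁻¹ * z) ≤ ε} with hB
  have hBm : MeasurableSet B :=
    measurableSet_le (hN.continuous.measurable.comp (by fun_prop)) measurable_const
  set δ : ℝ := ε / (2 * κ ^ 2 * M) with hδ
  set v : G := z⁻¹ * w with hv
  have hNv : N v ≤ δ := by
    have h1 := hN.inv_le (w⁻¹ * z)
    have h2 : N (w⁻¹ * z) < ε / (2 * κ ^ 3 * M) := hw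
    rw [show (w⁻¹ * z)⁻¹ = v by rw [hv]; group] at h1
    calc N v ≤ κ * (ε / (2 * κ ^ 3 * M)) := h1.trans (by gcongr)
      _ = δ := by rw [hδ]; field_simp
  have hκ2 : 1 ≤ κ ^ 2 := one_le_pow₀ hκ
  have hδ1 : κ ^ 2 * δ ≤ ε / 2 := by
    rw [hδ, mul_div_assoc', div_le_div_iff₀ (by positivity) (by norm_num)]
    have : 0 ≤ κ ^ 2 * ε := by positivity
    nlinarith
  have hδ2 : M * δ ≤ ε := by
    rw [hδ, mul_div_assoc', div_le_iff₀ (by positivity)]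
    have : 0 ≤ M * ε := by positivity
    nlinarith
  have hδ0 : 0 ≤ δ := by positivity
  have hδε : δ ≤ ε := by nlinarith
  have split : conv μ (annK N K ε₀ R) g w = conv μ (annK N K ε₀ R) (B.indicator g) w +
      conv μ (annK N K ε₀ R) (Bᶜ.indicator g) w := by
    simp only [conv]
    rw [← integral_add (hK.integrable_annK_mul hN hε₀ R (hg.indicator hBm) w)
      (hK.integrable_annK_mul hN hε₀ R (hg.indicator hBm.compl) w)]
    refine integral_congr_ae (Eventually.of_forall fun ζ => ?_)
    simp only
    rw [← mul_add, Set.indicator_self_add_compl_apply]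
  set A : G → ℝ≥0∞ := fun p =>
    {u | ε ≤ N u}.indicator (fun u => ENNReal.ofReal δ * ENNReal.ofReal (1 / N u ^ (D + 1))) p +
    ({u | N u < 2 * ε}.indicator (fun _ => ENNReal.ofReal ((2 / ε) ^ D)) p +
      {u | N u < 2 * R}.indicator (fun _ => ENNReal.ofReal ((2 / R) ^ D)) p) with hA
  have m1 : MeasurableSet {u | ε ≤ N u} :=
    measurableSet_le measurable_const hN.continuous.measurable
  have m2 : ∀ s, MeasurableSet {u | N u < s} := fun s =>
    measurableSet_lt hN.continuous.measurable measurable_const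
  have mA : Measurable fun u => ENNReal.ofReal (1 / N u ^ (D + 1)) :=
    ENNReal.measurable_ofReal.comp (((hN.continuous.measurable).pow_const _).const_div 1)
  have hAint : ∫⁻ p, A p ∂μ ≤ ENNReal.ofReal (V * (2 ^ (D + 1) + 2 * 4 ^ D)) := by
    have hs : ∀ s, 0 < s → ENNReal.ofReal ((2 / s) ^ D) * μ {u | N u < 2 * s} =
        ENNReal.ofReal (V * 4 ^ D) := fun s hs => by
      rw [hN.volume_lt _ (by positivity), ← ENNReal.ofReal_mul (by positivity)]
      congr 1
      rw [show (4 : ℝ) = 2 * 2 by norm_num, mul_pow, mul_pow, div_pow]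
      field_simp
    rw [hA, lintegral_add_left ((mA.const_mul _).indicator m1),
      lintegral_add_left (measurable_const.indicator (m2 _)), lintegral_indicator m1,
      lintegral_const_mul _ mA, lintegral_indicator_const (m2 _), lintegral_indicator_const (m2 _),
      hs ε hεp, hs R hRp]
    calc _ ≤ ENNReal.ofReal δ * ENNReal.ofReal (V * 2 ^ (D + 1) / ε) +
          (ENNReal.ofReal (V * 4 ^ D) + ENNReal.ofReal (V * 4 ^ D)) := by
          gcongr; exact hN.lintegral_tail_le hεp
      _ ≤ _ := by
          rw [← ENNReal.ofReal_mul hδ0, ← ENNReal.ofReal_add (by positivity) (by positivity),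
            ← ENNReal.ofReal_add (by positivity) (by positivity)]
          refine ENNReal.ofReal_le_ofReal ?_
          have : δ * (V * 2 ^ (D + 1) / ε) ≤ V * 2 ^ (D + 1) := by
            rw [mul_div_assoc', div_le_iff₀ hεp, mul_comm]
            gcongr
          linarith
  have far : |conv μ (annK N K ε₀ R) (Bᶜ.indicator g) w - conv μ (annK N K ε R) g z| ≤
      V * (2 ^ (D + 1) + 2 * 4 ^ D) * b := by
    rw [conv, conv, ← integral_sub (hK.integrable_annK_mul hN hε₀ R (hg.indicator hBm.compl) w)
      (hK.integrable_annK_mul hN hεp R hg z), ← Real.norm_eq_abs,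
      ← ENNReal.ofReal_le_ofReal_iff (by positivity), ofReal_norm]
    refine (enorm_integral_le_lintegral_enorm _).trans ?_
    calc ∫⁻ ζ, ‖annK N K ε₀ R (ζ⁻¹ * w) * Bᶜ.indicator g ζ - annK N K ε R (ζ⁻¹ * z) * g ζ‖ₑ ∂μ
        ≤ ∫⁻ ζ, A (ζ⁻¹ * z) * ENNReal.ofReal b ∂μ := by
          refine lintegral_mono_ae ?_
          filter_upwards [hb] with ζ hζ
          have ew : ζ⁻¹ * w = ζ⁻¹ * z * v := by rw [hv]; group
          by_cases hζB : ζ ∈ B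
          · have : annK N K ε R (ζ⁻¹ * z) = 0 := Set.indicator_of_notMem
              (fun h => absurd h.1 (not_lt.2 hζB)) _
            rw [Set.indicator_of_notMem (by simpa using hζB), this]
            simp
          · have hp : ε < N (ζ⁻¹ * z) := not_le.1 hζB
            rw [Set.indicator_of_mem (by simpa using hζB), ← sub_mul, enorm_mul]
            gcongr
            · rw [ew, Real.enorm_eq_ofReal_abs]
              refine (ENNReal.ofReal_le_ofReal (hK.abs_annK_mul_sub_le hN hε₀ hε hR hNv hδ1 hδ2
                hM hp)).trans ?_
              rw [hA]
              simp only
              have hp' : ζ⁻¹ * z ∈ {u | ε ≤ N u} := hp.le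
              rw [Set.indicator_of_mem hp', ← ENNReal.ofReal_mul hδ0, ← add_assoc]
              refine ENNReal.ofReal_add_le.trans (add_le_add (ENNReal.ofReal_add_le.trans
                (add_le_add le_rfl ?_)) ?_)
              · simp only [Set.indicator_apply]; split_ifs <;> simp
              · simp only [Set.indicator_apply]; split_ifs <;> simp
            · rw [Real.enorm_eq_ofReal_abs]; exact ENNReal.ofReal_le_ofReal hζ
      _ = (∫⁻ p, A p ∂μ) * ENNReal.ofReal b := by
          rw [lintegral_mul_const' _ _ ENNReal.ofReal_ne_top,
            (measurePreserving_inv_mul z).lintegral_comp_emb (measurableEmbedding_inv_mul z)]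
      _ ≤ _ := by
          rw [ENNReal.ofReal_mul (by positivity)]
          gcongr
  rw [abs_le] at far
  rw [split]
  have t1 := abs_add_le (conv μ (annK N K ε R) g z -
    conv μ (annK N K ε₀ R) (Bᶜ.indicator g) w) (conv μ (annK N K ε₀ R) (Bᶜ.indicator g) w)
  rw [sub_add_cancel] at t1
  have t2 : |conv μ (annK N K ε R) g z - conv μ (annK N K ε₀ R) (Bᶜ.indicator g) w| ≤
      V * (2 ^ (D + 1) + 2 * 4 ^ D) * b := by rw [abs_le]; constructor <;> linarith
  have t3 := abs_sub (conv μ (annK N K ε₀ R) (B.indicator g) w +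
    conv μ (annK N K ε₀ R) (Bᶜ.indicator g) w) (conv μ (annK N K ε₀ R) (B.indicator g) w)
  rw [add_sub_cancel_left] at t3
  linarith

end IsSingularKernel

end GoodPart

/-! ### Weak type of maximal truncations -/

section WeakType

open scoped ENNReal

variable {G : Type*} [Group G] [TopologicalSpace G] [IsTopologicalGroup G]
  [MeasurableSpace G] [BorelSpace G] {μ : Measure G}
  {N : G → ℝ} {κ V : ℝ} {D : ℕ} {M : ℝ} {K : G → ℝ}
  [SecondCountableTopology G] [μ.IsMulRightInvariant] [μ.IsInvInvariant]
  [LocallyCompactSpace G] [T2Space G] [μ.Regular]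

theorem IsSingularKernel.integral_conv_annK_sq_le (hN : IsGauge μ N κ V D)
    (hK : IsSingularKernel μ N D M K) (hM : 1 ≤ M) (n : ℕ) {f : G → ℝ} (hf : Integrable f μ)
    {b : ℝ} (hb : ∀ᵐ z ∂μ, |f z| ≤ b) :
    Integrable (conv μ (annK N K (2 ^ n)⁻¹ (2 ^ n)) f) μ ∧
    (∃ B, ∀ z, |conv μ (annK N K (2 ^ n)⁻¹ (2 ^ n)) f z| ≤ B) ∧
    ∫ z, conv μ (annK N K (2 ^ n)⁻¹ (2 ^ n)) f z ^ 2 ∂μ ≤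
      (√(V * 16 ^ D * (8 + 12 * D) * (κ ^ 2 + M) * 2 * (V * 4 ^ D)) * 8) ^ 2 *
        ∫ z, f z ^ 2 ∂μ := by
  have hε : (0 : ℝ) < (2 ^ n)⁻¹ := by positivity
  have hk := hK.integrable_annK hN hε (b := 2 ^ (2 * n) * (2 ^ n)⁻¹) (by positivity)
  have e : (2 : ℝ) ^ (2 * n) * (2 ^ n)⁻¹ = 2 ^ n := by
    rw [two_mul, pow_add]; field_simp
  have h1 := integral_conv_sq_le hk hf hb
  have h2 := hK.norm_convOp_le hN hM hε (2 * n)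
  have h3 := integrable_conv hk hf
  have h4 := abs_conv_le hk hb
  have h5 : 0 ≤ ∫ z, f z ^ 2 ∂μ := integral_nonneg fun z => sq_nonneg _
  have h6 := h1.trans (mul_le_mul_of_nonneg_right
    (pow_le_pow_left₀ (norm_nonneg _) h2 2) h5)
  rw [e] at h3 h4 h6
  exact ⟨h3, ⟨_, h4⟩, h6⟩

theorem integral_sq_le_of_bounded {f : G → ℝ} (hf : Integrable f μ) {b : ℝ}
    (hb : ∀ᵐ z ∂μ, |f z| ≤ b) : ∫ z, f z ^ 2 ∂μ ≤ b * ∫ z, |f z| ∂μ := by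
  rw [← integral_const_mul]
  refine integral_mono_ae ((memLp_two_iff_integrable_sq hf.1).1 (memLp_two_of_bounded hf hb))
    (hf.norm.const_mul b) ?_
  filter_upwards [hb] with z hz
  rw [← sq_abs, sq]
  exact mul_le_mul_of_nonneg_right hz (abs_nonneg _)

/-- A lower bound on a ball for two-sided truncations propagates to a ball average of the square of
a single, finer truncation. -/
theorem IsSingularKernel.lt_average_sq (hN : IsGauge μ N κ V D)
    (hK : IsSingularKernel μ N D M K) (hM : 1 ≤ M) {γ c C₂ : ℝ} (hγ : 0 < γ)
    (hc : c = 1 / (2 * κ ^ 3 * M))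
    (hC₂ : C₂ = √(V * 16 ^ D * (8 + 12 * D) * (κ ^ 2 + M) * 2 * (V * 4 ^ D)) * 8)
    (hγ1 : V * (2 ^ (D + 1) + 2 * 4 ^ D) * γ ≤ 1 / 4)
    (hγ2 : C₂ ^ 2 * γ ^ 2 * 2 ^ D ≤ c ^ D / 16) {t : ℝ} (ht : 0 < t) {g : G → ℝ}
    (hg : Integrable g μ) (hb : ∀ᵐ z ∂μ, |g z| ≤ γ * t) {n : ℕ} {ε : ℝ} (hε : (2 ^ n)⁻¹ ≤ ε)
    (hR : ε ≤ 2 ^ n) {z : G} (hz : t < |conv μ (annK N K ε (2 ^ n)) g z|) :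
    ENNReal.ofReal (t ^ 2 * V / 32 * (c * ε) ^ D) < ∫⁻ w in gball N z (c * ε),
      ENNReal.ofReal (conv μ (annK N K (2 ^ n)⁻¹ (2 ^ n)) g w ^ 2) ∂μ := by
  have hV := hN.V_pos
  have hκ := hN.kappa_pos
  have hε₀ : (0 : ℝ) < (2 ^ n)⁻¹ := by positivity
  have hεp : 0 < ε := hε₀.trans_le hε
  have hcp : 0 < c := by rw [hc]; have : 0 < M := by linarith
                         positivity
  set B : Set G := {ζ | N (ζ⁻¹ * z) ≤ ε} with hB
  have hBm : MeasurableSet B :=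
    measurableSet_le (hN.continuous.measurable.comp (by fun_prop)) measurable_const
  have hBsub : B ⊆ gball N z (2 * ε) := fun ζ hζ => by
    have : N (ζ⁻¹ * z) ≤ ε := hζ
    exact show N (ζ⁻¹ * z) < 2 * ε by linarith
  have hBμ : μ B ≤ ENNReal.ofReal (V * (2 * ε) ^ D) :=
    (measure_mono hBsub).trans (hN.measure_gball z (by positivity)).le
  have hgB : Integrable (B.indicator g) μ := hg.indicator hBm
  have hbB : ∀ᵐ z ∂μ, |B.indicator g z| ≤ γ * t := by
    filter_upwards [hb] with ζ hζ
    by_cases h : ζ ∈ B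
    · rwa [Set.indicator_of_mem h]
    · rw [Set.indicator_of_notMem h, abs_zero]; positivity
  obtain ⟨h1i, ⟨B1, hB1⟩, -⟩ := hK.integral_conv_annK_sq_le hN hM n hg hb
  obtain ⟨h2i, ⟨B2, hB2⟩, h2s⟩ := hK.integral_conv_annK_sq_le hN hM n hgB hbB
  rw [← hC₂] at h2s
  set h₁ := conv μ (annK N K (2 ^ n)⁻¹ (2 ^ n)) g
  set h₂ := conv μ (annK N K (2 ^ n)⁻¹ (2 ^ n)) (B.indicator g)
  have h2sq : Integrable (fun w => h₂ w ^ 2) μ := (memLp_two_iff_integrable_sq h2i.1).1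
    (memLp_two_of_bounded h2i (Eventually.of_forall hB2))
  -- the part of `g` near `z` has small `L²` norm because `g` is bounded
  have hnear : ∫⁻ w, ENNReal.ofReal (h₂ w ^ 2) ∂μ ≤
      ENNReal.ofReal (t ^ 2 / 16 * (V * (c * ε) ^ D)) := by
    rw [← ofReal_integral_eq_lintegral_ofReal h2sq (Eventually.of_forall fun w => sq_nonneg _)]
    refine ENNReal.ofReal_le_ofReal (h2s.trans ?_)
    have e1 : ∫ w, B.indicator g w ^ 2 ∂μ ≤ (γ * t) ^ 2 * (V * (2 * ε) ^ D) := by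
      have hfin : μ B ≠ ∞ := ne_top_of_le_ne_top ENNReal.ofReal_ne_top hBμ
      have e2 : ∫ w, B.indicator g w ^ 2 ∂μ ≤ ∫ w, B.indicator (fun _ => (γ * t) ^ 2) w ∂μ := by
        refine integral_mono_ae ((memLp_two_iff_integrable_sq hgB.1).1
          (memLp_two_of_bounded hgB hbB)) ((integrable_indicator_iff hBm).2
            (integrableOn_const hfin enorm_ne_top)) ?_
        filter_upwards [hb] with ζ hζ
        by_cases h : ζ ∈ B
        · simp only [Set.indicator_of_mem h]
          rw [← sq_abs]
          exact pow_le_pow_left₀ (abs_nonneg _) hζ 2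
        · simp [Set.indicator_of_notMem h]
      refine e2.trans ?_
      rw [integral_indicator hBm, setIntegral_const, smul_eq_mul, mul_comm]
      refine mul_le_mul_of_nonneg_left ?_ (by positivity)
      exact ENNReal.toReal_le_of_le_ofReal (by positivity) hBμ
    calc C₂ ^ 2 * ∫ w, B.indicator g w ^ 2 ∂μ
        ≤ C₂ ^ 2 * ((γ * t) ^ 2 * (V * (2 * ε) ^ D)) := by gcongr
      _ = (C₂ ^ 2 * γ ^ 2 * 2 ^ D) * (t ^ 2 * (V * ε ^ D)) := by rw [mul_pow, mul_pow]; ring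
      _ ≤ (c ^ D / 16) * (t ^ 2 * (V * ε ^ D)) := by gcongr
      _ = _ := by rw [mul_pow]; ring
  -- by Cotlar's inequality `|h₁| + |h₂| ≥ t / 2` on the ball
  have hlow : ENNReal.ofReal (t ^ 2 / 8 * (V * (c * ε) ^ D)) ≤
      ∫⁻ w in gball N z (c * ε), ENNReal.ofReal (h₁ w ^ 2) ∂μ +
        ∫⁻ w, ENNReal.ofReal (h₂ w ^ 2) ∂μ := by
    calc ENNReal.ofReal (t ^ 2 / 8 * (V * (c * ε) ^ D))
        = ∫⁻ _ in gball N z (c * ε), ENNReal.ofReal (t ^ 2 / 8) ∂μ := by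
          rw [setLIntegral_const, hN.measure_gball _ (by positivity),
            ← ENNReal.ofReal_mul (by positivity)]
      _ ≤ ∫⁻ w in gball N z (c * ε), (ENNReal.ofReal (h₁ w ^ 2) + ENNReal.ofReal (h₂ w ^ 2)) ∂μ := by
          refine setLIntegral_mono' (hN.measurableSet_gball _ _) fun w hw => ?_
          rw [← ENNReal.ofReal_add (sq_nonneg _) (sq_nonneg _)]
          refine ENNReal.ofReal_le_ofReal ?_
          have hw' : w ∈ gball N z (ε / (2 * κ ^ 3 * M)) := by
            rw [hc, one_div_mul_eq_div] at hw; exact hw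
          have h3 := hK.abs_conv_annK_le hN hε₀ hε hR hM hg hb hw'
          have h4 : V * (2 ^ (D + 1) + 2 * 4 ^ D) * (γ * t) ≤ t / 4 := by
            rw [← mul_assoc]
            calc _ ≤ 1 / 4 * t := by gcongr
              _ = t / 4 := by ring
          have h5 : t / 2 ≤ |h₁ w| + |h₂ w| := by linarith
          have h6 : (t / 2) ^ 2 ≤ (|h₁ w| + |h₂ w|) ^ 2 := pow_le_pow_left₀ (by positivity) h5 2
          nlinarith [sq_abs (h₁ w), sq_abs (h₂ w), sq_nonneg (|h₁ w| - |h₂ w|)]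
      _ = ∫⁻ w in gball N z (c * ε), ENNReal.ofReal (h₁ w ^ 2) ∂μ +
          ∫⁻ w in gball N z (c * ε), ENNReal.ofReal (h₂ w ^ 2) ∂μ :=
          lintegral_add_left' (by
            exact (ENNReal.measurable_ofReal.comp_aemeasurable
              (h1i.1.aemeasurable.pow_const 2)).restrict) _
      _ ≤ _ := by gcongr; exact Measure.restrict_le_self
  have h7 := hlow.trans (add_le_add_right hnear _)
  rw [show t ^ 2 / 8 * (V * (c * ε) ^ D) = t ^ 2 / 16 * (V * (c * ε) ^ D) +
    t ^ 2 / 16 * (V * (c * ε) ^ D) by ring, ENNReal.ofReal_add (by positivity) (by positivity)] at h7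
  have h8 := (ENNReal.add_le_add_iff_right ENNReal.ofReal_ne_top).1 h7
  refine lt_of_lt_of_le ((ENNReal.ofReal_lt_ofReal_iff (by positivity)).2 ?_) h8
  have : 0 < t ^ 2 * (V * (c * ε) ^ D) := by positivity
  linarith

/-- Weak type estimate for maximal truncations of functions bounded by a small multiple of the
level. -/
theorem IsGauge.exists_measure_maximal_bounded_le (hN : IsGauge μ N κ V D) (hM : 1 ≤ M) :
    ∃ γ C : ℝ, 0 < γ ∧ 0 < C ∧ ∀ K, IsSingularKernel μ N D M K → ∀ t, 0 < t →
      ∀ g : G → ℝ, Integrable g μ → (∀ᵐ z ∂μ, |g z| ≤ γ * t) →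
      μ {z | ∃ ε, 0 < ε ∧ t < |conv μ (tailK N K ε) g z|} ≤
        ENNReal.ofReal (C / t) * ∫⁻ z, ‖g z‖ₑ ∂μ := by
  have hV := hN.V_pos
  have hκ := hN.kappa_pos
  have hM0 : 0 < M := by linarith
  set C₂ : ℝ := √(V * 16 ^ D * (8 + 12 * D) * (κ ^ 2 + M) * 2 * (V * 4 ^ D)) * 8 with hC₂
  have hC₂p : 0 < C₂ := by positivity
  set c : ℝ := 1 / (2 * κ ^ 3 * M) with hc
  have hcp : 0 < c := by positivity
  set A : ℝ := V * (2 ^ (D + 1) + 2 * 4 ^ D) with hA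
  have hAp : 0 < A := by positivity
  -- the first bound keeps the error of Cotlar's inequality below `t / 4`, the second one the
  -- contribution of the part of `g` near `z`
  set γ : ℝ := min (1 / (4 * A)) √(c ^ D / 16 / (C₂ ^ 2 * 2 ^ D)) with hγ
  have hγp : 0 < γ := lt_min (by positivity) (Real.sqrt_pos.2 (by positivity))
  have hγ1 : A * γ ≤ 1 / 4 := by
    calc A * γ ≤ A * (1 / (4 * A)) := by gcongr; exact min_le_left _ _
      _ = 1 / 4 := by field_simp
  have hγ2 : C₂ ^ 2 * γ ^ 2 * 2 ^ D ≤ c ^ D / 16 := by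
    have : γ ^ 2 ≤ c ^ D / 16 / (C₂ ^ 2 * 2 ^ D) := by
      rw [← Real.sq_sqrt (show 0 ≤ c ^ D / 16 / (C₂ ^ 2 * 2 ^ D) by positivity)]
      exact pow_le_pow_left₀ hγp.le (min_le_right _ _) 2
    rw [le_div_iff₀ (by positivity)] at this
    linarith
  refine ⟨γ, 32 * (5 * κ ^ 2) ^ D * C₂ ^ 2 * γ, hγp, by positivity, fun K hK t ht g hg hb => ?_⟩
  -- two-sided truncations `ε < N ≤ 2ⁿ` with `ε ≥ 2⁻ⁿ` exhaust all truncations as `n → ∞`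
  set S : ℕ → Set G := fun n =>
    {z | ∃ ε, (2 ^ n)⁻¹ ≤ ε ∧ ε ≤ 2 ^ n ∧ t < |conv μ (annK N K ε (2 ^ n)) g z|} with hS
  have hSn : ∀ n, μ (S n) ≤ ENNReal.ofReal (32 * (5 * κ ^ 2) ^ D * C₂ ^ 2 * γ / t) *
      ∫⁻ z, ‖g z‖ₑ ∂μ := by
    intro n
    obtain ⟨h1i, ⟨B1, hB1⟩, h1s⟩ := hK.integral_conv_annK_sq_le hN hM n hg hb
    set h₁ := conv μ (annK N K (2 ^ n)⁻¹ (2 ^ n)) g with hh₁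
    have h1sq : Integrable (fun w => h₁ w ^ 2) μ := (memLp_two_iff_integrable_sq h1i.1).1
      (memLp_two_of_bounded h1i (Eventually.of_forall hB1))
    have hsub : S n ⊆ {z | ∃ r, 0 < r ∧ ENNReal.ofReal (t ^ 2 * V / 32 * r ^ D) <
        ∫⁻ w in gball N z r, ENNReal.ofReal (h₁ w ^ 2) ∂μ} := by
      rintro z ⟨ε, h1, h2, h3⟩
      have hεp : 0 < ε := lt_of_lt_of_le (by positivity) h1
      exact ⟨c * ε, by positivity, hK.lt_average_sq hN hM hγp hc hC₂ hγ1 hγ2 ht hg hb h1 h2 h3⟩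
    have hl : ∫⁻ w, ENNReal.ofReal (h₁ w ^ 2) ∂μ = ENNReal.ofReal (∫ w, h₁ w ^ 2 ∂μ) :=
      (ofReal_integral_eq_lintegral_ofReal h1sq
        (Eventually.of_forall fun w => sq_nonneg _)).symm
    refine (measure_mono hsub).trans ((hN.measure_maximal_le
      (by rw [hl]; exact ENNReal.ofReal_ne_top) (by positivity)).trans ?_)
    rw [hl, ← ofReal_integral_norm_eq_lintegral_enorm hg, ← ENNReal.ofReal_mul (by positivity),
      ← ENNReal.ofReal_mul (by positivity)]
    refine ENNReal.ofReal_le_ofReal ?_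
    have h2 := h1s.trans (mul_le_mul_of_nonneg_left (integral_sq_le_of_bounded hg hb)
      (sq_nonneg _))
    rw [← hC₂] at h2
    calc V * (5 * κ ^ 2) ^ D / (t ^ 2 * V / 32) * ∫ w, h₁ w ^ 2 ∂μ
        ≤ V * (5 * κ ^ 2) ^ D / (t ^ 2 * V / 32) * (C₂ ^ 2 * (γ * t * ∫ z, |g z| ∂μ)) := by
          gcongr
      _ = _ := by
          simp only [Real.norm_eq_abs]
          field_simp
  have hsub : {z | ∃ ε, 0 < ε ∧ t < |conv μ (tailK N K ε) g z|} ⊆ ⋃ n, ⋂ m ∈ Set.Ici n, S m := by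
    rintro z ⟨ε, hε, hz⟩
    have h1 : ∀ᶠ n : ℕ in atTop, t < |conv μ (annK N K ε (2 ^ n)) g z| :=
      ((hK.tendsto_conv_annK hN hε hg z).abs).eventually_const_lt hz
    have hpow := tendsto_pow_atTop_atTop_of_one_lt (one_lt_two (α := ℝ))
    have h2 : ∀ᶠ n : ℕ in atTop, ε ≤ 2 ^ n := hpow.eventually_ge_atTop ε
    have h3 : ∀ᶠ n : ℕ in atTop, ε⁻¹ ≤ 2 ^ n := hpow.eventually_ge_atTop ε⁻¹
    obtain ⟨n, hn⟩ := eventually_atTop.1 (h1.and (h2.and h3))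
    refine Set.mem_iUnion.2 ⟨n, Set.mem_iInter₂.2 fun m hm => ?_⟩
    obtain ⟨a1, a2, a3⟩ := hn m hm
    exact ⟨ε, inv_le_of_inv_le₀ hε a3, a2, a1⟩
  refine (measure_mono hsub).trans ?_
  have hmono : Monotone fun n => ⋂ m ∈ Set.Ici n, S m := fun n n' h =>
    Set.biInter_mono (Set.Ici_subset_Ici.2 h) fun _ _ => le_rfl
  rw [hmono.measure_iUnion]
  refine iSup_le fun n => (measure_mono ?_).trans (hSn n)
  exact Set.biInter_subset_of_mem (Set.self_mem_Ici)

/-- Pointwise estimate for a function with mean zero supported in a small ball, away from that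
ball: regularity of the kernel, plus the effect of the ball crossing the truncation sphere. -/
theorem IsSingularKernel.enorm_conv_tailK_le (hN : IsGauge μ N κ V D)
    (hK : IsSingularKernel μ N D M K) (hM : 1 ≤ M) {ε R : ℝ} (hε : 0 < ε) (hR : 0 < R)
    {b : G → ℝ} (hb : Integrable b μ) {y z : G} (hsupp : ∀ ζ, ζ ∉ gball N y R → b ζ = 0)
    (hb0 : ∫ ζ, b ζ ∂μ = 0) (hz : (2 * κ ^ 2 + M) * R ≤ N (y⁻¹ * z)) :
    ‖conv μ (tailK N K ε) b z‖ₑ ≤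
      ENNReal.ofReal (R * (1 / N (y⁻¹ * z) ^ (D + 1))) * ∫⁻ ζ, ‖b ζ‖ₑ ∂μ +
        ENNReal.ofReal ((ε ^ D)⁻¹) * ∫⁻ ζ in gball N z (3 * ε), ‖b ζ‖ₑ ∂μ := by
  set w := y⁻¹ * z with hw
  have hκ2 : 1 ≤ κ ^ 2 := one_le_pow₀ hN.one_le
  have hNw : 0 < N w := lt_of_lt_of_le (by positivity) hz
  -- the mean of `b` vanishes, so the value of the kernel at the centre may be subtracted
  have e1 : conv μ (tailK N K ε) b z =
      ∫ ζ, (tailK N K ε (ζ⁻¹ * z) - tailK N K ε w) * b ζ ∂μ := by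
    have : ∫ ζ, tailK N K ε w * b ζ ∂μ = 0 := by rw [integral_const_mul, hb0, mul_zero]
    rw [conv, ← sub_zero (∫ ζ, _ ∂μ), ← this,
      ← integral_sub (hK.integrable_tailK_mul hN hε hb z) (hb.const_mul _)]
    simp only [sub_mul]
  have pt : ∀ ζ, ‖(tailK N K ε (ζ⁻¹ * z) - tailK N K ε w) * b ζ‖ₑ ≤
      ENNReal.ofReal (R * (1 / N w ^ (D + 1))) * ‖b ζ‖ₑ +
        (gball N z (3 * ε)).indicator (fun ζ => ENNReal.ofReal ((ε ^ D)⁻¹) * ‖b ζ‖ₑ) ζ := by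
    intro ζ
    by_cases hζ : ζ ∈ gball N y R
    swap
    · simp [hsupp ζ hζ]
    set v := ζ⁻¹ * y with hv
    have hNv : N v < R := hζ
    have ew : ζ⁻¹ * z = v * w := by rw [hv, hw]; group
    have hd := abs_le.1 ((hN.abs_mul_left_sub_le w v).trans
      (mul_le_mul_of_nonneg_left hNv.le (sq_nonneg κ)))
    have hMR : 0 ≤ M * R := by positivity
    rw [enorm_mul, ew]
    by_cases c1 : ε < N (v * w) <;> by_cases c2 : ε < N w
    · have a1 : tailK N K ε (v * w) = K (v * w) := Set.indicator_of_mem (s := {u | ε < N u}) c1 _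
      have a2 : tailK N K ε w = K w := Set.indicator_of_mem (s := {u | ε < N u}) c2 _
      rw [a1, a2]
      refine le_trans ?_ le_self_add
      gcongr
      rw [Real.enorm_eq_ofReal_abs]
      refine ENNReal.ofReal_le_ofReal ((hK.left w v ?_).trans ?_)
      · have : M * N v ≤ M * R := by gcongr
        nlinarith [sq_nonneg κ]
      · rw [mul_one_div]; gcongr
    · have a1 := hK.abs_tailK_le hN hε (v * w)
      have a2 : tailK N K ε w = 0 := Set.indicator_of_notMem (s := {u | ε < N u}) c2 _
      push Not at c2
      have hmem : ζ ∈ gball N z (3 * ε) := by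
        refine show N (ζ⁻¹ * z) < 3 * ε from ?_
        rw [ew]; nlinarith
      rw [a2, sub_zero, Set.indicator_of_mem hmem]
      refine le_trans ?_ le_add_self
      gcongr
      rw [Real.enorm_eq_ofReal_abs]
      exact ENNReal.ofReal_le_ofReal a1
    · have a1 := hK.abs_tailK_le hN hε w
      have a2 : tailK N K ε (v * w) = 0 := Set.indicator_of_notMem (s := {u | ε < N u}) c1 _
      push Not at c1
      have hmem : ζ ∈ gball N z (3 * ε) := by
        refine show N (ζ⁻¹ * z) < 3 * ε from ?_
        rw [ew]; linarith
      rw [a2, zero_sub, enorm_neg, Set.indicator_of_mem hmem]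
      refine le_trans ?_ le_add_self
      gcongr
      rw [Real.enorm_eq_ofReal_abs]
      exact ENNReal.ofReal_le_ofReal a1
    · have a1 : tailK N K ε (v * w) = 0 := Set.indicator_of_notMem (s := {u | ε < N u}) c1 _
      have a2 : tailK N K ε w = 0 := Set.indicator_of_notMem (s := {u | ε < N u}) c2 _
      simp [a1, a2]
  rw [e1]
  refine (enorm_integral_le_lintegral_enorm _).trans ((lintegral_mono pt).trans (le_of_eq ?_))
  rw [lintegral_add_left' (hb.1.enorm.const_mul _),
    lintegral_indicator (hN.measurableSet_gball _ _),
    lintegral_const_mul' _ _ ENNReal.ofReal_ne_top,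
    lintegral_const_mul' _ _ ENNReal.ofReal_ne_top]

/-- **Weak type `(1,1)` of the maximal truncated singular integral**, with a constant depending
only on the gauge and on the separation constant of the kernel. -/
theorem IsGauge.exists_measure_maximal_truncation_le (hN : IsGauge μ N κ V D) (hM : 1 ≤ M) :
    ∃ C : ℝ, 0 < C ∧ ∀ K, IsSingularKernel μ N D M K → ∀ t, 0 < t →
      ∀ f : G → ℝ, Integrable f μ →
      μ {z | ∃ ε, 0 < ε ∧ t < |conv μ (tailK N K ε) f z|} ≤
        ENNReal.ofReal (C / t) * ∫⁻ z, ‖f z‖ₑ ∂μ := by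
  obtain ⟨γ, C₁, hγ, hC₁, good⟩ := hN.exists_measure_maximal_bounded_le hM
  have hV := hN.V_pos
  have hκ := hN.kappa_pos
  have hM0 : 0 < M := by linarith
  -- height of the decomposition relative to the level `t`
  set θ : ℝ := γ / 2 * V / (2 * (5 * κ ^ 2) ^ D) with hθ
  have hθp : 0 < θ := by positivity
  set L : ℝ := κ * (2 * κ ^ 2 + M) with hL
  have hLp : 0 < L := by positivity
  set Ca : ℝ := V * L ^ D * ((5 * κ ^ 2) ^ D / θ) with hCa
  set Cb : ℝ := V * 2 ^ (D + 1) * 2 / (1 / 4) with hCb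
  set Cc : ℝ := V * (5 * κ ^ 2) ^ D / (1 / 4 / 3 ^ D) * 2 with hCc
  refine ⟨2 * C₁ + (Ca + Cb + Cc), by positivity, fun K hK t ht f hf => ?_⟩
  set I : ℝ≥0∞ := ∫⁻ z, ‖f z‖ₑ ∂μ with hI
  have hIfin : I ≠ ∞ := hf.2.ne
  obtain ⟨u, R, b, g, hu, hR, hRsum, hbi, hbsupp, hb0, hbsum, hgi, hgI, hgb, hsum⟩ :=
    hN.exists_calderonZygmund hf (a := θ * t) (by positivity)
  have hcu := hu.to_subtype
  have hgb' : ∀ᵐ z ∂μ, |g z| ≤ γ * (t / 2) := by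
    filter_upwards [hgb] with z hz
    refine hz.trans (le_of_eq ?_)
    rw [hθ]; field_simp
  have hfg : Integrable (fun ζ => f ζ - g ζ) μ := hf.sub hgi
  set Ω : Set G := ⋃ y ∈ u, gball N y (L * R y) with hΩ
  set h : G → ℝ≥0∞ := fun ζ => ∑' y, ‖b y ζ‖ₑ with hh
  have hhI : ∫⁻ ζ, h ζ ∂μ ≤ 2 * I := by
    rw [hh, lintegral_tsum fun y => (hbi y).1.enorm]; exact hbsum
  have hhfin : ∫⁻ ζ, h ζ ∂μ ≠ ∞ := ne_top_of_le_ne_top (by finiteness) hhI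
  set T : u → Set G := fun y => {z | R y ≤ N ((y : G)⁻¹ * z)} with hT
  have hTm : ∀ y, MeasurableSet (T y) := fun y =>
    measurableSet_le measurable_const (hN.continuous.measurable.comp (by fun_prop))
  set Φ : G → ℝ≥0∞ := fun z => ∑' y : u,
    (T y).indicator (fun z => ENNReal.ofReal (R y * (1 / N ((y : G)⁻¹ * z) ^ (D + 1)))) z *
      ∫⁻ ζ, ‖b y ζ‖ₑ ∂μ with hΦ
  have hΦm' : ∀ y : u, Measurable fun z : G =>
      ENNReal.ofReal (R y * (1 / N ((y : G)⁻¹ * z) ^ (D + 1))) := fun y =>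
    ENNReal.measurable_ofReal.comp ((((hN.continuous.measurable.comp
      (by fun_prop : Measurable fun z : G => (y : G)⁻¹ * z)).pow_const _).const_div 1).const_mul _)
  have hΦm : Measurable Φ := Measurable.tsum fun y =>
    ((hΦm' y).indicator (hTm y)).mul_const _
  have hΦI : ∫⁻ z, Φ z ∂μ ≤ ENNReal.ofReal (V * 2 ^ (D + 1)) * (2 * I) := by
    rw [hΦ, lintegral_tsum fun y => (((hΦm' y).indicator (hTm y)).mul_const _).aemeasurable]
    refine le_trans ?_ (mul_le_mul_right hbsum _)
    rw [← ENNReal.tsum_mul_left]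
    refine ENNReal.tsum_le_tsum fun y => ?_
    rw [lintegral_mul_const _ ((hΦm' y).indicator (hTm y))]
    gcongr
    have hRy := hR y y.2
    have hset : MeasurableSet {p : G | R y ≤ N p} :=
      measurableSet_le measurable_const hN.continuous.measurable
    calc ∫⁻ z, (T y).indicator
          (fun z => ENNReal.ofReal (R y * (1 / N ((y : G)⁻¹ * z) ^ (D + 1)))) z ∂μ
        = ∫⁻ p, {p : G | R y ≤ N p}.indicator
            (fun p => ENNReal.ofReal (R y * (1 / N p ^ (D + 1)))) p ∂μ := by
          rw [← (measurePreserving_mul_left_of_inv (μ := μ) (y : G)⁻¹).lintegral_comp_emb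
            (MeasurableEquiv.mulLeft _).measurableEmbedding ({p : G | R y ≤ N p}.indicator
              fun p => ENNReal.ofReal (R y * (1 / N p ^ (D + 1))))]
          rfl
      _ = ∫⁻ p in {p : G | R y ≤ N p}, ENNReal.ofReal (R y) *
            ENNReal.ofReal (1 / N p ^ (D + 1)) ∂μ := by
          rw [lintegral_indicator hset]
          simp only [ENNReal.ofReal_mul hRy.le]
      _ ≤ ENNReal.ofReal (R y) * ENNReal.ofReal (V * 2 ^ (D + 1) / R y) := by
          rw [lintegral_const_mul' _ _ ENNReal.ofReal_ne_top]
          gcongr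
          exact hN.lintegral_tail_le hRy
      _ = ENNReal.ofReal (V * 2 ^ (D + 1)) := by
          rw [← ENNReal.ofReal_mul hRy.le]
          congr 1
          field_simp
  -- outside the enlarged balls the bad part is controlled by `Φ` and the maximal function of `h`
  have hbad : ∀ z, z ∉ Ω → ∀ ε, 0 < ε → ‖conv μ (tailK N K ε) (fun ζ => f ζ - g ζ) z‖ₑ ≤
      Φ z + ENNReal.ofReal ((ε ^ D)⁻¹) * ∫⁻ ζ in gball N z (3 * ε), h ζ ∂μ := by
    intro z hz ε hε
    have e1 : conv μ (tailK N K ε) (fun ζ => f ζ - g ζ) z =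
        ∑' y, conv μ (tailK N K ε) (b y) z := by
      simp only [conv]
      rw [← integral_tsum fun y => (hK.integrable_tailK_mul hN hε (hbi y) z).1]
      · refine integral_congr_ae (Eventually.of_forall fun ζ => ?_)
        simp only
        rw [tsum_mul_left, (hsum ζ).tsum_eq]
      · have hle : ∑' y, ∫⁻ ζ, ‖tailK N K ε (ζ⁻¹ * z) * b y ζ‖ₑ ∂μ ≤
            ENNReal.ofReal ((ε ^ D)⁻¹) * (2 * I) := by
          refine le_trans ?_ (mul_le_mul_right hbsum _)
          rw [← ENNReal.tsum_mul_left]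
          refine ENNReal.tsum_le_tsum fun y => ?_
          rw [← lintegral_const_mul' _ _ ENNReal.ofReal_ne_top]
          refine lintegral_mono fun ζ => ?_
          rw [enorm_mul]
          gcongr
          rw [Real.enorm_eq_ofReal_abs]
          exact ENNReal.ofReal_le_ofReal (hK.abs_tailK_le hN hε _)
        exact ne_top_of_le_ne_top (by finiteness) hle
    rw [e1]
    refine enorm_tsum_le_tsum_enorm.trans ?_
    rw [hh, lintegral_tsum fun y => (hbi y).1.enorm.restrict, ← ENNReal.tsum_mul_left, hΦ,
      ← ENNReal.tsum_add]
    refine ENNReal.tsum_le_tsum fun y => ?_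
    have hRy := hR y y.2
    have hfar : (2 * κ ^ 2 + M) * R y ≤ N ((y : G)⁻¹ * z) := by
      have h1 : L * R y ≤ N (z⁻¹ * y) := by
        by_contra hlt
        exact hz (Set.mem_biUnion y.2 (not_le.1 hlt))
      have h2 := hN.inv_le ((y : G)⁻¹ * z)
      rw [show ((y : G)⁻¹ * z)⁻¹ = z⁻¹ * y by group] at h2
      have h3 : κ * ((2 * κ ^ 2 + M) * R y) ≤ κ * N ((y : G)⁻¹ * z) := by
        rw [← mul_assoc]; exact h1.trans h2
      exact le_of_mul_le_mul_left h3 hκ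
    have hmem : z ∈ T y := by
      refine le_trans ?_ hfar
      have : 0 ≤ κ ^ 2 * R y := by positivity
      nlinarith
    rw [Set.indicator_of_mem hmem]
    exact hK.enorm_conv_tailK_le hN hM hε hRy (hbi y) (hbsupp y) (hb0 y) hfar
  have hsub : {z | ∃ ε, 0 < ε ∧ t < |conv μ (tailK N K ε) f z|} ⊆
      {z | ∃ ε, 0 < ε ∧ t / 2 < |conv μ (tailK N K ε) g z|} ∪ (Ω ∪
        ({z | ENNReal.ofReal (t / 4) ≤ Φ z} ∪
        {z | ∃ r, 0 < r ∧ ENNReal.ofReal (t / 4 / 3 ^ D * r ^ D) <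
          ∫⁻ ζ in gball N z r, h ζ ∂μ})) := by
    rintro z ⟨ε, hε, hz⟩
    by_cases h1 : t / 2 < |conv μ (tailK N K ε) g z|
    · exact Or.inl ⟨ε, hε, h1⟩
    by_cases h2 : z ∈ Ω
    · exact Or.inr (Or.inl h2)
    by_cases h3 : ENNReal.ofReal (t / 4) ≤ Φ z
    · exact Or.inr (Or.inr (Or.inl h3))
    refine Or.inr (Or.inr (Or.inr ⟨3 * ε, by positivity, ?_⟩))
    push Not at h1 h3
    have e1 := hK.conv_tailK_add hN hε hgi hfg z
    simp only [add_sub_cancel] at e1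
    have h4 : t / 2 < |conv μ (tailK N K ε) (fun ζ => f ζ - g ζ) z| := by
      have := abs_add_le (conv μ (tailK N K ε) g z) (conv μ (tailK N K ε) (fun ζ => f ζ - g ζ) z)
      rw [← e1] at this
      linarith
    by_contra hlt
    push Not at hlt
    have h5 := hbad z h2 ε hε
    have h6 : ENNReal.ofReal ((ε ^ D)⁻¹) * ∫⁻ ζ in gball N z (3 * ε), h ζ ∂μ ≤
        ENNReal.ofReal (t / 4) := by
      refine (mul_le_mul_right hlt _).trans (le_of_eq ?_)
      rw [← ENNReal.ofReal_mul (by positivity)]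
      congr 1
      rw [mul_pow]; field_simp
    have h7 : ENNReal.ofReal (t / 2) < ENNReal.ofReal (t / 4) + ENNReal.ofReal (t / 4) := by
      calc ENNReal.ofReal (t / 2)
          < ‖conv μ (tailK N K ε) (fun ζ => f ζ - g ζ) z‖ₑ := by
            rw [Real.enorm_eq_ofReal_abs]
            exact (ENNReal.ofReal_lt_ofReal_iff (lt_trans (by positivity) h4)).2 h4
        _ ≤ _ := h5
        _ < _ := ENNReal.add_lt_add_of_lt_of_le (ne_top_of_le_ne_top ENNReal.ofReal_ne_top h6) h3 h6
    rw [← ENNReal.ofReal_add (by positivity) (by positivity)] at h7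
    exact absurd h7 (by rw [show t / 4 + t / 4 = t / 2 by ring]; exact lt_irrefl _)
  refine (measure_mono hsub).trans ?_
  have m1 : μ {z | ∃ ε, 0 < ε ∧ t / 2 < |conv μ (tailK N K ε) g z|} ≤
      ENNReal.ofReal (2 * C₁ / t) * I := by
    refine (good K hK (t / 2) (by positivity) g hgi hgb').trans ?_
    rw [show C₁ / (t / 2) = 2 * C₁ / t by field_simp]
    gcongr
  have m2 : μ Ω ≤ ENNReal.ofReal (Ca / t) * I := by
    refine (hN.measure_iUnion_enlarged_le hu hR hLp).trans
      ((mul_le_mul_right hRsum _).trans (le_of_eq ?_))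
    rw [← mul_assoc, ← ENNReal.ofReal_mul (by positivity)]
    congr 2
    rw [hCa]; field_simp
  have m3 : μ {z | ENNReal.ofReal (t / 4) ≤ Φ z} ≤ ENNReal.ofReal (Cb / t) * I := by
    have h1 := meas_ge_le_lintegral_div (μ := μ) hΦm.aemeasurable
      (ε := ENNReal.ofReal (t / 4)) (by simpa using ht) ENNReal.ofReal_ne_top
    refine h1.trans ((ENNReal.div_le_div_right hΦI _).trans (le_of_eq ?_))
    rw [ENNReal.div_eq_inv_mul, ← ENNReal.ofReal_inv_of_pos (by positivity), ← mul_assoc,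
      ← mul_assoc, ← ENNReal.ofReal_mul (by positivity)]
    congr 1
    rw [show (2 : ℝ≥0∞) = ENNReal.ofReal 2 by simp, ← ENNReal.ofReal_mul (by positivity)]
    congr 1
    rw [hCb]; field_simp
  have m4 : μ {z | ∃ r, 0 < r ∧ ENNReal.ofReal (t / 4 / 3 ^ D * r ^ D) <
      ∫⁻ ζ in gball N z r, h ζ ∂μ} ≤ ENNReal.ofReal (Cc / t) * I := by
    refine (hN.measure_maximal_le hhfin (by positivity)).trans
      ((mul_le_mul_right hhI _).trans (le_of_eq ?_))
    rw [show (2 : ℝ≥0∞) = ENNReal.ofReal 2 by simp, ← mul_assoc,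
      ← ENNReal.ofReal_mul (by positivity)]
    congr 2
    rw [hCc]; field_simp
  have hsplit : ENNReal.ofReal ((2 * C₁ + (Ca + Cb + Cc)) / t) * I =
      ENNReal.ofReal (2 * C₁ / t) * I + (ENNReal.ofReal (Ca / t) * I +
        (ENNReal.ofReal (Cb / t) * I + ENNReal.ofReal (Cc / t) * I)) := by
    rw [← add_mul, ← add_mul, ← add_mul, ← ENNReal.ofReal_add (by positivity) (by positivity),
      ← ENNReal.ofReal_add (by positivity) (by positivity),
      ← ENNReal.ofReal_add (by positivity) (by positivity)]
    congr 2
    ring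
  rw [hsplit]
  exact (measure_union_le _ _).trans (add_le_add m1 ((measure_union_le _ _).trans
    (add_le_add m2 ((measure_union_le _ _).trans (add_le_add m3 m4)))))

end WeakType

/-! ### Almost everywhere existence of principal values -/

section PrincipalValue

open scoped ENNReal

variable {G : Type*} [Group G] [TopologicalSpace G] [IsTopologicalGroup G]
  [MeasurableSpace G] [BorelSpace G] {μ : Measure G}
  {N : G → ℝ} {κ V : ℝ} {D : ℕ} {M : ℝ} {K : G → ℝ}

/-- The function `N ^ (-D) N` is integrable near the identity, by summation over dyadic annuli. -/
theorem IsGauge.lintegral_near_le (hN : IsGauge μ N κ V D) :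
    ∫⁻ u in {u | N u ≤ 1}, ENNReal.ofReal ((N u ^ D)⁻¹ * N u) ∂μ ≤
      ENNReal.ofReal (V * 4 ^ D * 2) := by
  have hV := hN.V_pos
  set A : ℕ → Set G := fun i => {u | (1 / 2) ^ (i + 1) < N u ∧ N u ≤ (1 / 2) ^ i} with hA
  have hAm : ∀ i, MeasurableSet (A i) := fun i => hN.measurableSet_annulus _ _
  have hm : MeasurableSet {u | N u ≤ 1} :=
    measurableSet_le hN.continuous.measurable measurable_const
  have pt : ∀ u ∈ {u | N u ≤ 1}, ENNReal.ofReal ((N u ^ D)⁻¹ * N u) ≤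
      ∑' i, (A i).indicator (fun u => ENNReal.ofReal ((N u ^ D)⁻¹ * N u)) u := by
    intro u hu
    rcases eq_or_lt_of_le (hN.nonneg u) with h0 | h0
    · rw [← h0]; simp
    · obtain ⟨i, h1, h2⟩ := exists_nat_pow_near_of_lt_one h0 hu (y := (1 / 2 : ℝ)) (by norm_num)
        (by norm_num)
      refine le_trans (le_of_eq ?_) (ENNReal.le_tsum i)
      rw [Set.indicator_of_mem (show u ∈ A i from ⟨h1, h2⟩)]
  have piece : ∀ i, ∫⁻ u in A i, ENNReal.ofReal ((N u ^ D)⁻¹ * N u) ∂μ ≤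
      ENNReal.ofReal (V * 4 ^ D * (1 / 2) ^ i) := by
    intro i
    calc ∫⁻ u in A i, ENNReal.ofReal ((N u ^ D)⁻¹ * N u) ∂μ
        ≤ ∫⁻ _ in A i, ENNReal.ofReal ((((1 / 2) ^ (i + 1)) ^ D)⁻¹ * (1 / 2) ^ i) ∂μ := by
          refine setLIntegral_mono' (hAm i) fun u hu => ENNReal.ofReal_le_ofReal ?_
          have h1 : (1 / 2) ^ (i + 1) < N u := hu.1
          have h2 : N u ≤ (1 / 2) ^ i := hu.2
          have h3 := hN.nonneg u
          gcongr
      _ ≤ ENNReal.ofReal ((((1 / 2) ^ (i + 1)) ^ D)⁻¹ * (1 / 2) ^ i) *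
            μ {u | N u < 2 * (1 / 2) ^ i} := by
          rw [setLIntegral_const]
          gcongr
          intro u hu
          have h2 : N u ≤ (1 / 2) ^ i := hu.2
          have : (0 : ℝ) < (1 / 2) ^ i := by positivity
          exact show N u < 2 * (1 / 2) ^ i by linarith
      _ = _ := by
          rw [hN.volume_lt _ (by positivity), ← ENNReal.ofReal_mul (by positivity)]
          congr 1
          rw [mul_pow 2, pow_succ, mul_pow _ (1 / 2 : ℝ) D, one_div_pow 2 D,
            show (4 : ℝ) = 2 * 2 by norm_num, mul_pow]
          field_simp
  calc _ ≤ ∫⁻ u in {u | N u ≤ 1},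
        ∑' i, (A i).indicator (fun u => ENNReal.ofReal ((N u ^ D)⁻¹ * N u)) u ∂μ :=
        setLIntegral_mono' hm pt
    _ ≤ ∫⁻ u, ∑' i, (A i).indicator (fun u => ENNReal.ofReal ((N u ^ D)⁻¹ * N u)) u ∂μ :=
        setLIntegral_le_lintegral _ _
    _ = ∑' i, ∫⁻ u in A i, ENNReal.ofReal ((N u ^ D)⁻¹ * N u) ∂μ := by
        rw [lintegral_tsum fun i => ?_]
        · simp only [lintegral_indicator (hAm _)]
        · refine ((ENNReal.measurable_ofReal.comp ?_).indicator (hAm i)).aemeasurable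
          exact ((hN.continuous.measurable.pow_const _).inv).mul hN.continuous.measurable
    _ ≤ ∑' i : ℕ, ENNReal.ofReal (V * 4 ^ D * (1 / 2) ^ i) := ENNReal.tsum_le_tsum piece
    _ = ENNReal.ofReal (V * 4 ^ D * 2) := by
        rw [← ENNReal.ofReal_tsum_of_nonneg (fun i => by positivity)
          (summable_geometric_two.mul_left _), tsum_mul_left, tsum_geometric_two]

variable [SecondCountableTopology G] [μ.IsMulRightInvariant] [μ.IsInvInvariant]

variable [LocallyCompactSpace G] [T2Space G] [μ.Regular]

namespace IsSingularKernel

variable (hN : IsGauge μ N κ V D) (hK : IsSingularKernel μ N D M K)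
include hN hK

/-- The principal value exists where the function is Lipschitz with respect to the gauge: the
vanishing of the kernel over annuli allows `φ z` to be subtracted near the singularity. -/
theorem exists_tendsto_conv_tailK {φ : G → ℝ} (hφ : Integrable φ μ) {z : G} {C : ℝ}
    (hL : ∀ u, N u ≤ 1 → |φ (z * u⁻¹) - φ z| ≤ C * N u) :
    ∃ l, Tendsto (fun ε => conv μ (tailK N K ε) φ z) (𝓝[>] 0) (𝓝 l) := by
  set S : Set G := {u | N u ≤ 1} with hS
  have hSm : MeasurableSet S := measurableSet_le hN.continuous.measurable measurable_const
  set φz : G → ℝ := fun u => φ (z * u⁻¹) with hφz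
  have hφzi : Integrable φz μ := by
    have h1 : MeasurePreserving (fun u : G => z * u⁻¹) μ μ :=
      (measurePreserving_mul_left_of_inv z).comp (Measure.measurePreserving_inv μ)
    exact h1.integrable_comp_of_integrable hφ
  set F : ℝ → G → ℝ := fun ε => S.indicator (fun u => tailK N K ε u * (φz u - φ z)) with hF
  have htm : ∀ ε, AEStronglyMeasurable (tailK N K ε) μ := fun ε =>
    (hK.measurable_tailK hN ε).aestronglyMeasurable
  have hFm : ∀ ε, AEStronglyMeasurable (F ε) μ := fun ε =>
    ((htm ε).mul (hφzi.1.sub aestronglyMeasurable_const)).indicator hSm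
  set G₀ : G → ℝ := S.indicator fun u => |C| * ((N u ^ D)⁻¹ * N u) with hG₀
  have hG₀i : Integrable G₀ μ := by
    rw [hG₀, integrable_indicator_iff hSm]
    refine Integrable.const_mul ⟨?_, ?_⟩ _
    · exact (((hN.continuous.measurable.pow_const _).inv).mul
        hN.continuous.measurable).aestronglyMeasurable
    · refine lt_of_le_of_lt (le_of_eq ?_) (hN.lintegral_near_le.trans_lt ENNReal.ofReal_lt_top)
      refine lintegral_congr fun u => ?_
      have := hN.nonneg u
      rw [Real.enorm_eq_ofReal_abs, abs_of_nonneg (by positivity)]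
  have hbound : ∀ ε u, ‖F ε u‖ ≤ G₀ u := by
    intro ε u
    by_cases hu : u ∈ S
    · simp only [hF, hG₀, Set.indicator_of_mem hu, norm_mul, Real.norm_eq_abs]
      have h1 : |tailK N K ε u| ≤ (N u ^ D)⁻¹ := by
        by_cases h : ε < N u
        · rw [tailK, Set.indicator_of_mem (s := {u | ε < N u}) h]; exact hK.size u
        · rw [tailK, Set.indicator_of_notMem (s := {u | ε < N u}) h, abs_zero]
          have := hN.nonneg u
          positivity
      have h2 : |φz u - φ z| ≤ |C| * N u :=
        (hL u hu).trans (mul_le_mul_of_nonneg_right (le_abs_self C) (hN.nonneg u))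
      calc _ ≤ (N u ^ D)⁻¹ * (|C| * N u) := mul_le_mul h1 h2 (abs_nonneg _)
            (inv_nonneg.2 (pow_nonneg (hN.nonneg u) _))
        _ = _ := by ring
    · simp [hF, hG₀, hu]
  have hFi : ∀ ε, Integrable (F ε) μ := fun ε =>
    hG₀i.mono' (hFm ε) (Eventually.of_forall (hbound ε))
  have hlim : Tendsto (fun ε => ∫ u, F ε u ∂μ) (𝓝[>] 0)
      (𝓝 (∫ u, S.indicator (fun u => tailK N K 0 u * (φz u - φ z)) u ∂μ)) := by
    refine tendsto_integral_filter_of_dominated_convergence G₀ (Eventually.of_forall hFm)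
      (Eventually.of_forall fun ε => Eventually.of_forall (hbound ε)) hG₀i
      (Eventually.of_forall fun u => ?_)
    refine tendsto_const_nhds.congr' ?_
    rcases eq_or_lt_of_le (hN.nonneg u) with h0 | h0
    · filter_upwards [self_mem_nhdsWithin] with ε hε
      have hε'' : ¬ ε < 0 := not_lt.2 (le_of_lt hε)
      simp [hF, Set.indicator_apply, tailK, hε'', ← h0]
    · filter_upwards [nhdsWithin_le_nhds (eventually_lt_nhds h0)] with ε hε
      simp [hF, Set.indicator_apply, tailK, hε, h0]
  refine ⟨_, (hlim.add_const (conv μ (tailK N K 1) φ z)).congr' ?_⟩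
  have hone : ∀ᶠ ε : ℝ in 𝓝[>] 0, ε < 1 :=
    nhdsWithin_le_nhds (eventually_lt_nhds zero_lt_one)
  filter_upwards [self_mem_nhdsWithin, hone] with ε hε hε1
  have hε0 : (0 : ℝ) < ε := hε
  have hai := hK.integrable_annK hN hε0 (b := 1) one_pos
  have hti : ∀ ε, 0 < ε → Integrable (fun u => tailK N K ε u * φz u) μ := fun ε h =>
    hφzi.bdd_mul (htm ε) (Eventually.of_forall fun u => hK.abs_tailK_le hN h u)
  have e1 : ∫ u, annK N K ε 1 u * φ z ∂μ = 0 := by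
    rw [integral_mul_const, hK.integral_annK hN hε0 hε1, zero_mul]
  -- subtracting the constant `φ z` on the annulus `ε < N ≤ 1` does not change the integral
  have e2 : ∀ u, F ε u + tailK N K 1 u * φz u = tailK N K ε u * φz u - annK N K ε 1 u * φ z := by
    intro u
    by_cases h1 : N u ≤ 1
    · have h2 : ¬ 1 < N u := not_lt.2 h1
      simp only [hF, tailK, annK, Set.indicator_apply, Set.mem_ofPred_eq, h1, h2, hS, if_true,
        if_false, and_true]
      split_ifs <;> ring
    · have h2 : 1 < N u := not_le.1 h1
      have h3 : ε < N u := hε1.trans h2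
      simp [hF, tailK, annK, Set.indicator_apply, h1, h2, hS, h3]
  rw [conv_eq_integral, conv_eq_integral, ← integral_add (hFi ε) (hti 1 one_pos)]
  simp only [e2]
  rw [integral_sub (hti ε hε0) (hai.mul_const _), e1, sub_zero]

end IsSingularKernel

/-- Principal values of integrable functions exist almost everywhere, provided that the functions
that are pointwise Lipschitz with respect to the gauge are dense in `L¹`. -/
theorem IsSingularKernel.ae_exists_tendsto (hN : IsGauge μ N κ V D)
    (hK : IsSingularKernel μ N D M K) (hM : 1 ≤ M)
    (dense : ∀ f : G → ℝ, Integrable f μ → ∀ η : ℝ, 0 < η → ∃ φ : G → ℝ, Integrable φ μ ∧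
      ∫⁻ z, ‖f z - φ z‖ₑ ∂μ ≤ ENNReal.ofReal η ∧
      ∀ z, ∃ C, ∀ u, N u ≤ 1 → |φ (z * u⁻¹) - φ z| ≤ C * N u)
    {f : G → ℝ} (hf : Integrable f μ) :
    ∀ᵐ z ∂μ, ∃ l, Tendsto (fun ε => conv μ (tailK N K ε) f z) (𝓝[>] 0) (𝓝 l) := by
  obtain ⟨C, hC, hmax⟩ := hN.exists_measure_maximal_truncation_le hM
  set T : ℝ → G → ℝ := fun ε z => conv μ (tailK N K ε) f z with hT
  -- the points where the oscillation of the truncations as `ε → 0` exceeds `θ`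
  set Ω : ℝ → Set G := fun θ => {z | ∀ δ, 0 < δ → ∃ ε ε', 0 < ε ∧ ε < δ ∧ 0 < ε' ∧ ε' < δ ∧
    θ < |T ε z - T ε' z|} with hΩ
  have hzero : ∀ θ, 0 < θ → μ (Ω θ) = 0 := by
    intro θ hθ
    refine le_antisymm (ENNReal.le_of_forall_pos_le_add fun η hη _ => ?_) bot_le
    have hη' : (0 : ℝ) < η := hη
    obtain ⟨φ, hφ, hfφ, hlip⟩ := dense f hf (η / (C / (θ / 4))) (by positivity)
    have hsub : Ω θ ⊆ {z | ∃ ε, 0 < ε ∧ θ / 4 < |conv μ (tailK N K ε) (fun ζ => f ζ - φ ζ) z|} := by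
      intro z hz
      obtain ⟨Cz, hCz⟩ := hlip z
      obtain ⟨l, hl⟩ := hK.exists_tendsto_conv_tailK hN hφ hCz
      have h1 : ∀ᶠ ε in 𝓝[>] (0 : ℝ), |conv μ (tailK N K ε) φ z - l| < θ / 4 :=
        (Metric.tendsto_nhds.1 hl) (θ / 4) (by positivity)
      obtain ⟨δ, hδ, hδs⟩ := mem_nhdsGT_iff_exists_Ioo_subset.1 h1
      obtain ⟨ε, ε', e1, e2, e3, e4, e5⟩ := hz δ hδ
      have a1 : |conv μ (tailK N K ε) φ z - l| < θ / 4 := hδs ⟨e1, e2⟩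
      have a2 : |conv μ (tailK N K ε') φ z - l| < θ / 4 := hδs ⟨e3, e4⟩
      have s : ∀ ε, 0 < ε → T ε z = conv μ (tailK N K ε) φ z +
          conv μ (tailK N K ε) (fun ζ => f ζ - φ ζ) z := fun ε hε => by
        have hfφi : Integrable (fun ζ => f ζ - φ ζ) μ := hf.sub hφ
        have := hK.conv_tailK_add hN hε hφ hfφi z
        simp only [add_sub_cancel] at this
        exact this
      by_contra hcon
      have b1 : ∀ ε, 0 < ε → |conv μ (tailK N K ε) (fun ζ => f ζ - φ ζ) z| ≤ θ / 4 := fun ε hε => by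
        by_contra h
        exact hcon ⟨ε, hε, not_le.1 h⟩
      have c1 := b1 ε e1
      have c2 := b1 ε' e3
      rw [s ε e1, s ε' e3] at e5
      rw [abs_lt] at a1 a2
      rw [abs_le] at c1 c2
      rcases lt_abs.1 e5 with h | h <;> linarith
    refine (measure_mono hsub).trans ((hmax K hK (θ / 4) (by positivity) _ (hf.sub hφ)).trans ?_)
    refine (mul_le_mul_right hfφ _).trans (le_of_eq ?_)
    rw [← ENNReal.ofReal_mul (by positivity), mul_div_cancel₀ _ (by positivity), zero_add,
      ENNReal.ofReal_coe_nnreal]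
  have all : ∀ᵐ z ∂μ, ∀ n : ℕ, z ∉ Ω (1 / ((n : ℝ) + 1)) := by
    rw [ae_all_iff]
    exact fun n => measure_eq_zero_iff_ae_notMem.1 (hzero _ (by positivity))
  filter_upwards [all] with z hz
  refine cauchy_map_iff_exists_tendsto.1 (Metric.cauchy_iff.2 ⟨inferInstance, fun η hη => ?_⟩)
  obtain ⟨n, hn⟩ := exists_nat_one_div_lt hη
  have h := hz n
  simp only [hΩ, Set.mem_ofPred_eq] at h
  push Not at h
  obtain ⟨δ, hδ, hδ'⟩ := h
  refine ⟨(fun ε => T ε z) '' Set.Ioo 0 δ, image_mem_map (Ioo_mem_nhdsGT hδ), ?_⟩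
  rintro _ ⟨ε, hε, rfl⟩ _ ⟨ε', hε', rfl⟩
  rw [Real.dist_eq]
  exact (hδ' ε ε' hε.1 hε.2 hε'.1 hε'.2).trans_lt hn

end PrincipalValue

/-! ### The homogeneous norm and the dilations -/

section HomNorm

variable {d : ℕ} {s : Fin (d + 1) → ℕ}

theorem one_le_expo (i : Idx s) : 1 ≤ expo i := by
  cases i <;> simp [expo]

theorem expo_le (i : Idx s) : expo i ≤ 2 * d + 2 := by
  cases i with
  | none => simp [expo]
  | some p =>
    have := p.1.isLt
    simp only [expo]
    omega

@[simp] theorem dil_apply (r : ℝ) (z : Pt s) (i : Idx s) : dil r z i = r ^ expo i * z i := rfl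

theorem dil_add (r : ℝ) (z w : Pt s) : dil r (z + w) = dil r z + dil r w := by
  ext i; simp [mul_add]

theorem dil_dil (r r' : ℝ) (z : Pt s) : dil r (dil r' z) = dil (r * r') z := by
  ext i; simp [mul_pow, mul_assoc]

@[simp] theorem dil_one (z : Pt s) : dil 1 z = z := by
  ext i; simp

@[simp] theorem dil_apply_zero (r : ℝ) : dil r (0 : Pt s) = 0 := by
  ext i; simp

theorem norm_dil_le_of_forall {r c : ℝ} (hr : 0 ≤ r) (hc : ∀ i : Idx s, r ^ expo i ≤ c)
    (z : Pt s) : ‖dil r z‖ ≤ c * ‖z‖ := by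
  have hc0 : 0 ≤ c := (pow_nonneg hr _).trans (hc none)
  rw [EuclideanSpace.norm_eq, EuclideanSpace.norm_eq]
  refine Real.sqrt_le_iff.2 ⟨by positivity, ?_⟩
  rw [mul_pow, Real.sq_sqrt (Finset.sum_nonneg fun i _ => sq_nonneg _), Finset.mul_sum]
  refine Finset.sum_le_sum fun i _ => ?_
  rw [dil_apply, norm_mul, mul_pow, Real.norm_of_nonneg (pow_nonneg hr _)]
  have := hc i
  gcongr

theorem norm_dil_le {r : ℝ} (hr : 0 ≤ r) (hr1 : r ≤ 1) (z : Pt s) : ‖dil r z‖ ≤ r * ‖z‖ :=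
  norm_dil_le_of_forall hr
    (fun i => pow_le_of_le_one hr hr1 (by have := one_le_expo i; omega)) z

@[simp] theorem homNorm_zero : homNorm (0 : Pt s) = 0 := by
  simp [homNorm]

theorem homNorm_pos {z : Pt s} (hz : z ≠ 0) : 0 < homNorm z := by
  rw [homNorm, dif_neg hz]
  exact (existsUnique_homNorm hz).exists.choose_spec.1

theorem norm_sq_dil_inv (ρ : ℝ) (z : Pt s) :
    ‖dil ρ⁻¹ z‖ ^ 2 = ∑ i, z i ^ 2 / ρ ^ (2 * expo i) := by
  rw [EuclideanSpace.norm_sq_eq]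
  refine Finset.sum_congr rfl fun i _ => ?_
  rw [dil_apply, Real.norm_eq_abs, sq_abs, mul_pow, inv_pow, inv_pow, ← pow_mul, mul_comm 2,
    div_eq_inv_mul]

theorem norm_dil_homNorm_inv {z : Pt s} (hz : z ≠ 0) : ‖dil (homNorm z)⁻¹ z‖ = 1 := by
  have h := (existsUnique_homNorm hz).exists.choose_spec.2
  have h2 : ‖dil (homNorm z)⁻¹ z‖ ^ 2 = 1 := by
    rw [norm_sq_dil_inv, homNorm, dif_neg hz]
    exact h
  exact (pow_eq_one_iff_of_nonneg (norm_nonneg _) two_ne_zero).1 h2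

theorem norm_dil_homNorm_inv_le (z : Pt s) : ‖dil (homNorm z)⁻¹ z‖ ≤ 1 := by
  by_cases hz : z = 0
  · simp [hz]
  · exact (norm_dil_homNorm_inv hz).le

theorem homNorm_nonneg (z : Pt s) : 0 ≤ homNorm z := by
  by_cases hz : z = 0
  · simp [hz]
  · exact (homNorm_pos hz).le

theorem homNorm_eq_zero_iff {z : Pt s} : homNorm z = 0 ↔ z = 0 :=
  ⟨fun h => by_contra fun hz => (homNorm_pos hz).ne' h, fun h => by simp [h]⟩

theorem homNorm_eq_of_norm_dil {z : Pt s} {ρ : ℝ} (hρ : 0 < ρ) (h : ‖dil ρ⁻¹ z‖ = 1) :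
    homNorm z = ρ := by
  have hz : z ≠ 0 := by
    rintro rfl
    simp at h
  refine (existsUnique_homNorm hz).unique ⟨homNorm_pos hz, ?_⟩ ⟨hρ, ?_⟩
  · rw [← norm_sq_dil_inv, norm_dil_homNorm_inv hz, one_pow]
  · rw [← norm_sq_dil_inv, h, one_pow]

theorem homNorm_dil {r : ℝ} (hr : 0 ≤ r) (z : Pt s) : homNorm (dil r z) = r * homNorm z := by
  rcases eq_or_lt_of_le hr with rfl | hr
  · have : dil 0 z = 0 := by
      ext i
      have := one_le_expo i
      simp [show expo i ≠ 0 by omega]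
    simp [this]
  by_cases hz : z = 0
  · simp [hz]
  have hp := homNorm_pos hz
  refine homNorm_eq_of_norm_dil (mul_pos hr hp) ?_
  rw [dil_dil, mul_inv, mul_right_comm, inv_mul_cancel₀ hr.ne', one_mul, norm_dil_homNorm_inv hz]

theorem homNorm_le_iff {z : Pt s} {ρ : ℝ} (hρ : 0 < ρ) : homNorm z ≤ ρ ↔ ‖dil ρ⁻¹ z‖ ≤ 1 := by
  by_cases hz : z = 0
  · simp [hz, hρ.le]
  have hp := homNorm_pos hz
  constructor
  · intro h
    have e : dil ρ⁻¹ z = dil (homNorm z / ρ) (dil (homNorm z)⁻¹ z) := by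
      rw [dil_dil]; congr 1; field_simp
    have h1 : homNorm z / ρ ≤ 1 := (div_le_one hρ).2 h
    have := norm_dil_le (by positivity) h1 (dil (homNorm z)⁻¹ z)
    rw [norm_dil_homNorm_inv hz, mul_one] at this
    rw [e]
    exact this.trans h1
  · intro h
    by_contra! hc
    have e : dil (homNorm z)⁻¹ z = dil (ρ / homNorm z) (dil ρ⁻¹ z) := by
      rw [dil_dil]; congr 1; field_simp
    have h1 : ρ / homNorm z < 1 := (div_lt_one hp).2 hc
    have h2 := norm_dil_le (by positivity) h1.le (dil ρ⁻¹ z)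
    rw [← e, norm_dil_homNorm_inv hz] at h2
    have : ρ / homNorm z * ‖dil ρ⁻¹ z‖ ≤ ρ / homNorm z * 1 := by gcongr
    linarith

theorem homNorm_lt_iff {z : Pt s} {ρ : ℝ} (hρ : 0 < ρ) : homNorm z < ρ ↔ ‖dil ρ⁻¹ z‖ < 1 := by
  rw [lt_iff_le_and_ne, lt_iff_le_and_ne, homNorm_le_iff hρ]
  refine and_congr_right fun _ => not_congr ⟨fun h => ?_, homNorm_eq_of_norm_dil hρ⟩
  have hz : z ≠ 0 := by
    rintro rfl
    rw [homNorm_zero] at h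
    exact hρ.ne h
  rw [← h, norm_dil_homNorm_inv hz]

theorem norm_le_homNorm {z : Pt s} (h : homNorm z ≤ 1) : ‖z‖ ≤ homNorm z := by
  by_cases hz : z = 0
  · simp [hz]
  have hp := homNorm_pos hz
  have e : z = dil (homNorm z) (dil (homNorm z)⁻¹ z) := by
    rw [dil_dil, mul_inv_cancel₀ hp.ne', dil_one]
  have := norm_dil_le hp.le h (dil (homNorm z)⁻¹ z)
  rwa [← e, norm_dil_homNorm_inv hz, mul_one] at this

theorem homNorm_le_one_iff {z : Pt s} : homNorm z ≤ 1 ↔ ‖z‖ ≤ 1 := by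
  rw [homNorm_le_iff one_pos, inv_one, dil_one]

theorem continuous_dil_apply (r : ℝ) : Continuous fun z : Pt s => dil r z := by
  unfold dil
  fun_prop

theorem continuous_homNorm : Continuous (homNorm : Pt s → ℝ) := by
  refine OrderTopology.continuous_iff.2 fun a => ?_
  rcases lt_trichotomy a 0 with ha | rfl | ha
  · have h1 : (homNorm : Pt s → ℝ) ⁻¹' Set.Ioi a = Set.univ :=
      Set.eq_univ_of_forall fun z => ha.trans_le (homNorm_nonneg z)
    have h2 : (homNorm : Pt s → ℝ) ⁻¹' Set.Iio a = ∅ :=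
      Set.eq_empty_of_forall_notMem fun z hz => (ha.trans_le (homNorm_nonneg z)).not_gt hz
    simp [h1, h2]
  · have h1 : (homNorm : Pt s → ℝ) ⁻¹' Set.Ioi 0 = {0}ᶜ := by
      ext z
      exact ⟨fun h hz => by
        rw [Set.mem_singleton_iff.1 hz] at h
        simp at h, fun h => homNorm_pos h⟩
    have h2 : (homNorm : Pt s → ℝ) ⁻¹' Set.Iio 0 = ∅ :=
      Set.eq_empty_of_forall_notMem fun z hz => (homNorm_nonneg z).not_gt hz
    rw [h1, h2]
    exact ⟨isOpen_compl_singleton, isOpen_empty⟩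
  · have h1 : (homNorm : Pt s → ℝ) ⁻¹' Set.Ioi a = {z | 1 < ‖dil a⁻¹ z‖} := by
      ext z
      exact lt_iff_lt_of_le_iff_le (homNorm_le_iff ha)
    have h2 : (homNorm : Pt s → ℝ) ⁻¹' Set.Iio a = {z | ‖dil a⁻¹ z‖ < 1} := by
      ext z
      exact homNorm_lt_iff ha
    rw [h1, h2]
    exact ⟨isOpen_lt continuous_const (continuous_dil_apply _).norm,
      isOpen_lt (continuous_dil_apply _).norm continuous_const⟩

/-- Away from the origin the homogeneous norm grows at most linearly in the Euclidean distance. -/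
theorem homNorm_le_add {p q : Pt s} (hp : 1 / 2 < homNorm p) :
    homNorm p ≤ homNorm q + 2 ^ (2 * d + 1) * ‖p - q‖ := by
  set h : ℝ := 2 ^ (2 * d + 1) * ‖p - q‖ with hh
  have hh0 : 0 ≤ h := by positivity
  -- for `σ ≥ 1 / 2` a dilation by `σ⁻¹ ≤ 2` expands by at most `2 ^ (2 d + 1) σ⁻¹`
  have key : ∀ σ : ℝ, 1 / 2 ≤ σ → homNorm q + h ≤ σ → homNorm p ≤ σ := by
    intro σ hσ hqσ
    have hσ0 : 0 < σ := by linarith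
    have hq0 := homNorm_nonneg q
    rw [homNorm_le_iff hσ0, ← add_sub_cancel q p, dil_add]
    have e : dil σ⁻¹ q = dil (homNorm q / σ) (dil (homNorm q)⁻¹ q) := by
      by_cases hq : q = 0
      · simp [hq]
      · have := homNorm_pos hq
        rw [dil_dil]; congr 1; field_simp
    have h1 : ‖dil σ⁻¹ q‖ ≤ homNorm q / σ := by
      rw [e]
      refine (norm_dil_le (by positivity) ((div_le_one hσ0).2 (by linarith)) _).trans ?_
      exact mul_le_of_le_one_right (by positivity) (norm_dil_homNorm_inv_le q)
    have h2 : ‖dil σ⁻¹ (p - q)‖ ≤ h / σ := by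
      have : ∀ i : Idx s, σ⁻¹ ^ expo i ≤ 2 ^ (2 * d + 1) * σ⁻¹ := by
        intro i
        obtain ⟨k, hk⟩ : ∃ k, expo i = k + 1 := ⟨expo i - 1, by have := one_le_expo i; omega⟩
        have hkd : k ≤ 2 * d + 1 := by have := expo_le i; omega
        have hσ2 : σ⁻¹ ≤ 2 := by
          rw [inv_le_comm₀ hσ0 two_pos]
          linarith
        rw [hk, pow_succ]
        have : σ⁻¹ ^ k ≤ 2 ^ (2 * d + 1) :=
          calc σ⁻¹ ^ k ≤ 2 ^ k := by gcongr
            _ ≤ 2 ^ (2 * d + 1) := pow_le_pow_right₀ one_le_two hkd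
        gcongr
      refine (norm_dil_le_of_forall (by positivity) this _).trans (le_of_eq ?_)
      rw [hh]; ring
    calc ‖dil σ⁻¹ q + dil σ⁻¹ (p - q)‖ ≤ homNorm q / σ + h / σ :=
          (norm_add_le _ _).trans (add_le_add h1 h2)
      _ = (homNorm q + h) / σ := by ring
      _ ≤ 1 := (div_le_one hσ0).2 hqσ
  have := key (max (1 / 2) (homNorm q + h)) (le_max_left _ _) (le_max_right _ _)
  rcases le_max_iff.1 this with h' | h'
  · linarith
  · exact h'

theorem sum_expo : ∑ i : Idx s, expo i = homDim s + 2 := by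
  rw [Fintype.sum_option, homDim, Fintype.sum_sigma]
  simp only [expo, Finset.sum_const, Finset.card_univ, Fintype.card_fin, smul_eq_mul]
  rw [add_comm]
  simp [mul_comm]

theorem card_idx : Fintype.card (Idx s) = spaceDim s + 1 := by
  simp [spaceDim]

theorem volume_homNorm_lt {r : ℝ} (hr : 0 < r) :
    volume {z : Pt s | homNorm z < r} =
      ENNReal.ofReal ((volume (Metric.ball (0 : Pt s) 1)).toReal * r ^ (homDim s + 2)) := by
  set A : Pt s →ₗ[ℝ] Pt s :=
    Matrix.toLin (EuclideanSpace.basisFun (Idx s) ℝ).toBasis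
      (EuclideanSpace.basisFun (Idx s) ℝ).toBasis (Matrix.diagonal fun i => r⁻¹ ^ expo i) with hA
  have hAz : ∀ z, A z = dil r⁻¹ z := by
    intro z
    ext i
    rw [hA, Matrix.toLin_apply]
    rcases i with _ | i <;> simp [Matrix.mulVec_diagonal, Pi.single_apply]
  have hdet : LinearMap.det A = r⁻¹ ^ (homDim s + 2) := by
    rw [hA, LinearMap.det_toLin, Matrix.det_diagonal, Finset.prod_pow_eq_pow_sum, sum_expo]
  have hset : {z : Pt s | homNorm z < r} = A ⁻¹' Metric.ball 0 1 := by
    ext z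
    rw [Set.mem_preimage, mem_ball_zero_iff, hAz]
    exact homNorm_lt_iff hr
  rw [hset, Measure.addHaar_preimage_linearMap _ (by rw [hdet]; positivity), hdet, inv_pow,
    inv_inv, abs_of_pos (by positivity), mul_comm (ENNReal.toReal _),
    ENNReal.ofReal_mul (by positivity), ENNReal.ofReal_toReal measure_ball_lt_top.ne]

end HomNorm

/-! ### The Kolmogorov group -/

section Group

open scoped ContDiff

variable {d : ℕ} {s : Fin (d + 1) → ℕ} (B : Matrix (SpaceIdx s) (SpaceIdx s) ℝ)

theorem flow_add (τ τ' : ℝ) : flow B (τ + τ') = flow B τ * flow B τ' := by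
  rw [flow, flow, flow, neg_add, add_smul, Matrix.exp_add_of_commute]
  exact ((Commute.refl _).smul_left _).smul_right _

@[simp] theorem flow_zero : flow B 0 = 1 := by
  simp [flow]

open scoped Matrix.Norms.Operator in
theorem contDiff_flow_apply (p q : SpaceIdx s) : ContDiff ℝ ∞ fun τ => flow B τ p q := by
  have h1 : ContDiff ℝ ∞ (NormedSpace.exp : Matrix (SpaceIdx s) (SpaceIdx s) ℝ → _) :=
    contDiff_iff_contDiffAt.2 fun x => (NormedSpace.exp_analytic (𝕂 := ℝ) x).contDiffAt
  have h2 : ContDiff ℝ ∞ fun τ : ℝ => -τ • B.transpose := by fun_prop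
  have h3 : ContDiff ℝ ∞ fun A : Matrix (SpaceIdx s) (SpaceIdx s) ℝ => A p q :=
    ((LinearMap.toContinuousLinearMap (Matrix.entryLinearMap ℝ ℝ p q))).contDiff
  exact h3.comp (h1.comp h2)

theorem continuous_flow : Continuous (flow B) :=
  continuous_matrix fun p q => (contDiff_flow_apply B p q).continuous

@[simp] theorem mkPt_none (x : SpaceIdx s → ℝ) (t : ℝ) : mkPt x t none = t := rfl

@[simp] theorem mkPt_some (x : SpaceIdx s → ℝ) (t : ℝ) (p : SpaceIdx s) :
    mkPt x t (some p) = x p := rfl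

@[simp] theorem spacePart_mkPt (x : SpaceIdx s → ℝ) (t : ℝ) : spacePart (mkPt x t) = x := rfl

@[simp] theorem mkPt_spacePart (z : Pt s) : mkPt (spacePart z) (z none) = z := by
  ext i; cases i <;> rfl

theorem op_assoc (u v w : Pt s) : op B (op B u v) w = op B u (op B v w) := by
  simp only [op, spacePart_mkPt, mkPt_none, Matrix.mulVec_add, Matrix.mulVec_mulVec, ← flow_add,
    add_assoc, add_comm (w none)]

theorem zero_op (u : Pt s) : op B 0 u = u := by
  have : spacePart (0 : Pt s) = 0 := rfl
  simp [op, this]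

theorem op_zero (u : Pt s) : op B u 0 = u := by
  have : spacePart (0 : Pt s) = 0 := rfl
  simp [op, this]

theorem inv_op (u : Pt s) : op B (inv B u) u = 0 := by
  have h : flow B (u none) * flow B (-u none) = 1 := by rw [← flow_add]; simp
  ext i
  cases i <;> simp [op, inv, Matrix.mulVec_neg, Matrix.mulVec_mulVec, h]

/-- The space `ℝ^{N+1}` regarded as a (multiplicative) group under the operation `op B`. -/
def KGroup {d : ℕ} {s : Fin (d + 1) → ℕ} (_B : Matrix (SpaceIdx s) (SpaceIdx s) ℝ) : Type := Pt s

instance : Group (KGroup B) where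
  mul := op B
  mul_assoc := op_assoc B
  one := (0 : Pt s)
  one_mul := zero_op B
  mul_one := op_zero B
  inv := inv B
  inv_mul_cancel := inv_op B

instance : TopologicalSpace (KGroup B) := inferInstanceAs (TopologicalSpace (Pt s))
instance : MeasurableSpace (KGroup B) := inferInstanceAs (MeasurableSpace (Pt s))
instance : BorelSpace (KGroup B) := inferInstanceAs (BorelSpace (Pt s))
instance : SecondCountableTopology (KGroup B) :=
  inferInstanceAs (SecondCountableTopology (Pt s))
instance : LocallyCompactSpace (KGroup B) := inferInstanceAs (LocallyCompactSpace (Pt s))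
instance : T2Space (KGroup B) := inferInstanceAs (T2Space (Pt s))
instance : NormalSpace (KGroup B) := inferInstanceAs (NormalSpace (Pt s))

/-- Lebesgue measure on the Kolmogorov group. -/
def lebesgue {d : ℕ} {s : Fin (d + 1) → ℕ} (B : Matrix (SpaceIdx s) (SpaceIdx s) ℝ) :
    Measure (KGroup B) := (volume : Measure (Pt s))

instance : (lebesgue B).Regular := inferInstanceAs (volume : Measure (Pt s)).Regular

theorem contDiff_op : ContDiff ℝ ∞ fun p : Pt s × Pt s => op B p.1 p.2 := by
  have hc : ∀ (i : Idx s), ContDiff ℝ ∞ fun z : Pt s => z i := fun i => by fun_prop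
  have h1 : ∀ i, ContDiff ℝ ∞ fun p : Pt s × Pt s => p.1 i := fun i => (hc i).comp contDiff_fst
  have h2 : ∀ i, ContDiff ℝ ∞ fun p : Pt s × Pt s => p.2 i := fun i => (hc i).comp contDiff_snd
  refine (contDiff_piLp 2).2 fun i => ?_
  rcases i with _ | p
  · exact (h1 none).add (h2 none)
  · refine (h2 (some p)).add (ContDiff.sum fun q _ => ?_)
    exact ((contDiff_flow_apply B p q).comp (h2 none)).mul (h1 (some q))

theorem contDiff_inv : ContDiff ℝ ∞ fun p : Pt s => inv B p := by
  have hc : ∀ (i : Idx s), ContDiff ℝ ∞ fun z : Pt s => z i := fun i => by fun_prop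
  refine (contDiff_piLp 2).2 fun i => ?_
  rcases i with _ | p
  · exact (hc none).neg
  · refine ContDiff.neg (ContDiff.sum fun q _ => ?_)
    exact ((contDiff_flow_apply B p q).comp (hc none).neg).mul (hc (some q))

instance : IsTopologicalGroup (KGroup B) where
  continuous_mul := (contDiff_op B).continuous
  continuous_inv := (contDiff_inv B).continuous

variable {B} (hB : IsKolmogorovMatrix s B)
include hB

/-- The exponential of `τ Bᵀ` is homogeneous for the dilations, because `B` raises the block index
by one and the exponents of consecutive blocks differ by two. -/
theorem flow_sq_mul {r : ℝ} (hr : r ≠ 0) (τ : ℝ) :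
    flow B (r ^ 2 * τ) = Matrix.diagonal (fun p : SpaceIdx s => r ^ expo (some p)) * flow B τ *
      Matrix.diagonal (fun p : SpaceIdx s => r⁻¹ ^ expo (some p)) := by
  set U : (Matrix (SpaceIdx s) (SpaceIdx s) ℝ)ˣ :=
    ⟨Matrix.diagonal fun p => r ^ expo (some p), Matrix.diagonal fun p => r⁻¹ ^ expo (some p),
      by simp [Matrix.diagonal_mul_diagonal, hr], by simp [Matrix.diagonal_mul_diagonal, hr]⟩
  have h := Matrix.exp_units_conj U (-τ • B.transpose)
  rw [flow, flow]
  refine Eq.trans ?_ h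
  congr 1
  ext p q
  change _ = (Matrix.diagonal (fun p : SpaceIdx s => r ^ expo (some p)) * (-τ • B.transpose) *
    Matrix.diagonal (fun p : SpaceIdx s => r⁻¹ ^ expo (some p))) p q
  rw [Matrix.mul_diagonal, Matrix.diagonal_mul]
  by_cases hpq : (p.1 : ℕ) = (q.1 : ℕ) + 1
  · have : expo (some p) = expo (some q) + 2 := by simp only [expo]; omega
    rw [this, pow_add]
    simp only [Matrix.smul_apply, Matrix.transpose_apply, smul_eq_mul, inv_pow]
    field_simp
  · simp [hB.zero_off q p hpq]

theorem dil_op {r : ℝ} (hr : r ≠ 0) (u v : Pt s) :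
    dil r (op B u v) = op B (dil r u) (dil r v) := by
  ext i
  rcases i with _ | p
  · simp [op, mul_add]
  · have h : ∀ q, flow B (dil r v none) p q = _ := fun q =>
      congrFun (congrFun (flow_sq_mul hB hr (v none)) p) q
    simp only [op, dil_apply, mkPt_some, Pi.add_apply] at h ⊢
    simp only [h, Matrix.mulVec, dotProduct, Matrix.mul_diagonal, Matrix.diagonal_mul, spacePart,
      dil_apply, mul_add, Finset.mul_sum]
    congr 1
    refine Finset.sum_congr rfl fun q _ => ?_
    rw [inv_pow]
    field_simp

theorem dil_inv {r : ℝ} (hr : r ≠ 0) (u : Pt s) : dil r (inv B u) = inv B (dil r u) := by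
  have h : op B (dil r (inv B u)) (dil r u) = 0 := by
    rw [← dil_op hB hr, inv_op, dil_apply_zero]
  exact eq_inv_of_mul_eq_one_left (G := KGroup B) h

/-- Dilations conjugate the flow at time `τ` to the flow at time `r² τ`, which tends to the
identity as `r → 0`. -/
theorem det_flow (τ : ℝ) : (flow B τ).det = 1 := by
  have h1 : ∀ r : ℝ, r ≠ 0 → (flow B (r ^ 2 * τ)).det = (flow B τ).det := by
    intro r hr
    rw [flow_sq_mul hB hr, Matrix.det_mul, Matrix.det_mul, mul_right_comm, ← Matrix.det_mul]
    simp [Matrix.diagonal_mul_diagonal, hr]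
  have h2 : Tendsto (fun r : ℝ => (flow B (r ^ 2 * τ)).det) (𝓝[≠] 0) (𝓝 1) := by
    have : Continuous fun r : ℝ => (flow B (r ^ 2 * τ)).det :=
      ((continuous_flow B).comp (by fun_prop)).matrix_det
    have h := this.tendsto 0
    simp only [ne_eq, OfNat.ofNat_ne_zero, not_false_eq_true, zero_pow, zero_mul, flow_zero,
      Matrix.det_one] at h
    exact h.mono_left nhdsWithin_le_nhds
  refine tendsto_nhds_unique (tendsto_const_nhds.congr' ?_) h2
  filter_upwards [self_mem_nhdsWithin] with r hr
  exact (h1 r hr).symm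

omit hB in
theorem measurePreserving_mkPt : MeasurePreserving
    (fun p : ℝ × (SpaceIdx s → ℝ) => mkPt p.2 p.1) (volume.prod volume) (volume : Measure (Pt s)) := by
  have h1 : MeasurePreserving (MeasurableEquiv.piOptionEquivProd fun _ : Idx s => ℝ).symm
      ((volume : Measure (SpaceIdx s → ℝ)).prod volume) volume :=
    ⟨MeasurableEquiv.measurable _, Measure.pi_map_piOptionEquivProd fun _ : Idx s => volume⟩
  have h2 := ((PiLp.volume_preserving_toLp (Idx s)).comp h1).comp
    (Measure.measurePreserving_swap (μ := (volume : Measure ℝ)))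
  have e : (fun p : ℝ × (SpaceIdx s → ℝ) => mkPt p.2 p.1) =
      (WithLp.toLp 2 ∘ (MeasurableEquiv.piOptionEquivProd fun _ : Idx s => ℝ).symm) ∘ Prod.swap := by
    funext p
    ext i
    cases i <;> rfl
  rw [e]
  exact h2

omit hB in
theorem measurePreserving_unmkPt : MeasurePreserving
    (fun z : Pt s => (z none, spacePart z)) volume
      ((volume : Measure ℝ).prod (volume : Measure (SpaceIdx s → ℝ))) := by
  have hm : Measurable fun z : Pt s => (z none, spacePart z) := by
    unfold spacePart
    fun_prop
  refine ⟨hm, ?_⟩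
  rw [← measurePreserving_mkPt.map_eq, Measure.map_map hm measurePreserving_mkPt.measurable]
  exact Measure.map_id

theorem measurePreserving_flow_mulVec (τ : ℝ) :
    MeasurePreserving (fun x : SpaceIdx s → ℝ => (flow B τ).mulVec x) := by
  have h := Real.map_matrix_volume_pi_eq_smul_volume_pi
    (M := flow B τ) (by rw [det_flow hB]; exact one_ne_zero)
  rw [det_flow hB] at h
  refine ⟨(Continuous.matrix_mulVec continuous_const continuous_id).measurable, ?_⟩
  simp only [inv_one, abs_one, ENNReal.ofReal_one, one_smul] at h
  exact h

theorem isMulRightInvariant_lebesgue : (lebesgue B).IsMulRightInvariant := by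
  refine ⟨fun (w : Pt s) => ?_⟩
  have h1 : MeasurePreserving (fun p : ℝ × (SpaceIdx s → ℝ) =>
      (p.1 + w none, spacePart w + (flow B (w none)).mulVec p.2))
      (volume.prod volume) (volume.prod volume) :=
    (measurePreserving_add_right volume _).prod
      ((measurePreserving_add_left volume _).comp (measurePreserving_flow_mulVec hB _))
  exact (measurePreserving_mkPt.comp (h1.comp measurePreserving_unmkPt)).map_eq

theorem isInvInvariant_lebesgue : (lebesgue B).IsInvInvariant := by
  refine ⟨?_⟩
  have h1 : MeasurePreserving (fun p : ℝ × (SpaceIdx s → ℝ) =>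
      (-p.1, -(flow B (-p.1)).mulVec p.2)) (volume.prod volume) (volume.prod volume) := by
    refine (Measure.measurePreserving_neg (volume : Measure ℝ)).skew_product
      (g := fun t x => -(flow B (-t)).mulVec x) ?_ (Eventually.of_forall fun t => ?_)
    · refine Continuous.measurable (Continuous.neg ?_)
      exact ((continuous_flow B).comp continuous_fst.neg).matrix_mulVec continuous_snd
    · exact ((Measure.measurePreserving_neg (volume : Measure (SpaceIdx s → ℝ))).comp
        (measurePreserving_flow_mulVec hB _)).map_eq
  exact (measurePreserving_mkPt.comp (h1.comp measurePreserving_unmkPt)).map_eq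

end Group

/-! ### The homogeneous norm as a gauge -/

section Gauge

open scoped ContDiff

variable {d : ℕ} {s : Fin (d + 1) → ℕ} (B : Matrix (SpaceIdx s) (SpaceIdx s) ℝ)

theorem exists_lipschitzOn_closedBall {E F : Type*} [NormedAddCommGroup E] [NormedSpace ℝ E]
    [FiniteDimensional ℝ E] [NormedAddCommGroup F] [NormedSpace ℝ F] {g : E → F}
    (hg : ContDiff ℝ ∞ g) (R : ℝ) :
    ∃ C, 0 ≤ C ∧ ∀ x y, ‖x‖ ≤ R → ‖y‖ ≤ R → ‖g x - g y‖ ≤ C * ‖x - y‖ := by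
  have : ProperSpace E := FiniteDimensional.proper ℝ E
  obtain ⟨C, hC⟩ := ((hg.of_le (by simp)).locallyLipschitz (𝕂 := ℝ)).locallyLipschitzOn
    |>.exists_lipschitzOnWith_of_compact (isCompact_closedBall (0 : E) R)
  refine ⟨C, C.2, fun x y hx hy => ?_⟩
  have := hC.dist_le_mul x (mem_closedBall_zero_iff.2 hx) y (mem_closedBall_zero_iff.2 hy)
  rwa [dist_eq_norm, dist_eq_norm] at this

/-- Translations by small elements move points of a bounded set by a small amount. -/
theorem exists_norm_op_sub_le : ∃ C : ℝ, 1 ≤ C ∧ ∀ u v : Pt s, ‖u‖ ≤ 1 → ‖v‖ ≤ 1 →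
    ‖op B u v - u‖ ≤ C * ‖v‖ ∧ ‖op B v u - u‖ ≤ C * ‖v‖ := by
  obtain ⟨C, hC, h⟩ := exists_lipschitzOn_closedBall (contDiff_op B) 1
  refine ⟨max 1 C, le_max_left _ _, fun u v hu hv => ⟨?_, ?_⟩⟩
  · have h1 := h (u, v) (u, 0) (by simp [hu, hv]) (by simp [hu])
    simp only [op_zero, Prod.mk_sub_mk, sub_self, sub_zero, Prod.norm_mk, norm_zero] at h1
    rw [max_eq_right (norm_nonneg v)] at h1
    exact h1.trans (by gcongr; exact le_max_right _ _)
  · have h1 := h (v, u) (0, u) (by simp [hu, hv]) (by simp [hu])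
    simp only [zero_op, Prod.mk_sub_mk, sub_self, sub_zero, Prod.norm_mk, norm_zero] at h1
    rw [max_eq_left (norm_nonneg v)] at h1
    exact h1.trans (by gcongr; exact le_max_right _ _)

variable {B}

/-- If translating by the dilates of `v` moves the dilates of `u` to those of `w`, with at most
linear displacement, then `w` satisfies a triangle inequality: dilate so that `w` gets norm one. -/
theorem homNorm_le_add_mul {C κ : ℝ} (hC : 0 ≤ C) (hκ : 1 ≤ κ) (hCκ : 2 ^ (2 * d + 1) * C ≤ κ)
    {u v w : Pt s} (h : ∀ r : ℝ, r ≠ 0 → ‖dil r u‖ ≤ 1 → ‖dil r v‖ ≤ 1 →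
      ‖dil r w - dil r u‖ ≤ C * ‖dil r v‖) :
    homNorm w ≤ homNorm u + κ * homNorm v := by
  have hu0 := homNorm_nonneg u
  have hv0 := homNorm_nonneg v
  by_cases hw : w = 0
  · rw [hw, homNorm_zero]
    positivity
  have hp := homNorm_pos hw
  have hr : (homNorm w)⁻¹ ≠ 0 := inv_ne_zero hp.ne'
  have hr0 : 0 ≤ (homNorm w)⁻¹ := by positivity
  suffices h1 : 1 ≤ (homNorm w)⁻¹ * homNorm u + κ * ((homNorm w)⁻¹ * homNorm v) by
    have h2 := mul_le_mul_of_nonneg_left h1 hp.le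
    field_simp at h2
    linarith
  have h1 := h _ hr
  have hw1 : homNorm (dil (homNorm w)⁻¹ w) = 1 := by
    rw [homNorm_dil hr0, inv_mul_cancel₀ hp.ne']
  rw [← homNorm_dil hr0, ← homNorm_dil hr0]
  generalize dil (homNorm w)⁻¹ u = u', dil (homNorm w)⁻¹ v = v', dil (homNorm w)⁻¹ w = w' at *
  have hu0' := homNorm_nonneg u'
  have hv0' := homNorm_nonneg v'
  by_cases hu : homNorm u' ≤ 1
  swap
  · have : 0 ≤ κ * homNorm v' := by positivity
    linarith
  by_cases hv : homNorm v' ≤ 1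
  swap
  · have : 1 * 1 ≤ κ * homNorm v' := mul_le_mul hκ (not_le.1 hv).le zero_le_one (by linarith)
    linarith
  have h3 := h1 (homNorm_le_one_iff.1 hu) (homNorm_le_one_iff.1 hv)
  have h4 := homNorm_le_add (p := w') (q := u') (by rw [hw1]; norm_num)
  rw [hw1] at h4
  have h5 : ‖w' - u'‖ ≤ C * homNorm v' :=
    h3.trans (mul_le_mul_of_nonneg_left (norm_le_homNorm hv) hC)
  calc (1 : ℝ) ≤ homNorm u' + 2 ^ (2 * d + 1) * ‖w' - u'‖ := h4
    _ ≤ homNorm u' + 2 ^ (2 * d + 1) * (C * homNorm v') :=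
        add_le_add_right (mul_le_mul_of_nonneg_left h5 (by positivity)) _
    _ = homNorm u' + 2 ^ (2 * d + 1) * C * homNorm v' := by ring
    _ ≤ homNorm u' + κ * homNorm v' :=
        add_le_add_right (mul_le_mul_of_nonneg_right hCκ hv0') _

/-- Inversion is bounded on the unit sphere, hence by homogeneity everywhere. -/
theorem exists_homNorm_inv_le (hB : IsKolmogorovMatrix s B) :
    ∃ C, ∀ u : Pt s, homNorm (inv B u) ≤ C * homNorm u := by
  obtain ⟨C₁, hC₁, hinv⟩ := exists_lipschitzOn_closedBall (contDiff_inv B) 1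
  refine ⟨1 + 2 ^ (2 * d + 1) * C₁, fun u => ?_⟩
  have h4 : inv B (0 : Pt s) = 0 := inv_one (G := KGroup B)
  by_cases hu : u = 0
  · simp [hu, h4]
  have hp := homNorm_pos hu
  have hw1 : ‖dil (homNorm u)⁻¹ u‖ = 1 := norm_dil_homNorm_inv hu
  have h1 : homNorm (inv B (dil (homNorm u)⁻¹ u)) ≤ 1 + 2 ^ (2 * d + 1) * C₁ := by
    generalize dil (homNorm u)⁻¹ u = w at hw1
    have h0 : (0 : ℝ) ≤ 2 ^ (2 * d + 1) * C₁ := by positivity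
    by_cases h : homNorm (inv B w) ≤ 1
    · linarith
    · have h2 := homNorm_le_add (p := inv B w) (q := 0) (by linarith)
      have h3 := hinv w 0 hw1.le (by simp)
      rw [h4, sub_zero, sub_zero, hw1, mul_one] at h3
      rw [homNorm_zero, zero_add, sub_zero] at h2
      have : (2 : ℝ) ^ (2 * d + 1) * ‖inv B w‖ ≤ 2 ^ (2 * d + 1) * C₁ :=
        mul_le_mul_of_nonneg_left h3 (by positivity)
      linarith
  rw [← dil_inv hB (inv_ne_zero hp.ne'), homNorm_dil (by positivity)] at h1
  rwa [inv_mul_le_iff₀ hp, mul_comm] at h1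

/-- Both triangle inequalities reduce by scaling to the region where `u` and `v` have norm at most
one, and there to the smoothness of the group law. -/
theorem exists_isGauge_homNorm (hB : IsKolmogorovMatrix s B) :
    ∃ κ, IsGauge (lebesgue B) (homNorm : Pt s → ℝ) κ
      (volume (Metric.ball (0 : Pt s) 1)).toReal (homDim s + 2) := by
  obtain ⟨C₀, hC₀, hop⟩ := exists_norm_op_sub_le B
  obtain ⟨C₁, hinv⟩ := exists_homNorm_inv_le hB
  have hκ0 : 1 ≤ max 1 (max (2 ^ (2 * d + 1) * C₀) C₁) := le_max_left _ _
  have hκ1 : 2 ^ (2 * d + 1) * C₀ ≤ max 1 (max (2 ^ (2 * d + 1) * C₀) C₁) :=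
    (le_max_left _ _).trans (le_max_right _ _)
  have hκ2 : C₁ ≤ max 1 (max (2 ^ (2 * d + 1) * C₀) C₁) :=
    (le_max_right _ _).trans (le_max_right _ _)
  generalize max 1 (max (2 ^ (2 * d + 1) * C₀) C₁) = κ at hκ0 hκ1 hκ2
  have hC₀' : 0 ≤ C₀ := by linarith
  refine ⟨κ, ⟨homNorm_nonneg, continuous_homNorm, homNorm_zero, hκ0, fun (u v : Pt s) => ?_,
    fun (u v : Pt s) => ?_, fun (u : Pt s) =>
      (hinv u).trans (mul_le_mul_of_nonneg_right hκ2 (homNorm_nonneg u)), ?_, by omega,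
    fun r hr => volume_homNorm_lt hr, fun U hU => ?_⟩⟩
  · refine homNorm_le_add_mul (w := op B u v) hC₀' hκ0 hκ1 fun r hr h1 h2 => ?_
    rw [dil_op hB hr]
    exact (hop _ _ h1 h2).1
  · refine homNorm_le_add_mul (w := op B v u) hC₀' hκ0 hκ1 fun r hr h1 h2 => ?_
    rw [dil_op hB hr]
    exact (hop _ _ h1 h2).2
  · exact ENNReal.toReal_pos (Metric.measure_ball_pos _ _ one_pos).ne' measure_ball_lt_top.ne
  · obtain ⟨ε, hε, hεU⟩ := Metric.mem_nhds_iff.1 (show U ∈ 𝓝 (0 : Pt s) from hU)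
    refine ⟨min ε 1, lt_min hε one_pos, fun (u : Pt s) hu => hεU ?_⟩
    have hu' : homNorm u < min ε 1 := hu
    rw [mem_ball_zero_iff]
    exact (norm_le_homNorm (hu'.le.trans (min_le_right _ _))).trans_lt
      (hu'.trans_le (min_le_left _ _))

/-- Smooth compactly supported functions are Lipschitz for the homogeneous norm at every point. -/
theorem exists_lipschitz_approx {f : Pt s → ℝ} (hf : Integrable f) {η : ℝ} (hη : 0 < η) :
    ∃ φ : Pt s → ℝ, Integrable φ ∧ ∫⁻ z, ‖f z - φ z‖ₑ ≤ ENNReal.ofReal η ∧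
      ∀ z, ∃ C, ∀ u, homNorm u ≤ 1 → |φ (op B z (inv B u)) - φ z| ≤ C * homNorm u := by
  obtain ⟨φ, hφc, hφ, hle⟩ := (memLp_one_iff_integrable.2 hf).exist_eLpNorm_sub_le
    ENNReal.one_ne_top le_rfl hη
  refine ⟨φ, hφ.continuous.integrable_of_hasCompactSupport hφc, ?_, fun z => ?_⟩
  · rwa [eLpNorm_one_eq_lintegral_enorm] at hle
  · have hg : ContDiff ℝ ∞ fun u : Pt s => φ (op B z (inv B u)) :=
      hφ.comp ((contDiff_op B).comp (contDiff_const.prodMk (contDiff_inv B)))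
    obtain ⟨C, hC, h⟩ := exists_lipschitzOn_closedBall hg 1
    refine ⟨C, fun u hu => ?_⟩
    have h1 := h u 0 (homNorm_le_one_iff.1 hu) (by simp)
    have h4 : inv B (0 : Pt s) = 0 := inv_one (G := KGroup B)
    rw [h4, op_zero, sub_zero, Real.norm_eq_abs] at h1
    exact h1.trans (by gcongr; exact norm_le_homNorm hu)

end Gauge

/-! ### Polynomials and the Gaussian weight -/

section GaussianPolynomial

variable {ι : Type*} [Fintype ι]

/-- The value of a polynomial at a point of Euclidean space. -/
abbrev evalE (p : MvPolynomial ι ℝ) (x : EuclideanSpace ℝ ι) : ℝ :=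
  MvPolynomial.eval (fun i => x i) p

theorem hasFDerivAt_evalE (p : MvPolynomial ι ℝ) (x : EuclideanSpace ℝ ι) :
    HasFDerivAt (evalE p)
      (∑ i, evalE (MvPolynomial.pderiv i p) x • (EuclideanSpace.proj i : _ →L[ℝ] ℝ)) x := by
  classical
  induction p using MvPolynomial.induction_on with
  | C a =>
    have e : evalE (MvPolynomial.C a) = fun _ : EuclideanSpace ℝ ι => a :=
      funext fun y => MvPolynomial.eval_C a
    rw [e]
    simp only [evalE, MvPolynomial.pderiv_C, map_zero, zero_smul, Finset.sum_const_zero]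
    exact hasFDerivAt_const a x
  | add p q hp hq =>
    have e : evalE (p + q) = evalE p + evalE q := funext fun y => map_add _ _ _
    rw [e]
    simp only [map_add, add_smul, Finset.sum_add_distrib]
    exact hp.add hq
  | mul_X p j hp =>
    have h1 : HasFDerivAt (fun x : EuclideanSpace ℝ ι => x j)
        (EuclideanSpace.proj j : _ →L[ℝ] ℝ) x :=
      (EuclideanSpace.proj j : EuclideanSpace ℝ ι →L[ℝ] ℝ).hasFDerivAt
    have h2 := hp.mul h1
    have e : (∑ i, evalE (MvPolynomial.pderiv i (p * MvPolynomial.X j)) x •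
        (EuclideanSpace.proj i : EuclideanSpace ℝ ι →L[ℝ] ℝ)) = evalE p x • EuclideanSpace.proj j +
        x j • ∑ i, evalE (MvPolynomial.pderiv i p) x • EuclideanSpace.proj i := by
      simp only [MvPolynomial.pderiv_mul, MvPolynomial.pderiv_X, evalE, map_add, map_mul,
        MvPolynomial.eval_X, add_smul, Finset.sum_add_distrib, Finset.smul_sum, smul_smul]
      rw [add_comm]
      congr 1
      · rw [Finset.sum_eq_single j]
        · simp
        · intro i _ hi
          simp [hi.symm]
        · simp
      · simp only [mul_comm (x j)]
    have e2 : evalE (p * MvPolynomial.X j) =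
        evalE p * fun x : EuclideanSpace ℝ ι => x j := by
      funext y
      simp [evalE]
    rw [e, e2]
    exact h2

theorem continuous_evalE (p : MvPolynomial ι ℝ) : Continuous (evalE p) :=
  continuous_iff_continuousAt.2 fun x => (hasFDerivAt_evalE p x).continuousAt

theorem evalE_smul {p : MvPolynomial ι ℝ} {k : ℕ} (hp : p.IsHomogeneous k) (r : ℝ)
    (x : EuclideanSpace ℝ ι) : evalE p (r • x) = r ^ k * evalE p x := by
  rw [evalE, evalE, MvPolynomial.eval_eq', MvPolynomial.eval_eq', Finset.mul_sum]
  refine Finset.sum_congr rfl fun α hα => ?_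
  have h : ∑ i, α i = k := by
    have := hp (MvPolynomial.mem_support_iff.1 hα)
    rw [Finsupp.weight_apply, Finsupp.sum_fintype _ _ (by simp)] at this
    simpa using this
  simp only [PiLp.smul_apply, smul_eq_mul, mul_pow, Finset.prod_mul_distrib,
    Finset.prod_pow_eq_pow_sum, h]
  ring

/-- The Gaussian weight `exp (-|x|² / 2)`. -/
def gauss (x : EuclideanSpace ℝ ι) : ℝ := Real.exp (-(‖x‖ ^ 2) / 2)

theorem gauss_pos (x : EuclideanSpace ℝ ι) : 0 < gauss x := Real.exp_pos _

theorem continuous_gauss : Continuous (gauss : EuclideanSpace ℝ ι → ℝ) := by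
  unfold gauss
  fun_prop

theorem hasFDerivAt_gauss (x : EuclideanSpace ℝ ι) :
    HasFDerivAt gauss (-gauss x • innerSL ℝ x) x := by
  have h1 : HasFDerivAt (fun x : EuclideanSpace ℝ ι => -(‖x‖ ^ 2) / 2)
      (-(innerSL ℝ x : EuclideanSpace ℝ ι →L[ℝ] ℝ)) x := by
    have h := ((hasStrictFDerivAt_norm_sq x).hasFDerivAt.const_mul (-2 : ℝ)⁻¹)
    have e : (-2 : ℝ)⁻¹ • 2 • innerSL ℝ x = -(innerSL ℝ x : EuclideanSpace ℝ ι →L[ℝ] ℝ) := by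
      ext y
      simp
    rw [e] at h
    refine h.congr_of_eventuallyEq (Eventually.of_forall fun y => ?_)
    ring
  have h2 := h1.exp
  rw [smul_neg, ← neg_smul] at h2
  exact h2

theorem integrable_evalE_mul_gauss (p : MvPolynomial ι ℝ) :
    Integrable fun x : EuclideanSpace ℝ ι => evalE p x * gauss x := by
  have one : ∀ k : ℕ, Integrable fun t : ℝ => t ^ k * Real.exp (-(t ^ 2) / 2) := by
    intro k
    have := integrable_rpow_mul_exp_neg_mul_sq (b := 1 / 2) (by norm_num) (s := k)
      (by have : (0 : ℝ) ≤ k := Nat.cast_nonneg k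
          linarith)
    refine this.congr (Eventually.of_forall fun t => ?_)
    simp only [Real.rpow_natCast]
    congr 2
    ring
  have mono : ∀ α : ι →₀ ℕ, Integrable fun x : EuclideanSpace ℝ ι =>
      (∏ i, x i ^ α i) * gauss x := by
    intro α
    have h1 : Integrable (fun y : ι → ℝ => ∏ i, (y i ^ α i * Real.exp (-(y i ^ 2) / 2))) volume :=
      Integrable.fintype_prod fun i => one (α i)
    have h2 := (PiLp.volume_preserving_ofLp ι).integrable_comp_of_integrable h1
    refine h2.congr (Eventually.of_forall fun x => ?_)
    simp only [Function.comp, Finset.prod_mul_distrib, ← Real.exp_sum, gauss]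
    congr 2
    rw [EuclideanSpace.norm_sq_eq, ← Finset.sum_div, Finset.sum_neg_distrib]
    simp
  simp only [evalE, MvPolynomial.eval_eq', Finset.sum_mul, mul_assoc]
  exact integrable_finsetSum _ fun α _ => (mono α).const_mul _

/-- The Gaussian integral of a polynomial. -/
def gaussInt (p : MvPolynomial ι ℝ) : ℝ := ∫ x, evalE p x * gauss x

theorem gaussInt_add (p q : MvPolynomial ι ℝ) : gaussInt (p + q) = gaussInt p + gaussInt q := by
  simp only [gaussInt, evalE, map_add, add_mul]
  exact integral_add (integrable_evalE_mul_gauss p) (integrable_evalE_mul_gauss q)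

theorem gaussInt_C_mul (c : ℝ) (p : MvPolynomial ι ℝ) :
    gaussInt (MvPolynomial.C c * p) = c * gaussInt p := by
  simp only [gaussInt, evalE, map_mul, MvPolynomial.eval_C, mul_assoc]
  exact integral_const_mul _ _

/-- The Gaussian integral as a linear functional. -/
def gaussIntL (ι : Type*) [Fintype ι] : MvPolynomial ι ℝ →ₗ[ℝ] ℝ where
  toFun := gaussInt
  map_add' := gaussInt_add
  map_smul' c p := by rw [MvPolynomial.smul_eq_C_mul, gaussInt_C_mul]; rfl

theorem gaussInt_sum {α : Type*} (t : Finset α) (p : α → MvPolynomial ι ℝ) :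
    gaussInt (∑ a ∈ t, p a) = ∑ a ∈ t, gaussInt (p a) :=
  map_sum (gaussIntL ι) p t

/-- Integration by parts against the Gaussian weight. -/
theorem gaussInt_pderiv (i : ι) (p : MvPolynomial ι ℝ) :
    gaussInt (MvPolynomial.pderiv i p) = gaussInt (MvPolynomial.X i * p) := by
  classical
  have h1 : ∀ x, fderiv ℝ (evalE p) x (EuclideanSpace.single i 1) =
      evalE (MvPolynomial.pderiv i p) x := by
    intro x
    rw [(hasFDerivAt_evalE p x).fderiv]
    simp
  have h2 : ∀ x, evalE p x * fderiv ℝ gauss x (EuclideanSpace.single i 1) =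
      -(evalE (MvPolynomial.X i * p) x * gauss x) := by
    intro x
    rw [(hasFDerivAt_gauss x).fderiv]
    simp [EuclideanSpace.inner_single_right]
    ring
  have := integral_mul_fderiv_eq_neg_fderiv_mul_of_integrable (μ := volume)
    (f := evalE p) (g := gauss) (v := EuclideanSpace.single i (1 : ℝ))
    (by simp only [h1]; exact integrable_evalE_mul_gauss _)
    (by simp only [h2]; exact (integrable_evalE_mul_gauss _).neg)
    (integrable_evalE_mul_gauss _) (fun x _ => (hasFDerivAt_evalE p x).differentiableAt)
    (fun x _ => (hasFDerivAt_gauss x).differentiableAt)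
  simp only [h1, h2, integral_neg, neg_inj] at this
  exact this.symm

theorem gaussInt_mul_self_nonneg (p : MvPolynomial ι ℝ) : 0 ≤ gaussInt (p * p) :=
  integral_nonneg fun x => by
    simp only [evalE, map_mul]
    exact mul_nonneg (mul_self_nonneg _) (gauss_pos x).le

theorem eq_zero_of_gaussInt_mul_self {p : MvPolynomial ι ℝ} (h : gaussInt (p * p) = 0) :
    p = 0 := by
  have hnn : ∀ x, 0 ≤ evalE (p * p) x * gauss x := fun x => by
    simp only [evalE, map_mul]
    exact mul_nonneg (mul_self_nonneg _) (gauss_pos x).le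
  have h1 := (integral_eq_zero_iff_of_nonneg hnn (integrable_evalE_mul_gauss _)).1 h
  have h2 := (Continuous.ae_eq_iff_eq volume
    ((continuous_evalE (p * p)).mul continuous_gauss) continuous_const).1 h1
  refine MvPolynomial.funext fun y => ?_
  have h3 := congrFun h2 (WithLp.toLp 2 y)
  have h4 := (gauss_pos (WithLp.toLp 2 y)).ne'
  have h5 : evalE (p * p) (WithLp.toLp 2 y) * gauss (WithLp.toLp 2 y) = 0 := h3
  rw [evalE, map_mul] at h5
  have h6 : evalE p (WithLp.toLp 2 y) = 0 := by simpa [h4] using h5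
  rw [map_zero]
  exact h6

/-- For a harmonic polynomial of degree `m`, the Gaussian `L²` norm of the gradient is `m` times
that of the polynomial: integrate by parts and use Euler's identity. -/
theorem sum_gaussInt_pderiv_sq {m : ℕ} {p : MvPolynomial ι ℝ} (hp : p.IsHomogeneous m)
    (hh : ∑ i, MvPolynomial.pderiv i (MvPolynomial.pderiv i p) = 0) :
    ∑ i, gaussInt (MvPolynomial.pderiv i p * MvPolynomial.pderiv i p) = m * gaussInt (p * p) := by
  have h1 : ∀ i, MvPolynomial.pderiv i p * MvPolynomial.pderiv i p +
      p * MvPolynomial.pderiv i (MvPolynomial.pderiv i p) =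
      MvPolynomial.pderiv i (p * MvPolynomial.pderiv i p) := fun i => by
    rw [MvPolynomial.pderiv_mul]
  have h2 := congrArg gaussInt (Finset.sum_congr rfl fun i (_ : i ∈ Finset.univ) => h1 i)
  rw [Finset.sum_add_distrib, ← Finset.mul_sum, hh, mul_zero, add_zero, gaussInt_sum,
    gaussInt_sum] at h2
  simp only [gaussInt_pderiv] at h2
  rw [h2, ← gaussInt_sum]
  have h3 : ∑ i, MvPolynomial.X i * (p * MvPolynomial.pderiv i p) =
      MvPolynomial.C (m : ℝ) * (p * p) := by
    rw [← mul_assoc, mul_comm (MvPolynomial.C (m : ℝ)) p, mul_assoc]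
    rw [show MvPolynomial.C (m : ℝ) * p = m • p by simp [nsmul_eq_mul], ← hp.sum_X_mul_pderiv,
      Finset.mul_sum]
    exact Finset.sum_congr rfl fun i _ => by ring
  rw [h3, gaussInt_C_mul]

/-- The polynomial `|x|²`. -/
def normSqPoly (ι : Type*) [Fintype ι] : MvPolynomial ι ℝ := ∑ i, MvPolynomial.X i ^ 2

theorem evalE_normSqPoly (x : EuclideanSpace ℝ ι) : evalE (normSqPoly ι) x = ‖x‖ ^ 2 := by
  simp [normSqPoly, evalE, EuclideanSpace.norm_sq_eq]

theorem isHomogeneous_normSqPoly : (normSqPoly ι).IsHomogeneous 2 :=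
  MvPolynomial.IsHomogeneous.sum _ _ _ fun i _ => (MvPolynomial.isHomogeneous_X ℝ i).pow 2

theorem gaussInt_normSqPoly_mul {k : ℕ} {q : MvPolynomial ι ℝ} (hq : q.IsHomogeneous k) :
    gaussInt (normSqPoly ι * q) = (Fintype.card ι + k) * gaussInt q := by
  have h1 : ∀ i, gaussInt (MvPolynomial.X i ^ 2 * q) =
      gaussInt q + gaussInt (MvPolynomial.X i * MvPolynomial.pderiv i q) := by
    intro i
    rw [pow_two, mul_assoc, ← gaussInt_pderiv, MvPolynomial.pderiv_mul,
      MvPolynomial.pderiv_X_self, gaussInt_add, one_mul]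
  rw [normSqPoly, Finset.sum_mul, gaussInt_sum]
  simp only [h1]
  rw [Finset.sum_add_distrib, ← gaussInt_sum (p := fun i => MvPolynomial.X i *
    MvPolynomial.pderiv i q), hq.sum_X_mul_pderiv, nsmul_eq_mul, show ((k : ℕ) : MvPolynomial ι ℝ) = MvPolynomial.C (k : ℝ) by simp, gaussInt_C_mul]
  simp
  ring

end GaussianPolynomial

/-! ### Spaces of solid harmonics -/

section HarmonicSpace

variable {ι : Type*} [Fintype ι]

/-- The harmonic polynomials that are homogeneous of degree `k`. -/
def harmonicSpace (ι : Type*) [Fintype ι] (k : ℕ) : Submodule ℝ (MvPolynomial ι ℝ) where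
  carrier := {p | p.IsHomogeneous k ∧ ∑ i, MvPolynomial.pderiv i (MvPolynomial.pderiv i p) = 0}
  zero_mem' := ⟨MvPolynomial.isHomogeneous_zero _ _ _, by simp⟩
  add_mem' {p q} hp hq := ⟨hp.1.add hq.1, by
    simp only [map_add, Finset.sum_add_distrib, hp.2, hq.2, add_zero]⟩
  smul_mem' c p hp := ⟨by
    rw [MvPolynomial.smul_eq_C_mul]
    exact hp.1.C_mul c, by
    simp only [Derivation.map_smul, ← Finset.smul_sum, hp.2, smul_zero]⟩

theorem pderiv_comm (i j : ι) (p : MvPolynomial ι ℝ) :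
    MvPolynomial.pderiv i (MvPolynomial.pderiv j p) =
      MvPolynomial.pderiv j (MvPolynomial.pderiv i p) := by
  classical
  ext α
  simp only [MvPolynomial.coeff_pderiv, add_right_comm α]
  by_cases h : i = j
  · rw [h]
  · simp [h, Ne.symm h]
    ring

theorem pderiv_mem_harmonicSpace {k : ℕ} {p : MvPolynomial ι ℝ}
    (hp : p ∈ harmonicSpace ι (k + 1)) (i : ι) :
    MvPolynomial.pderiv i p ∈ harmonicSpace ι k := by
  refine ⟨hp.1.pderiv, ?_⟩
  have : ∀ j, MvPolynomial.pderiv j (MvPolynomial.pderiv j (MvPolynomial.pderiv i p)) =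
      MvPolynomial.pderiv i (MvPolynomial.pderiv j (MvPolynomial.pderiv j p)) := fun j => by
    rw [pderiv_comm j i, pderiv_comm j i]
  simp only [this]
  rw [← map_sum, hp.2, map_zero]

/-! ### Rotation invariance -/

/-- The composition of a polynomial with a linear isometry. -/
def rotate (U : EuclideanSpace ℝ ι ≃ₗᵢ[ℝ] EuclideanSpace ℝ ι) (p : MvPolynomial ι ℝ) :
    MvPolynomial ι ℝ := by
  classical
  exact MvPolynomial.aeval (fun i => ∑ j, MvPolynomial.C (U (EuclideanSpace.single j 1) i) *
    MvPolynomial.X j) p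

theorem evalE_rotate (U : EuclideanSpace ℝ ι ≃ₗᵢ[ℝ] EuclideanSpace ℝ ι) (p : MvPolynomial ι ℝ)
    (x : EuclideanSpace ℝ ι) : evalE (rotate U p) x = evalE p (U x) := by
  classical
  have h : ∀ i, (∑ j, U (EuclideanSpace.single j 1) i * x j) = U x i := by
    intro i
    have hx : x = ∑ j, x j • EuclideanSpace.single j (1 : ℝ) := by
      conv_lhs => rw [← (EuclideanSpace.basisFun ι ℝ).sum_repr x]
      simp
    conv_rhs => rw [hx, map_sum]
    simp [mul_comm]
  rw [evalE, rotate, MvPolynomial.aeval_def, MvPolynomial.eval_eval₂]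
  simp only [map_sum, map_mul, MvPolynomial.eval_C, MvPolynomial.eval_X, h]
  rw [evalE, MvPolynomial.eval₂_eq', MvPolynomial.eval_eq']
  simp

theorem isHomogeneous_rotate (U : EuclideanSpace ℝ ι ≃ₗᵢ[ℝ] EuclideanSpace ℝ ι) {k : ℕ}
    {p : MvPolynomial ι ℝ} (hp : p.IsHomogeneous k) : (rotate U p).IsHomogeneous k := by
  classical
  rw [← one_mul k]
  refine hp.aeval _ fun i => MvPolynomial.IsHomogeneous.sum _ _ _ fun j _ => ?_
  exact (MvPolynomial.isHomogeneous_X ℝ j).C_mul _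

/-- The chain rule for a linear change of variables. -/
theorem pderiv_rotate [DecidableEq ι] (U : EuclideanSpace ℝ ι ≃ₗᵢ[ℝ] EuclideanSpace ℝ ι)
    (p : MvPolynomial ι ℝ) (j : ι) :
    MvPolynomial.pderiv j (rotate U p) =
      ∑ i, MvPolynomial.C (U (EuclideanSpace.single j 1) i) * rotate U (MvPolynomial.pderiv i p) := by
  induction p using MvPolynomial.induction_on with
  | C a => simp [rotate]
  | add p q hp hq =>
    simp only [rotate, map_add, mul_add, Finset.sum_add_distrib] at hp hq ⊢
    rw [hp, hq]
  | mul_X p l hp =>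
    have e : ∀ p q, rotate U (p * q) = rotate U p * rotate U q := fun p q => map_mul _ _ _
    have eX : MvPolynomial.pderiv j (rotate U (MvPolynomial.X l)) =
        MvPolynomial.C (U (EuclideanSpace.single j 1) l) := by
      simp only [rotate, MvPolynomial.aeval_X, map_sum, MvPolynomial.pderiv_C_mul]
      rw [Finset.sum_eq_single j]
      · rw [MvPolynomial.pderiv_X_self, mul_one]
        congr!
      · intro i _ hi
        rw [MvPolynomial.pderiv_X_of_ne hi, mul_zero]
      · simp
    rw [e, MvPolynomial.pderiv_mul, hp, eX]
    have e2 : ∀ i, rotate U (MvPolynomial.pderiv i (p * MvPolynomial.X l)) =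
        rotate U (MvPolynomial.pderiv i p) * rotate U (MvPolynomial.X l) +
        rotate U p * rotate U (MvPolynomial.pderiv i (MvPolynomial.X l)) := by
      intro i
      rw [MvPolynomial.pderiv_mul]
      simp only [rotate, map_add, map_mul]
    simp only [e2, mul_add, Finset.sum_add_distrib, Finset.sum_mul, mul_assoc]
    congr 1
    rw [Finset.sum_eq_single l]
    · rw [MvPolynomial.pderiv_X_self]
      simp [rotate, mul_comm]
    · intro i _ hi
      rw [MvPolynomial.pderiv_X_of_ne hi.symm]
      simp [rotate]
    · simp

/-- The Laplacian commutes with rotations, because the rows of an orthogonal matrix are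
orthonormal. -/
theorem rotate_mem_harmonicSpace (U : EuclideanSpace ℝ ι ≃ₗᵢ[ℝ] EuclideanSpace ℝ ι) {k : ℕ}
    {p : MvPolynomial ι ℝ} (hp : p ∈ harmonicSpace ι k) : rotate U p ∈ harmonicSpace ι k := by
  classical
  refine ⟨isHomogeneous_rotate U hp.1, ?_⟩
  set a : ι → ι → ℝ := fun i j => U (EuclideanSpace.single j 1) i with ha
  have orth : ∀ i l, ∑ j, a i j * a l j = if i = l then 1 else 0 := by
    intro i l
    have h : ∀ i j, a i j = U.symm (EuclideanSpace.single i 1) j := by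
      intro i j
      have := U.inner_map_map (U.symm (EuclideanSpace.single i 1)) (EuclideanSpace.single j 1)
      simpa [EuclideanSpace.inner_single_left, EuclideanSpace.inner_single_right] using this
    have h2 := U.symm.inner_map_map (EuclideanSpace.single i 1) (EuclideanSpace.single l 1)
    rw [EuclideanSpace.inner_single_left] at h2
    simp only [h]
    rw [PiLp.inner_apply] at h2
    simp only [map_one, one_mul] at h2
    have h3 : (EuclideanSpace.single l (1 : ℝ) : EuclideanSpace ℝ ι) i = if i = l then 1 else 0 := by
      simp
    rw [← h3, ← h2]
    refine Finset.sum_congr rfl fun j _ => ?_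
    simp [mul_comm]
  have step : ∀ j, MvPolynomial.pderiv j (MvPolynomial.pderiv j (rotate U p)) =
      ∑ i, ∑ l, MvPolynomial.C (a i j * a l j) *
        rotate U (MvPolynomial.pderiv l (MvPolynomial.pderiv i p)) := by
    intro j
    rw [pderiv_rotate, map_sum]
    refine Finset.sum_congr rfl fun i _ => ?_
    rw [MvPolynomial.pderiv_C_mul, pderiv_rotate, Finset.mul_sum]
    refine Finset.sum_congr rfl fun l _ => ?_
    rw [map_mul, mul_assoc]
  simp only [step]
  rw [Finset.sum_comm]
  have : ∀ i, ∑ j, ∑ l, MvPolynomial.C (a i j * a l j) *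
      rotate U (MvPolynomial.pderiv l (MvPolynomial.pderiv i p)) =
      rotate U (MvPolynomial.pderiv i (MvPolynomial.pderiv i p)) := by
    intro i
    rw [Finset.sum_comm]
    simp only [← Finset.sum_mul, ← map_sum, orth]
    rw [Finset.sum_eq_single i]
    · simp
    · intro l _ hl
      simp [hl.symm]
    · simp
  simp only [this]
  have e : ∀ (q : ι → MvPolynomial ι ℝ), ∑ i, rotate U (q i) = rotate U (∑ i, q i) := fun q =>
    (map_sum _ _ _).symm
  rw [e, hp.2]
  exact map_zero _

theorem gaussInt_rotate (U : EuclideanSpace ℝ ι ≃ₗᵢ[ℝ] EuclideanSpace ℝ ι)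
    (p : MvPolynomial ι ℝ) : gaussInt (rotate U p) = gaussInt p := by
  have h : ∀ x, evalE (rotate U p) x * gauss x = evalE p (U x) * gauss (U x) := fun x => by
    rw [evalE_rotate, gauss, gauss, U.norm_map]
  simp only [gaussInt, h]
  exact U.measurePreserving.integral_comp U.toHomeomorph.measurableEmbedding
    (fun x => evalE p x * gauss x)

theorem rotate_mul (U : EuclideanSpace ℝ ι ≃ₗᵢ[ℝ] EuclideanSpace ℝ ι) (p q : MvPolynomial ι ℝ) :
    rotate U (p * q) = rotate U p * rotate U q := map_mul _ _ _

/-! ### The dimension bound -/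

/-- The multi-index of degree `k` with a prescribed entry at `i₀`, with prescribed entries away from
`i₀` and `p₀`, and with the entry at `p₀` determined by the degree. -/
def multiIndex [DecidableEq ι] (i₀ p₀ : ι) (k : ℕ)
    (c : Fin 2 × ({i : ι // i ≠ i₀ ∧ i ≠ p₀} → Fin (k + 1))) : ι →₀ ℕ :=
  Finsupp.equivFunOnFinite.symm fun i =>
    if h : i ≠ i₀ ∧ i ≠ p₀ then c.2 ⟨i, h⟩ else
      if i = i₀ then c.1 else k - (c.1 + ∑ j, (c.2 j : ℕ))

/-- A multi-index of degree `k` with entry at most one at `i₀` is determined by its entries outside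
`p₀`. -/
theorem exists_multiIndex_eq [DecidableEq ι] {i₀ p₀ : ι} (hne : i₀ ≠ p₀) {k : ℕ} {α : ι →₀ ℕ}
    (hα : α.degree = k) (h2 : α i₀ < 2) : ∃ c, multiIndex i₀ p₀ k c = α := by
  have hsum : α i₀ + (α p₀ + ∑ j : {i : ι // i ≠ i₀ ∧ i ≠ p₀}, α j) = k := by
    rw [← hα, Finsupp.degree_eq_sum, ← Finset.add_sum_erase _ _ (Finset.mem_univ i₀),
      ← Finset.add_sum_erase _ _ (Finset.mem_erase.2 ⟨hne.symm, Finset.mem_univ p₀⟩)]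
    congr 2
    refine (Finset.sum_subtype _ (fun i => ?_) _).symm
    simp [and_comm]
  have hle : ∀ i, α i < k + 1 := fun i => by
    have : α i ≤ α.degree := by
      rw [Finsupp.degree_eq_sum]
      exact Finset.single_le_sum (f := fun i => α i) (fun _ _ => Nat.zero_le _) (Finset.mem_univ i)
    omega
  refine ⟨(⟨α i₀, h2⟩, fun j => ⟨α j, hle j⟩), ?_⟩
  ext i
  simp only [multiIndex, Finsupp.equivFunOnFinite_symm_apply_apply]
  split_ifs with h h'
  · rfl
  · rw [h']
  · have : i = p₀ := by tauto
    subst this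
    omega

/-- A harmonic polynomial is determined by its coefficients of degree at most one in a fixed
variable: Laplace's equation expresses all others through these. -/
theorem finiteDimensional_and_finrank_harmonicSpace_le [Nontrivial ι] (k : ℕ) :
    FiniteDimensional ℝ (harmonicSpace ι k) ∧
      Module.finrank ℝ (harmonicSpace ι k) ≤ 2 * (k + 1) ^ (Fintype.card ι - 2) := by
  classical
  obtain ⟨i₀, p₀, hne⟩ := exists_pair_ne ι
  let L : harmonicSpace ι k →ₗ[ℝ]
      (Fin 2 × ({i : ι // i ≠ i₀ ∧ i ≠ p₀} → Fin (k + 1)) → ℝ) :=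
    LinearMap.pi fun c => (MvPolynomial.lcoeff ℝ (multiIndex i₀ p₀ k c)).comp
      (harmonicSpace ι k).subtype
  have hL : Function.Injective L := by
    refine (injective_iff_map_eq_zero L).2 fun q hq => ?_
    have hq' : ∀ c, MvPolynomial.coeff (multiIndex i₀ p₀ k c) (q : MvPolynomial ι ℝ) = 0 :=
      fun c => congrFun hq c
    have key : ∀ a, ∀ α : ι →₀ ℕ, α i₀ = a →
        MvPolynomial.coeff α (q : MvPolynomial ι ℝ) = 0 := by
      intro a
      induction a using Nat.strong_induction_on with
      | _ a ih =>
        intro α hα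
        by_cases hdeg : α.degree = k
        swap
        · exact q.2.1.coeff_eq_zero hdeg
        by_cases ha : a < 2
        · obtain ⟨c, hc⟩ := exists_multiIndex_eq hne hdeg (hα ▸ ha)
          rw [← hc]
          exact hq' c
        · set β : ι →₀ ℕ := α - Finsupp.single i₀ 2 with hβ
          have hβα : β + Finsupp.single i₀ 1 + Finsupp.single i₀ 1 = α := by
            rw [add_assoc, ← Finsupp.single_add]
            exact tsub_add_cancel_of_le (by simp; omega)
          have h0 := congrArg (MvPolynomial.coeff β) q.2.2
          rw [MvPolynomial.coeff_sum, Finset.sum_eq_single i₀] at h0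
          · rw [MvPolynomial.coeff_pderiv, MvPolynomial.coeff_pderiv, hβα,
              MvPolynomial.coeff_zero] at h0
            have p1 : (0 : ℝ) < (β i₀ : ℝ) + 1 + 1 := by positivity
            have p2 : (0 : ℝ) < (β i₀ : ℝ) + 1 := by positivity
            simpa [p1.ne', p2.ne'] using h0
          · intro i _ hi
            rw [MvPolynomial.coeff_pderiv, MvPolynomial.coeff_pderiv, ih (β i₀)]
            · simp
            · simp [hβ]
              omega
            · simp [hi]
          · simp
    ext α
    simpa using key _ α rfl
  refine ⟨FiniteDimensional.of_injective L hL, ?_⟩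
  refine (LinearMap.finrank_le_finrank_of_injective hL).trans (le_of_eq ?_)
  have hcard : Fintype.card {i : ι // i ≠ i₀ ∧ i ≠ p₀} = Fintype.card ι - 2 := by
    rw [Fintype.card_subtype]
    have : (Finset.univ.filter fun i => i ≠ i₀ ∧ i ≠ p₀) = (Finset.univ.erase i₀).erase p₀ := by
      ext i
      simp [and_comm]
    rw [this, Finset.card_erase_of_mem (by simp [hne.symm]),
      Finset.card_erase_of_mem (Finset.mem_univ _), Finset.card_univ]
    omega
  simp [hcard]

end HarmonicSpace

/-! ### Pointwise bounds for solid harmonics -/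

section SupBound

open scoped RealInnerProductSpace

variable {ι : Type*} [Fintype ι]

/-- The Gaussian inner product on harmonic polynomials. -/
abbrev harmonicCore (ι : Type*) [Fintype ι] (k : ℕ) :
    InnerProductSpace.Core ℝ (harmonicSpace ι k) where
  inner p q := gaussInt (p.1 * q.1)
  conj_inner_symm p q := congrArg gaussInt (mul_comm q.1 p.1)
  re_inner_nonneg p := gaussInt_mul_self_nonneg p.1
  add_left p q r := by
    rw [Submodule.coe_add, add_mul, gaussInt_add]
  smul_left p q c := by
    rw [Submodule.coe_smul, MvPolynomial.smul_eq_C_mul, mul_assoc, gaussInt_C_mul]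
    rfl
  definite p h := Subtype.ext (eq_zero_of_gaussInt_mul_self h)

/-- An orthonormal basis of the harmonic polynomials of degree `k` for the Gaussian inner product. -/
theorem exists_orthonormal_harmonic [Nontrivial ι] (k : ℕ) :
    ∃ b : Fin (Module.finrank ℝ (harmonicSpace ι k)) → MvPolynomial ι ℝ,
      (∀ j, b j ∈ harmonicSpace ι k) ∧ (∀ j, gaussInt (b j * b j) = 1) ∧
      (∀ a : Fin (Module.finrank ℝ (harmonicSpace ι k)) → ℝ,
        gaussInt ((∑ j, a j • b j) * ∑ j, a j • b j) = ∑ j, a j ^ 2) ∧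
      ∀ q ∈ harmonicSpace ι k, ∃ a : Fin (Module.finrank ℝ (harmonicSpace ι k)) → ℝ,
        q = ∑ j, a j • b j := by
  let := (harmonicCore ι k).toNormedAddCommGroup
  let : InnerProductSpace ℝ (harmonicSpace ι k) := InnerProductSpace.ofCore _
  have := (finiteDimensional_and_finrank_harmonicSpace_le (ι := ι) k).1
  have hin : ∀ p q : harmonicSpace ι k, ⟪p, q⟫ = gaussInt (p.1 * q.1) :=
    fun p q => rfl
  let b := stdOrthonormalBasis ℝ (harmonicSpace ι k)
  have hco : ∀ a : Fin (Module.finrank ℝ (harmonicSpace ι k)) → ℝ,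
      ∑ j, a j • (b j : MvPolynomial ι ℝ) = ((∑ j, a j • b j : harmonicSpace ι k) :
        MvPolynomial ι ℝ) := fun a => by simp
  refine ⟨fun j => b j, fun j => (b j).2, fun j => ?_, fun a => ?_, fun q hq => ?_⟩
  · have := b.orthonormal.1 j
    rw [← hin, real_inner_self_eq_norm_sq, this, one_pow]
  · rw [hco, ← hin, b.orthonormal.inner_sum]
    simp [pow_two]
  · refine ⟨fun j => ⟪b j, ⟨q, hq⟩⟫, ?_⟩
    rw [hco, b.sum_repr' ⟨q, hq⟩]

/-- The reproducing kernel of the harmonic polynomials of degree `k` is constant on spheres by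
rotation invariance, so its value on the unit sphere is the dimension up to normalisation. -/
theorem evalE_sq_mul_gaussInt_le [Nontrivial ι] {k : ℕ} {q : MvPolynomial ι ℝ}
    (hq : q ∈ harmonicSpace ι k) {x : EuclideanSpace ℝ ι} (hx : ‖x‖ = 1) :
    evalE q x ^ 2 * gaussInt (normSqPoly ι ^ k) ≤
      gaussInt (q * q) * Module.finrank ℝ (harmonicSpace ι k) := by
  obtain ⟨b, hb, hb1, hba, hbs⟩ := exists_orthonormal_harmonic (ι := ι) k
  -- the diagonal of the reproducing kernel
  set Z : EuclideanSpace ℝ ι → ℝ := fun y => ∑ j, evalE (b j) y ^ 2 with hZ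
  have hZ0 : ∀ y, 0 ≤ Z y := fun y => Finset.sum_nonneg fun j _ => sq_nonneg _
  have heval : ∀ (a : Fin (Module.finrank ℝ (harmonicSpace ι k)) → ℝ) y,
      evalE (∑ j, a j • b j) y = ∑ j, a j * evalE (b j) y := fun a y => by
    simp [evalE, MvPolynomial.smul_eval]
  have cs : ∀ q ∈ harmonicSpace ι k, ∀ y, evalE q y ^ 2 ≤ gaussInt (q * q) * Z y := by
    intro q hq y
    obtain ⟨a, rfl⟩ := hbs q hq
    rw [hba, heval]
    exact Finset.sum_mul_sq_le_sq_mul_sq _ _ _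
  -- `Z y` is the best constant in `cs`, and a reflection carries `y'` to `y`
  have inv : ∀ y y', ‖y‖ = ‖y'‖ → Z y ≤ Z y' := by
    intro y y' h
    set U : EuclideanSpace ℝ ι ≃ₗᵢ[ℝ] EuclideanSpace ℝ ι :=
      Submodule.reflection (Submodule.span ℝ {y' - y})ᗮ with hU
    have hUy : U y' = y := Submodule.reflection_sub h.symm
    set p := ∑ j, evalE (b j) y • b j with hp
    have hpm : p ∈ harmonicSpace ι k :=
      Submodule.sum_mem _ fun j _ => Submodule.smul_mem _ _ (hb j)
    have hpp : gaussInt (p * p) = Z y := hba _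
    have hpy : evalE p y = Z y := by
      rw [hp, heval]
      simp [hZ, pow_two]
    have h1 := cs _ (rotate_mem_harmonicSpace U hpm) y'
    rw [evalE_rotate, hUy, hpy, ← rotate_mul, gaussInt_rotate, hpp] at h1
    by_contra! hc
    have h2 : Z y * Z y' < Z y * Z y := mul_lt_mul_of_pos_left hc ((hZ0 y').trans_lt hc)
    rw [← pow_two] at h2
    linarith
  have hconst : ∀ y, Z y = ‖y‖ ^ (2 * k) * Z x := by
    intro y
    have hom : ∀ (r : ℝ) w, Z (r • w) = r ^ (2 * k) * Z w := by
      intro r w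
      simp only [hZ, Finset.mul_sum]
      refine Finset.sum_congr rfl fun j _ => ?_
      rw [evalE_smul (hb j).1, mul_pow, ← pow_mul, mul_comm k]
    have hn : ‖y‖ = ‖‖y‖ • x‖ := by
      rw [norm_smul, hx, mul_one, norm_norm]
    rw [le_antisymm (inv _ _ hn) (inv _ _ hn.symm), hom]
  -- integrating `Z` gives the dimension
  have hG : gaussInt (∑ j, b j * b j) = Z x * gaussInt (normSqPoly ι ^ k) := by
    rw [← gaussInt_C_mul]
    refine integral_congr_ae (Eventually.of_forall fun y => ?_)
    have h1 : evalE (∑ j, b j * b j) y = Z y := by simp [evalE, hZ, pow_two]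
    have h2 : evalE (MvPolynomial.C (Z x) * normSqPoly ι ^ k) y = Z x * (‖y‖ ^ 2) ^ k := by
      rw [← evalE_normSqPoly, evalE, map_mul, map_pow, MvPolynomial.eval_C]
    simp only [h1, h2]
    rw [hconst, ← pow_mul]
    ring
  rw [gaussInt_sum] at hG
  simp only [hb1, Finset.sum_const, Finset.card_univ, Fintype.card_fin, nsmul_eq_mul,
    mul_one] at hG
  rw [hG, ← mul_assoc]
  refine mul_le_mul_of_nonneg_right (cs q hq x) ?_
  refine integral_nonneg fun y => mul_nonneg ?_ (gauss_pos y).le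
  rw [evalE, map_pow]
  refine pow_nonneg ?_ _
  have := evalE_normSqPoly y
  rw [evalE] at this
  rw [this]
  positivity

/-! ### Polar coordinates -/

/-- Polar coordinates for a homogeneous polynomial times a radial function. -/
theorem integral_evalE_mul_radial [Nonempty ι] {k : ℕ} {p : MvPolynomial ι ℝ}
    (hp : p.IsHomogeneous k) (h : ℝ → ℝ) :
    ∫ x : EuclideanSpace ℝ ι, evalE p x * h ‖x‖ =
      (∫ ω : Metric.sphere (0 : EuclideanSpace ℝ ι) 1, evalE p ω
        ∂(volume : Measure (EuclideanSpace ℝ ι)).toSphere) *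
      ∫ r : Set.Ioi (0 : ℝ), (r : ℝ) ^ k * h r ∂(Measure.volumeIoiPow
        (Module.finrank ℝ (EuclideanSpace ℝ ι) - 1)) := by
  set μ : Measure (EuclideanSpace ℝ ι) := volume
  calc ∫ x, evalE p x * h ‖x‖ ∂μ
      = ∫ x : ({(0)}ᶜ : Set (EuclideanSpace ℝ ι)), evalE p x.1 * h ‖x.1‖ ∂(μ.comap (↑)) := by
        rw [integral_subtype_comap (measurableSet_singleton _).compl
          fun x : EuclideanSpace ℝ ι => evalE p x * h ‖x‖, restrict_compl_singleton]
    _ = ∫ y : Metric.sphere (0 : EuclideanSpace ℝ ι) 1 × Set.Ioi (0 : ℝ),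
          evalE p y.1 * ((y.2 : ℝ) ^ k * h y.2) ∂μ.toSphere.prod
            (.volumeIoiPow (Module.finrank ℝ (EuclideanSpace ℝ ι) - 1)) := by
        rw [← μ.measurePreserving_homeomorphUnitSphereProd.integral_comp
          (Homeomorph.measurableEmbedding _)]
        refine integral_congr_ae (Eventually.of_forall fun x => ?_)
        have hx : (x : EuclideanSpace ℝ ι) ≠ 0 := x.2
        have hx' : ‖(x : EuclideanSpace ℝ ι)‖ ≠ 0 := norm_ne_zero_iff.2 hx
        simp only [homeomorphUnitSphereProd_apply_fst_coe, homeomorphUnitSphereProd_apply_snd_coe]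
        rw [evalE_smul hp, inv_pow]
        field_simp
    _ = _ := integral_prod_mul
          (fun ω : Metric.sphere (0 : EuclideanSpace ℝ ι) 1 => evalE p ω)
          (fun r : Set.Ioi (0 : ℝ) => (r : ℝ) ^ k * h r)

theorem gaussInt_mul_integral_sphere [Nonempty ι] {k : ℕ} {p q : MvPolynomial ι ℝ}
    (hp : p.IsHomogeneous k) (hq : q.IsHomogeneous k) :
    gaussInt p * ∫ ω : Metric.sphere (0 : EuclideanSpace ℝ ι) 1, evalE q ω
        ∂(volume : Measure (EuclideanSpace ℝ ι)).toSphere =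
    gaussInt q * ∫ ω : Metric.sphere (0 : EuclideanSpace ℝ ι) 1, evalE p ω
        ∂(volume : Measure (EuclideanSpace ℝ ι)).toSphere := by
  have h1 := integral_evalE_mul_radial hp fun r => Real.exp (-(r ^ 2) / 2)
  have h2 := integral_evalE_mul_radial hq fun r => Real.exp (-(r ^ 2) / 2)
  rw [gaussInt, gaussInt]
  simp only [gauss]
  rw [h1, h2]
  ring

/-! ### Derivatives of normalised solid harmonics -/

theorem gaussInt_normSqPoly_pow_pos [Nonempty ι] (k : ℕ) :
    0 < gaussInt (normSqPoly ι ^ k) := by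
  have hpos : ∀ x : EuclideanSpace ℝ ι, evalE (normSqPoly ι ^ k) x = (‖x‖ ^ 2) ^ k := fun x => by
    rw [← evalE_normSqPoly, evalE, map_pow]
  rw [gaussInt, integral_pos_iff_support_of_nonneg
    (fun x => by rw [hpos]; exact mul_nonneg (by positivity) (gauss_pos x).le)
    (integrable_evalE_mul_gauss _)]
  have hsub : {(0 : EuclideanSpace ℝ ι)}ᶜ ⊆
      Function.support fun x => evalE (normSqPoly ι ^ k) x * gauss x := by
    intro x hx
    have : ‖x‖ ≠ 0 := norm_ne_zero_iff.2 hx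
    rw [Function.mem_support, hpos]
    exact mul_ne_zero (by positivity) (gauss_pos x).ne'
  refine lt_of_lt_of_le ?_ (measure_mono hsub)
  exact isOpen_compl_singleton.measure_pos _ (exists_ne (0 : EuclideanSpace ℝ ι))

/-- The area of the unit sphere. -/
def sphereArea (ι : Type*) [Fintype ι] : ℝ :=
  (volume : Measure (EuclideanSpace ℝ ι)).toSphere.real Set.univ

theorem sphereArea_pos [Nonempty ι] : 0 < sphereArea ι := by
  rw [sphereArea, Measure.toSphere_real_apply_univ]
  refine mul_pos (Nat.cast_pos.2 Module.finrank_pos) ?_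
  exact ENNReal.toReal_pos (Metric.measure_ball_pos _ _ one_pos).ne' measure_ball_lt_top.ne

/-- The first derivatives of a normalised solid harmonic of degree `m` are `O(m ^ (n / 2))` on the
unit sphere of an `n`-dimensional space. -/
theorem sq_evalE_pderiv_le [Nontrivial ι] {m : ℕ} (hm : 1 ≤ m) {p : MvPolynomial ι ℝ}
    (hp : p ∈ harmonicSpace ι m)
    (h1 : ∫ ω : Metric.sphere (0 : EuclideanSpace ℝ ι) 1, evalE p ω ^ 2
      ∂(volume : Measure (EuclideanSpace ℝ ι)).toSphere = 1)
    {x : EuclideanSpace ℝ ι} (hx : ‖x‖ = 1) (i : ι) :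
    evalE (MvPolynomial.pderiv i p) x ^ 2 ≤
      2 * (Fintype.card ι + 2) / sphereArea ι * (m : ℝ) ^ Fintype.card ι := by
  obtain ⟨k, rfl⟩ : ∃ k, m = k + 1 := ⟨m - 1, by omega⟩
  have hcard : 2 ≤ Fintype.card ι := Fintype.one_lt_card
  obtain ⟨n, hn⟩ : ∃ n, Fintype.card ι = n + 2 := ⟨Fintype.card ι - 2, by omega⟩
  have hσ := sphereArea_pos (ι := ι)
  have hI := gaussInt_normSqPoly_pow_pos (ι := ι) k
  have a1 := evalE_sq_mul_gaussInt_le (pderiv_mem_harmonicSpace hp i) hx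
  -- the powers of `m = k + 1`: one from the gradient, `n = card ι - 2` from the dimension, and one
  -- from the ratio of Gaussian moments in the normalisation on the sphere
  have a2 : gaussInt (MvPolynomial.pderiv i p * MvPolynomial.pderiv i p) ≤
      ((k + 1 : ℕ) : ℝ) * gaussInt (p * p) := by
    rw [← sum_gaussInt_pderiv_sq hp.1 hp.2]
    exact Finset.single_le_sum (f := fun i => gaussInt (MvPolynomial.pderiv i p *
      MvPolynomial.pderiv i p)) (fun j _ => gaussInt_mul_self_nonneg _) (Finset.mem_univ i)
  have a3 : (Module.finrank ℝ (harmonicSpace ι k) : ℝ) ≤ 2 * ((k + 1 : ℕ) : ℝ) ^ n := by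
    have := (finiteDimensional_and_finrank_harmonicSpace_le (ι := ι) k).2
    rw [hn, Nat.add_sub_cancel] at this
    exact_mod_cast this
  have a4 : gaussInt (p * p) * sphereArea ι = gaussInt (normSqPoly ι ^ (k + 1)) := by
    have hN : (normSqPoly ι ^ (k + 1)).IsHomogeneous (k + 1 + (k + 1)) := by
      have := isHomogeneous_normSqPoly (ι := ι).pow (k + 1)
      rwa [show 2 * (k + 1) = k + 1 + (k + 1) by ring] at this
    have h := gaussInt_mul_integral_sphere (hp.1.mul hp.1) hN
    have e1 : ∀ ω : Metric.sphere (0 : EuclideanSpace ℝ ι) 1,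
        evalE (normSqPoly ι ^ (k + 1)) ω = 1 := fun ω => by
      have := evalE_normSqPoly (ω : EuclideanSpace ℝ ι)
      rw [norm_eq_of_mem_sphere ω, one_pow] at this
      rw [evalE, map_pow, ← evalE, this, one_pow]
    have e2 : ∀ ω : Metric.sphere (0 : EuclideanSpace ℝ ι) 1,
        evalE (p * p) ω = evalE p ω ^ 2 := fun ω => by
      rw [evalE, map_mul, pow_two]
    simp only [e1, e2, h1, mul_one] at h
    rw [← h, sphereArea]
    simp
  have a5 : gaussInt (normSqPoly ι ^ (k + 1)) =
      (Fintype.card ι + (2 * k : ℕ)) * gaussInt (normSqPoly ι ^ k) := by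
    rw [pow_succ', gaussInt_normSqPoly_mul (isHomogeneous_normSqPoly.pow k)]
  have a6 : evalE (MvPolynomial.pderiv i p) x ^ 2 * gaussInt (normSqPoly ι ^ k) ≤
      (((k + 1 : ℕ) : ℝ) * ((Fintype.card ι + (2 * k : ℕ)) * gaussInt (normSqPoly ι ^ k) /
        sphereArea ι)) * (2 * ((k + 1 : ℕ) : ℝ) ^ n) := by
    rw [← a5, ← a4, mul_div_assoc, div_self hσ.ne', mul_one]
    refine a1.trans (mul_le_mul a2 a3 (Nat.cast_nonneg _) ?_)
    exact mul_nonneg (Nat.cast_nonneg _) (gaussInt_mul_self_nonneg _)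
  have a7 : evalE (MvPolynomial.pderiv i p) x ^ 2 ≤
      ((k + 1 : ℕ) : ℝ) * ((Fintype.card ι + (2 * k : ℕ)) / sphereArea ι) *
        (2 * ((k + 1 : ℕ) : ℝ) ^ n) := by
    refine le_of_mul_le_mul_right (a6.trans (le_of_eq ?_)) hI
    ring
  refine a7.trans ?_
  have a8 : (Fintype.card ι : ℝ) + (2 * k : ℕ) ≤ (Fintype.card ι + 2) * ((k + 1 : ℕ) : ℝ) := by
    have : (0 : ℝ) ≤ Fintype.card ι := Nat.cast_nonneg _
    have hk : (0 : ℝ) ≤ k := Nat.cast_nonneg _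
    push_cast
    nlinarith
  calc _ ≤ ((k + 1 : ℕ) : ℝ) * ((Fintype.card ι + 2) * ((k + 1 : ℕ) : ℝ) / sphereArea ι) *
        (2 * ((k + 1 : ℕ) : ℝ) ^ n) := by gcongr
    _ = 2 * (Fintype.card ι + 2) / sphereArea ι * ((k + 1 : ℕ) : ℝ) ^ (n + 2) := by ring
    _ = _ := by rw [hn]

end SupBound

/-! ### Regularity of the kernel -/

section KernelRegularity

/-- A polynomial is bounded by `A` and `A`-Lipschitz on the closed unit ball. -/
structure IsLipschitzOnBall {ι : Type*} [Fintype ι] (A : ℝ) (Y : MvPolynomial ι ℝ) : Prop where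
  bound : ∀ x : EuclideanSpace ℝ ι, ‖x‖ ≤ 1 → |evalE Y x| ≤ A
  lipschitz : ∀ x y : EuclideanSpace ℝ ι, ‖x‖ ≤ 1 → ‖y‖ ≤ 1 → |evalE Y x - evalE Y y| ≤ A * ‖x - y‖

/-- Normalised solid harmonics of degree `m` have Lipschitz constant `O(m ^ (n / 2))` on the unit
ball of an `n`-dimensional space. -/
theorem exists_isLipschitzOnBall (ι : Type*) [Fintype ι] [Nontrivial ι] :
    ∃ C : ℝ, 0 < C ∧ ∀ m : ℕ, 1 ≤ m → ∀ p ∈ harmonicSpace ι m,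
      ∫ ω : Metric.sphere (0 : EuclideanSpace ℝ ι) 1, evalE p ω ^ 2
        ∂(volume : Measure (EuclideanSpace ℝ ι)).toSphere = 1 →
      IsLipschitzOnBall (C * (m : ℝ) ^ ((Fintype.card ι : ℝ) / 2)) p := by
  have hσ := sphereArea_pos (ι := ι)
  set c : ℝ := Real.sqrt (2 * (Fintype.card ι + 2) / sphereArea ι) with hc
  have hc0 : 0 < c := Real.sqrt_pos.2 (by positivity)
  have hcard : (0 : ℝ) < Fintype.card ι := Nat.cast_pos.2 Fintype.card_pos
  refine ⟨Fintype.card ι * c, by positivity, fun m hm p hp hp1 => ?_⟩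
  set a : ℝ := c * (m : ℝ) ^ ((Fintype.card ι : ℝ) / 2) with ha
  have ha0 : 0 ≤ a := by positivity
  have sphere : ∀ x : EuclideanSpace ℝ ι, ‖x‖ = 1 → ∀ i, |evalE (MvPolynomial.pderiv i p) x| ≤ a := by
    intro x hx i
    refine abs_le_of_sq_le_sq' ?_ ha0 |> abs_le.2
    refine (sq_evalE_pderiv_le hm hp hp1 hx i).trans (le_of_eq ?_)
    rw [ha, mul_pow, Real.sq_sqrt (by positivity), ← Real.rpow_natCast (_ ^ _) 2,
      ← Real.rpow_mul (by positivity)]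
    norm_num
  have ball : ∀ x : EuclideanSpace ℝ ι, ‖x‖ ≤ 1 → ∀ i, |evalE (MvPolynomial.pderiv i p) x| ≤ a := by
    intro x hx i
    obtain ⟨w, hw, hxw⟩ : ∃ w : EuclideanSpace ℝ ι, ‖w‖ = 1 ∧ x = ‖x‖ • w := by
      by_cases h : x = 0
      · obtain ⟨w, hw⟩ := exists_norm_eq (EuclideanSpace ℝ ι) zero_le_one
        exact ⟨w, hw, by simp [h]⟩
      · exact ⟨‖x‖⁻¹ • x, norm_smul_inv_norm h, (smul_inv_smul₀ (norm_ne_zero_iff.2 h) x).symm⟩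
    rw [hxw, evalE_smul hp.1.pderiv, abs_mul, abs_of_nonneg (by positivity)]
    exact (mul_le_of_le_one_left (abs_nonneg _) (pow_le_one₀ (norm_nonneg _) hx)).trans
      (sphere w hw i)
  have lip : ∀ x y : EuclideanSpace ℝ ι, ‖x‖ ≤ 1 → ‖y‖ ≤ 1 →
      |evalE p x - evalE p y| ≤ Fintype.card ι * a * ‖x - y‖ := by
    intro x y hx hy
    refine (convex_closedBall (0 : EuclideanSpace ℝ ι) 1).norm_image_sub_le_of_norm_hasFDerivWithin_le
      (fun z _ => (hasFDerivAt_evalE p z).hasFDerivWithinAt) (fun z hz => ?_)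
      (mem_closedBall_zero_iff.2 hy) (mem_closedBall_zero_iff.2 hx)
    refine ContinuousLinearMap.opNorm_le_bound _ (by positivity) fun v => ?_
    simp only [FunLike.coe_sum, Finset.sum_apply, FunLike.coe_smul, Pi.smul_apply, smul_eq_mul,
      PiLp.proj_apply]
    calc ‖∑ i, evalE (MvPolynomial.pderiv i p) z * v i‖ ≤ ∑ _i : ι, a * ‖v‖ := by
          refine (norm_sum_le _ _).trans (Finset.sum_le_sum fun i _ => ?_)
          rw [norm_mul]
          exact mul_le_mul (ball z (mem_closedBall_zero_iff.1 hz) i) (PiLp.norm_apply_le v i)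
            (norm_nonneg _) ha0
      _ = Fintype.card ι * a * ‖v‖ := by simp [mul_assoc]
  rw [mul_assoc]
  refine ⟨fun x hx => ?_, lip⟩
  have h0 : evalE p (0 : EuclideanSpace ℝ ι) = 0 := by
    have := evalE_smul hp.1 0 (0 : EuclideanSpace ℝ ι)
    rwa [zero_smul, zero_pow (by omega), zero_mul] at this
  have := lip x 0 hx (by simp)
  rw [h0, sub_zero, sub_zero] at this
  exact this.trans (mul_le_of_le_one_right (by positivity) hx)

variable {d : ℕ} {s : Fin (d + 1) → ℕ}

theorem kernel_dil (Y : MvPolynomial (Idx s) ℝ) {r : ℝ} (hr : 0 < r) (z : Pt s) :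
    kernel Y (dil r z) = (r ^ (homDim s + 2))⁻¹ * kernel Y z := by
  rw [kernel, kernel, homNorm_dil hr.le, dil_dil, mul_inv, mul_right_comm, inv_mul_cancel₀ hr.ne',
    one_mul, mul_pow]
  field_simp

theorem abs_kernel_le {A : ℝ} {Y : MvPolynomial (Idx s) ℝ} (hY : IsLipschitzOnBall A Y)
    (z : Pt s) : |kernel Y z| ≤ A * (homNorm z ^ (homDim s + 2))⁻¹ := by
  have h := homNorm_nonneg z
  rw [kernel, abs_div, abs_of_nonneg (pow_nonneg h _), div_eq_mul_inv]
  exact mul_le_mul_of_nonneg_right (hY.bound _ (norm_dil_homNorm_inv_le z)) (by positivity)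

theorem measurable_kernel (Y : MvPolynomial (Idx s) ℝ) : Measurable (kernel Y : Pt s → ℝ) := by
  have hN : Measurable (homNorm : Pt s → ℝ) := continuous_homNorm.measurable
  have h1 : Measurable fun z : Pt s => dil (homNorm z)⁻¹ z := by
    unfold dil
    refine (WithLp.measurable_toLp 2 _).comp (measurable_pi_lambda _ fun i => ?_)
    exact (hN.inv.pow_const _).mul (by fun_prop)
  exact ((continuous_evalE Y).measurable.comp h1).div (hN.pow_const _)

theorem abs_pow_sub_one_le {τ : ℝ} (h0 : 0 ≤ τ) (h2 : τ ≤ 2) (k : ℕ) :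
    |τ ^ k - 1| ≤ k * 2 ^ k * |τ - 1| := by
  induction k with
  | zero => simp
  | succ k ih =>
    have e : τ ^ (k + 1) - 1 = τ * (τ ^ k - 1) + (τ - 1) := by ring
    have h1 : |τ * (τ ^ k - 1)| ≤ 2 * (k * 2 ^ k * |τ - 1|) := by
      rw [abs_mul, abs_of_nonneg h0]
      exact mul_le_mul h2 ih (abs_nonneg _) zero_le_two
    have h3 : (1 : ℝ) ≤ 2 ^ (k + 1) := one_le_pow₀ one_le_two
    have h4 : |τ - 1| ≤ 2 ^ (k + 1) * |τ - 1| := le_mul_of_one_le_left (abs_nonneg _) h3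
    rw [e]
    refine (abs_add_le _ _).trans ((add_le_add h1 h4).trans (le_of_eq ?_))
    push_cast
    ring

theorem norm_dil_sub_le {r c : ℝ} (hc : ∀ i : Idx s, |r ^ expo i - 1| ≤ c)
    (z : Pt s) : ‖dil r z - z‖ ≤ c * ‖z‖ := by
  have hc0 : 0 ≤ c := (abs_nonneg _).trans (hc none)
  rw [EuclideanSpace.norm_eq, EuclideanSpace.norm_eq]
  refine Real.sqrt_le_iff.2 ⟨by positivity, ?_⟩
  rw [mul_pow, Real.sq_sqrt (Finset.sum_nonneg fun i _ => sq_nonneg _), Finset.mul_sum]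
  refine Finset.sum_le_sum fun i _ => ?_
  have e : (dil r z - z) i = (r ^ expo i - 1) * z i := by
    rw [PiLp.sub_apply, dil_apply]
    ring
  rw [e, norm_mul, mul_pow, Real.norm_eq_abs]
  have := hc i
  gcongr

/-- Near the unit sphere of the homogeneous norm the kernel inherits the Lipschitz bound of the
polynomial. -/
theorem exists_abs_kernel_sub_le (s : Fin (d + 1) → ℕ) :
    ∃ C ε : ℝ, 0 < C ∧ 0 < ε ∧ ∀ (A : ℝ) (Y : MvPolynomial (Idx s) ℝ), IsLipschitzOnBall A Y →
      ∀ p q : Pt s, homNorm p = 1 → ‖q - p‖ ≤ ε →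
        |kernel Y q - kernel Y p| ≤ C * A * ‖q - p‖ := by
  obtain ⟨L, hL1, hadd⟩ : ∃ L : ℝ, 1 ≤ L ∧ ∀ p q : Pt s, 1 / 2 < homNorm p →
      homNorm p ≤ homNorm q + L * ‖p - q‖ :=
    ⟨2 ^ (2 * d + 1), one_le_pow₀ one_le_two, fun p q => homNorm_le_add⟩
  obtain ⟨k, hk1, hk2⟩ : ∃ k : ℕ, homDim s + 2 ≤ k ∧ 2 * d + 2 ≤ k :=
    ⟨_, le_max_left _ _, le_max_right _ _⟩
  obtain ⟨c, hc⟩ : ∃ c : ℝ, c = k * 2 ^ k * (2 * L) := ⟨_, rfl⟩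
  have hc0 : 0 ≤ c := by rw [hc]; positivity
  refine ⟨1 + 2 * c + c, (4 * L)⁻¹, by positivity, by positivity, fun A Y hY p q hp hpq => ?_⟩
  have hA : 0 ≤ A := (abs_nonneg _).trans (hY.bound 0 (by simp))
  have hδ0 := norm_nonneg (q - p)
  have hδL : L * ‖q - p‖ ≤ 1 / 4 := by
    have := mul_le_mul_of_nonneg_left hpq (show 0 ≤ L by linarith)
    have e : L * (4 * L)⁻¹ = 1 / 4 := by field_simp
    linarith
  have hδ1 : ‖q - p‖ ≤ 1 := by nlinarith
  have h1 := hadd p q (by rw [hp]; norm_num)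
  rw [hp, norm_sub_rev] at h1
  have hq : 1 / 2 < homNorm q := by linarith
  have h2 := hadd q p hq
  rw [hp] at h2
  obtain ⟨σ, hσ⟩ : ∃ σ, σ = homNorm q := ⟨_, rfl⟩
  rw [← hσ] at h1 h2 hq
  have hσ0 : 0 < σ := by linarith
  obtain ⟨τ, hτ⟩ : ∃ τ, τ = σ⁻¹ := ⟨_, rfl⟩
  have hτ0 : 0 ≤ τ := by rw [hτ]; positivity
  have hτ2 : τ ≤ 2 := by
    rw [hτ, inv_le_comm₀ hσ0 two_pos]
    linarith
  have hτ1 : |τ - 1| ≤ 2 * L * ‖q - p‖ := by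
    have e : τ - 1 = τ * (1 - σ) := by
      rw [hτ]
      field_simp
    have h3 : |1 - σ| ≤ L * ‖q - p‖ := abs_le.2 ⟨by linarith, by linarith⟩
    rw [e, abs_mul, abs_of_nonneg hτ0, mul_assoc]
    exact mul_le_mul hτ2 h3 (abs_nonneg _) zero_le_two
  have hpow : ∀ j : ℕ, j ≤ k → |τ ^ j - 1| ≤ c * ‖q - p‖ := by
    intro j hj
    have hj' : (j : ℝ) ≤ k := Nat.cast_le.2 hj
    have h2j : (2 : ℝ) ^ j ≤ 2 ^ k := pow_le_pow_right₀ one_le_two hj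
    calc |τ ^ j - 1| ≤ j * 2 ^ j * |τ - 1| := abs_pow_sub_one_le hτ0 hτ2 j
      _ ≤ k * 2 ^ k * (2 * L * ‖q - p‖) := by gcongr
      _ = c * ‖q - p‖ := by rw [hc]; ring
  have hp1 : ‖p‖ ≤ 1 := homNorm_le_one_iff.1 hp.le
  have hq2 : ‖q‖ ≤ 2 := by
    have := norm_add_le p (q - p)
    rw [add_sub_cancel] at this
    linarith
  have hdq : ‖dil τ q‖ ≤ 1 := by
    rw [hτ, hσ]
    exact norm_dil_homNorm_inv_le q
  have h3 : ‖dil τ q - q‖ ≤ c * ‖q - p‖ * 2 :=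
    (norm_dil_sub_le (fun i => hpow _ ((expo_le i).trans hk2)) q).trans
      (mul_le_mul_of_nonneg_left hq2 (by positivity))
  have h4 : ‖dil τ q - p‖ ≤ (1 + 2 * c) * ‖q - p‖ := by
    have := norm_add_le (dil τ q - q) (q - p)
    rw [sub_add_sub_cancel] at this
    linarith
  have e1 : kernel Y p = evalE Y p := by
    rw [kernel, hp, inv_one, dil_one, one_pow, div_one]
  have e2 : kernel Y q = evalE Y (dil τ q) * τ ^ (homDim s + 2) := by
    rw [kernel, hτ, hσ, inv_pow, div_eq_mul_inv]
  -- `p` is fixed by its own normalising dilation; that of `q` is by `τ`, which is close to one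
  have e3 : kernel Y q - kernel Y p = (evalE Y (dil τ q) - evalE Y p) +
      evalE Y (dil τ q) * (τ ^ (homDim s + 2) - 1) := by
    rw [e1, e2]
    ring
  rw [e3]
  calc _ ≤ |evalE Y (dil τ q) - evalE Y p| + |evalE Y (dil τ q)| * |τ ^ (homDim s + 2) - 1| :=
        (abs_add_le _ _).trans_eq (by rw [abs_mul])
    _ ≤ A * ((1 + 2 * c) * ‖q - p‖) + A * (c * ‖q - p‖) :=
        add_le_add ((hY.lipschitz _ _ hdq hp1).trans (mul_le_mul_of_nonneg_left h4 hA))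
          (mul_le_mul (hY.bound _ hdq) (hpow _ hk1) (abs_nonneg _) hA)
    _ = _ := by ring

/-- Translations by small elements change the kernel little near the unit sphere of the homogeneous
norm. -/
theorem exists_kernel_regularity_unit (B : Matrix (SpaceIdx s) (SpaceIdx s) ℝ) :
    ∃ C M : ℝ, 1 ≤ C ∧ 1 < M ∧ ∀ (A : ℝ) (Y : MvPolynomial (Idx s) ℝ), IsLipschitzOnBall A Y →
      ∀ w v : Pt s, homNorm w = 1 → M * homNorm v ≤ 1 →
        |kernel Y (op B w v) - kernel Y w| ≤ C * A * homNorm v ∧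
        |kernel Y (op B v w) - kernel Y w| ≤ C * A * homNorm v := by
  obtain ⟨C₀, hC₀, hop⟩ := exists_norm_op_sub_le B
  obtain ⟨C₁, ε, hC₁, hε, hker⟩ := exists_abs_kernel_sub_le s
  have hC₀' : 0 < C₀ := by linarith
  have hq : 0 < C₀ / ε := div_pos hC₀' hε
  refine ⟨1 + C₁ * C₀, 2 + C₀ / ε, by linarith [mul_pos hC₁ hC₀'], by linarith,
    fun A Y hY w v hw hv => ?_⟩
  have hA : 0 ≤ A := (abs_nonneg _).trans (hY.bound 0 (by simp))
  have hv0 := homNorm_nonneg v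
  have h0 : 0 ≤ C₀ / ε * homNorm v := mul_nonneg hq.le hv0
  rw [add_mul] at hv
  have hv1 : homNorm v ≤ 1 := by linarith
  have hvn := norm_le_homNorm hv1
  obtain ⟨h1, h2⟩ := hop w v (homNorm_le_one_iff.1 hw.le) (hvn.trans hv1)
  have h3 : C₀ * ‖v‖ ≤ C₀ * homNorm v := mul_le_mul_of_nonneg_left hvn hC₀'.le
  have h4 : C₀ * homNorm v ≤ ε := by
    have h5 : C₀ / ε * homNorm v ≤ 1 := by linarith
    rwa [div_mul_eq_mul_div, div_le_one hε] at h5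
  have h6 : ∀ x : Pt s, ‖x - w‖ ≤ C₀ * homNorm v →
      |kernel Y x - kernel Y w| ≤ (1 + C₁ * C₀) * A * homNorm v := by
    intro x hx
    refine (hker A Y hY w x hw (hx.trans h4)).trans ?_
    have h7 : C₁ * A * ‖x - w‖ ≤ C₁ * A * (C₀ * homNorm v) :=
      mul_le_mul_of_nonneg_left hx (mul_nonneg hC₁.le hA)
    have h8 : 0 ≤ A * homNorm v := mul_nonneg hA hv0
    calc _ ≤ C₁ * A * (C₀ * homNorm v) + A * homNorm v := by linarith
      _ = _ := by ring
  exact ⟨h6 _ (h1.trans h3), h6 _ (h2.trans h3)⟩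

/-- The smoothness of the kernel in terms of the group structure: both left and right translations
by small elements are admitted. -/
theorem exists_kernel_regularity {B : Matrix (SpaceIdx s) (SpaceIdx s) ℝ}
    (hB : IsKolmogorovMatrix s B) :
    ∃ C M : ℝ, 1 ≤ C ∧ 1 < M ∧ ∀ (A : ℝ) (Y : MvPolynomial (Idx s) ℝ), IsLipschitzOnBall A Y →
      ∀ w v : Pt s, M * homNorm v ≤ homNorm w →
        |kernel Y (op B w v) - kernel Y w| ≤
          C * A * (homNorm v / homNorm w ^ (homDim s + 2 + 1)) ∧
        |kernel Y (op B v w) - kernel Y w| ≤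
          C * A * (homNorm v / homNorm w ^ (homDim s + 2 + 1)) := by
  obtain ⟨C, M, hC, hM, unit⟩ := exists_kernel_regularity_unit (s := s) B
  refine ⟨C, M, hC, hM, fun A Y hY w v hwv => ?_⟩
  have hv0 := homNorm_nonneg v
  by_cases hw : w = 0
  · have hv : v = 0 := by
      rw [hw, homNorm_zero] at hwv
      exact homNorm_eq_zero_iff.1 (le_antisymm (nonpos_of_mul_nonpos_right hwv (by linarith)) hv0)
    subst hw hv
    simp [zero_op]
  have hρ := homNorm_pos hw
  obtain ⟨ρ, hρd⟩ : ∃ ρ, ρ = homNorm w := ⟨_, rfl⟩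
  rw [← hρd] at hρ hwv ⊢
  have hρi : ρ⁻¹ ≠ 0 := inv_ne_zero hρ.ne'
  have hu := unit A Y hY (dil ρ⁻¹ w) (dil ρ⁻¹ v)
    (by rw [homNorm_dil (by positivity), ← hρd, inv_mul_cancel₀ hρ.ne'])
    (by
      rw [homNorm_dil (by positivity), ← mul_assoc, mul_comm M, mul_assoc, inv_mul_le_iff₀ hρ]
      linarith)
  rw [← dil_op hB hρi, ← dil_op hB hρi, kernel_dil _ (by positivity), kernel_dil _ (by positivity),
    kernel_dil _ (by positivity), ← mul_sub, ← mul_sub, abs_mul, abs_mul, inv_pow, inv_inv,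
    abs_of_pos (by positivity), homNorm_dil (by positivity)] at hu
  have fin : ∀ x : ℝ, ρ ^ (homDim s + 2) * x ≤ C * A * (ρ⁻¹ * homNorm v) →
      x ≤ C * A * (homNorm v / ρ ^ (homDim s + 2 + 1)) := by
    intro x hx
    have hp : 0 < ρ ^ (homDim s + 2) := by positivity
    rw [← le_div_iff₀' hp] at hx
    refine hx.trans (le_of_eq ?_)
    rw [pow_succ ρ (homDim s + 2)]
    field_simp
  exact ⟨fin _ hu.1, fin _ hu.2⟩

end KernelRegularity

/-! ### Spherical means of solid harmonics times quadratic forms -/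

section SphericalMean

variable {ι : Type*} [Fintype ι]

theorem gaussInt_eq_zero_of_harmonic {k : ℕ} (hk : k ≠ 0) {p : MvPolynomial ι ℝ}
    (hp : p ∈ harmonicSpace ι k) : gaussInt p = 0 := by
  have h1 := congrArg gaussInt hp.1.sum_X_mul_pderiv
  rw [gaussInt_sum] at h1
  simp only [← gaussInt_pderiv] at h1
  rw [← gaussInt_sum, hp.2, nsmul_eq_mul, show ((k : ℕ) : MvPolynomial ι ℝ) =
    MvPolynomial.C (k : ℝ) by simp, gaussInt_C_mul] at h1
  have h0 : gaussInt (0 : MvPolynomial ι ℝ) = 0 := map_zero (gaussIntL ι)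
  rw [h0] at h1
  exact (mul_eq_zero.1 h1.symm).resolve_left (Nat.cast_ne_zero.2 hk)

theorem gaussInt_X_sq_mul_eq_zero {m : ℕ} (hm : m ≠ 0) (hm2 : m ≠ 2) {p : MvPolynomial ι ℝ}
    (hp : p ∈ harmonicSpace ι m) (i : ι) : gaussInt (MvPolynomial.X i ^ 2 * p) = 0 := by
  rw [pow_two, mul_assoc, ← gaussInt_pderiv, MvPolynomial.pderiv_mul, MvPolynomial.pderiv_X_self,
    gaussInt_add, one_mul, gaussInt_eq_zero_of_harmonic hm hp, zero_add, ← gaussInt_pderiv]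
  obtain ⟨k, rfl⟩ : ∃ k, m = k + 1 := ⟨m - 1, by omega⟩
  have h1 := pderiv_mem_harmonicSpace hp i
  rcases k with _ | k
  · obtain ⟨c, hc⟩ : ∃ c, MvPolynomial.pderiv i p = MvPolynomial.C c :=
      ⟨_, MvPolynomial.totalDegree_eq_zero_iff_eq_C.1 (Nat.le_zero.1 h1.1.totalDegree_le)⟩
    rw [hc, MvPolynomial.pderiv_C]
    exact map_zero (gaussIntL ι)
  · exact gaussInt_eq_zero_of_harmonic (by omega) (pderiv_mem_harmonicSpace h1 i)

theorem integral_norm_pow_mul_gauss_pos [Nonempty ι] (k : ℕ) :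
    0 < ∫ x : EuclideanSpace ℝ ι, ‖x‖ ^ k * gauss x := by
  have hint : Integrable fun x : EuclideanSpace ℝ ι => ‖x‖ ^ k * gauss x := by
    refine (integrable_evalE_mul_gauss (1 + normSqPoly ι ^ k)).mono'
      ((continuous_norm.pow k).mul continuous_gauss).aestronglyMeasurable
      (Eventually.of_forall fun x => ?_)
    have h1 : evalE (1 + normSqPoly ι ^ k) x = 1 + (‖x‖ ^ k) ^ 2 := by
      rw [evalE, map_add, map_one, map_pow, ← evalE, evalE_normSqPoly, ← pow_mul, ← pow_mul,
        mul_comm]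
    have h2 := gauss_pos x
    rw [h1, Real.norm_of_nonneg (by positivity)]
    refine mul_le_mul_of_nonneg_right ?_ h2.le
    nlinarith [sq_nonneg (‖x‖ ^ k - 1), sq_nonneg (‖x‖ ^ k)]
  rw [integral_pos_iff_support_of_nonneg
    (fun x => mul_nonneg (by positivity) (gauss_pos x).le) hint]
  have hsub : {(0 : EuclideanSpace ℝ ι)}ᶜ ⊆ Function.support fun x => ‖x‖ ^ k * gauss x := by
    intro x hx
    have : ‖x‖ ≠ 0 := norm_ne_zero_iff.2 hx
    exact mul_ne_zero (by positivity) (gauss_pos x).ne'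
  refine lt_of_lt_of_le ?_ (measure_mono hsub)
  exact isOpen_compl_singleton.measure_pos _ (exists_ne (0 : EuclideanSpace ℝ ι))

theorem integral_sphere_eq_zero_of_gaussInt [Nonempty ι] {k : ℕ} {p : MvPolynomial ι ℝ}
    (hp : p.IsHomogeneous k) (h0 : gaussInt p = 0) :
    ∫ ω : Metric.sphere (0 : EuclideanSpace ℝ ι) 1, evalE p ω
      ∂(volume : Measure (EuclideanSpace ℝ ι)).toSphere = 0 := by
  have h1 := integral_evalE_mul_radial hp fun r => Real.exp (-(r ^ 2) / 2)
  have h2 := integral_evalE_mul_radial (ι := ι) (MvPolynomial.isHomogeneous_one ι ℝ)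
    fun r => r ^ k * Real.exp (-(r ^ 2) / 2)
  have hpos := integral_norm_pow_mul_gauss_pos (ι := ι) k
  simp only [evalE, map_one, one_mul, pow_zero] at h2
  simp only [gauss] at hpos
  rw [h2] at hpos
  rw [gaussInt] at h0
  simp only [gauss] at h0
  rw [h1] at h0
  refine (mul_eq_zero.1 h0).resolve_right fun h => ?_
  rw [h, mul_zero] at hpos
  exact lt_irrefl _ hpos

/-- The quadratic form `∑ aᵢ xᵢ²`. -/
def diagPoly (a : ι → ℝ) : MvPolynomial ι ℝ := ∑ i, MvPolynomial.C (a i) * MvPolynomial.X i ^ 2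

theorem isHomogeneous_diagPoly (a : ι → ℝ) : (diagPoly a).IsHomogeneous 2 :=
  MvPolynomial.IsHomogeneous.sum _ _ _ fun i _ =>
    ((MvPolynomial.isHomogeneous_X ℝ i).pow 2).C_mul _

/-- Solid harmonics of degree `m ∉ {0, 2}` are orthogonal to diagonal quadratic forms on the
sphere. -/
theorem integral_sphere_mul_diagPoly_eq_zero [Nonempty ι] {m : ℕ} (hm : m ≠ 0) (hm2 : m ≠ 2)
    {p : MvPolynomial ι ℝ} (hp : p ∈ harmonicSpace ι m) (a : ι → ℝ) :
    ∫ ω : Metric.sphere (0 : EuclideanSpace ℝ ι) 1, evalE (p * diagPoly a) ω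
      ∂(volume : Measure (EuclideanSpace ℝ ι)).toSphere = 0 := by
  refine integral_sphere_eq_zero_of_gaussInt (hp.1.mul (isHomogeneous_diagPoly a)) ?_
  rw [diagPoly, Finset.mul_sum, gaussInt_sum]
  refine Finset.sum_eq_zero fun i _ => ?_
  rw [mul_left_comm, gaussInt_C_mul, mul_comm p, gaussInt_X_sq_mul_eq_zero hm hm2 hp, mul_zero]

end SphericalMean

/-! ### Homogeneous polar coordinates -/

section HomogeneousPolar

variable {d : ℕ} {s : Fin (d + 1) → ℕ}

/-- The map `x ↦ δ_{|x|} (x / |x|)`, which takes Euclidean to homogeneous spheres. -/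
def polarMap (x : Pt s) : Pt s := WithLp.toLp 2 fun i => ‖x‖ ^ (expo i - 1) * x i

theorem polarMap_eq {x : Pt s} (hx : x ≠ 0) : polarMap x = dil ‖x‖ (‖x‖⁻¹ • x) := by
  have h : ‖x‖ ≠ 0 := norm_ne_zero_iff.2 hx
  ext i
  obtain ⟨k, hk⟩ : ∃ k, expo i = k + 1 := ⟨expo i - 1, by have := one_le_expo i; omega⟩
  simp only [polarMap, dil_apply, PiLp.smul_apply, smul_eq_mul, hk, Nat.add_sub_cancel, pow_succ]
  field_simp

theorem homNorm_polarMap {x : Pt s} (hx : x ≠ 0) : homNorm (polarMap x) = ‖x‖ := by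
  rw [polarMap_eq hx, homNorm_dil (norm_nonneg _),
    homNorm_eq_of_norm_dil one_pos (by rw [inv_one, dil_one]; exact norm_smul_inv_norm hx),
    mul_one]

theorem dil_inv_polarMap {x : Pt s} (hx : x ≠ 0) : dil ‖x‖⁻¹ (polarMap x) = ‖x‖⁻¹ • x := by
  rw [polarMap_eq hx, dil_dil, inv_mul_cancel₀ (norm_ne_zero_iff.2 hx), dil_one]

theorem polarMap_injOn {a b : ℝ} (ha : 0 < a) :
    Set.InjOn (polarMap : Pt s → Pt s) {x | a < ‖x‖ ∧ ‖x‖ ≤ b} := by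
  intro x hx y hy h
  have hx0 : x ≠ 0 := norm_pos_iff.1 (ha.trans hx.1)
  have hy0 : y ≠ 0 := norm_pos_iff.1 (ha.trans hy.1)
  have h1 : ‖x‖ = ‖y‖ := by rw [← homNorm_polarMap hx0, h, homNorm_polarMap hy0]
  have h2 := dil_inv_polarMap hx0
  rw [h, h1, dil_inv_polarMap hy0] at h2
  exact (smul_right_injective _ (inv_ne_zero (norm_ne_zero_iff.2 hy0)) h2).symm

theorem polarMap_image {a b : ℝ} (ha : 0 < a) :
    (polarMap : Pt s → Pt s) '' {x | a < ‖x‖ ∧ ‖x‖ ≤ b} = {z | a < homNorm z ∧ homNorm z ≤ b} := by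
  ext z
  constructor
  · rintro ⟨x, hx, rfl⟩
    have hx0 : x ≠ 0 := norm_pos_iff.1 (ha.trans hx.1)
    rwa [Set.mem_ofPred_eq, homNorm_polarMap hx0]
  · intro hz
    have hN : 0 < homNorm z := ha.trans hz.1
    have hz0 : z ≠ 0 := fun h => by simp [h] at hN
    have hw := norm_dil_homNorm_inv hz0
    have hn : ‖homNorm z • dil (homNorm z)⁻¹ z‖ = homNorm z := by
      rw [norm_smul, hw, mul_one, Real.norm_of_nonneg hN.le]
    refine ⟨homNorm z • dil (homNorm z)⁻¹ z, by rwa [Set.mem_ofPred_eq, hn], ?_⟩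
    rw [polarMap_eq (norm_pos_iff.1 (by rwa [hn])), hn, inv_smul_smul₀ hN.ne', dil_dil,
      mul_inv_cancel₀ hN.ne', dil_one]

/-- The Jacobian matrix of `polarMap`: a diagonal matrix times a rank one perturbation of the
identity. -/
def polarJac (x : Pt s) : Matrix (Idx s) (Idx s) ℝ :=
  Matrix.diagonal (fun i => ‖x‖ ^ (expo i - 1)) *
    (1 + Matrix.replicateCol Unit (fun i => ((expo i : ℝ) - 1) * x i / ‖x‖ ^ 2) *
      Matrix.replicateRow Unit (fun i => x i))

/-- The matrix determinant lemma. As `expo i` are the exponents of the dilations, the Jacobian is a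
radial factor times a quadratic form. -/
theorem det_polarJac {x : Pt s} (hx : x ≠ 0) :
    (polarJac x).det = ‖x‖ ^ (∑ i : Idx s, (expo i - 1)) *
      (evalE (diagPoly fun i : Idx s => (expo i : ℝ)) x / ‖x‖ ^ 2) := by
  have h : ‖x‖ ≠ 0 := norm_ne_zero_iff.2 hx
  rw [polarJac, Matrix.det_mul, Matrix.det_diagonal, Finset.prod_pow_eq_pow_sum,
    Matrix.det_one_add_replicateCol_mul_replicateRow]
  congr 1
  have h2 : ‖x‖ ^ 2 = ∑ i, x i ^ 2 := by
    rw [EuclideanSpace.norm_sq_eq]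
    simp
  have h3 : ((fun i => x i) ⬝ᵥ fun i => ((expo i : ℝ) - 1) * x i / ‖x‖ ^ 2) =
      (∑ i, ((expo i : ℝ) - 1) * x i ^ 2) / ‖x‖ ^ 2 := by
    rw [dotProduct, Finset.sum_div]
    refine Finset.sum_congr rfl fun i _ => ?_
    ring
  rw [h3, eq_div_iff (by positivity), add_mul, one_mul, div_mul_cancel₀ _ (by positivity)]
  conv_lhs => rw [h2]
  rw [← Finset.sum_add_distrib, evalE, diagPoly, map_sum]
  refine Finset.sum_congr rfl fun i _ => ?_
  simp
  ring

theorem hasFDerivAt_norm_of_ne {E : Type*} [NormedAddCommGroup E] [InnerProductSpace ℝ E] {x : E}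
    (hx : x ≠ 0) : HasFDerivAt (fun y : E => ‖y‖) (‖x‖⁻¹ • innerSL ℝ x) x := by
  have h : ‖x‖ ≠ 0 := norm_ne_zero_iff.2 hx
  have h1 := (hasStrictFDerivAt_norm_sq x).hasFDerivAt.sqrt (by positivity)
  simp only [Real.sqrt_sq (norm_nonneg _)] at h1
  have e : ‖x‖⁻¹ • innerSL ℝ x = (1 / (2 * ‖x‖)) • 2 • (innerSL ℝ x : E →L[ℝ] ℝ) := by
    ext y
    simp
    field_simp
  rw [e]
  exact h1

theorem hasFDerivAt_polarMap {x : Pt s} (hx : x ≠ 0) :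
    HasFDerivAt polarMap (LinearMap.toContinuousLinearMap
      (Matrix.toLin (EuclideanSpace.basisFun (Idx s) ℝ).toBasis
        (EuclideanSpace.basisFun (Idx s) ℝ).toBasis (polarJac x))) x := by
  have hn : ‖x‖ ≠ 0 := norm_ne_zero_iff.2 hx
  rw [← hasFDerivWithinAt_univ, hasFDerivWithinAt_euclidean]
  intro i
  have h1 : HasFDerivAt (fun y : Pt s => y i) (EuclideanSpace.proj i : _ →L[ℝ] ℝ) x :=
    (EuclideanSpace.proj i : Pt s →L[ℝ] ℝ).hasFDerivAt
  have h2 := ((hasFDerivAt_norm_of_ne hx).pow (expo i - 1)).mul h1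
  rw [hasFDerivWithinAt_univ]
  refine h2.congr_fderiv ?_
  ext v
  have h3 : ((Matrix.toLin (EuclideanSpace.basisFun (Idx s) ℝ).toBasis
      (EuclideanSpace.basisFun (Idx s) ℝ).toBasis (polarJac x)) v) i =
      (polarJac x).mulVec (fun j => v j) i := by
    rw [Matrix.toLin_apply]
    rcases i with _ | i <;> simp [Pi.single_apply, Matrix.mulVec, dotProduct]
  have h4 : (polarJac x).mulVec (fun j => v j) i =
      ‖x‖ ^ (expo i - 1) * (v i + ((expo i : ℝ) - 1) * x i / ‖x‖ ^ 2 * ∑ j, x j * v j) := by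
    rw [polarJac, ← Matrix.mulVec_mulVec, Matrix.mulVec_diagonal, Matrix.add_mulVec,
      Matrix.one_mulVec, Pi.add_apply]
    congr 2
    simp only [Matrix.mulVec, dotProduct, Matrix.mul_apply, Finset.univ_unique,
      Matrix.replicateCol_apply, Matrix.replicateRow_apply, Finset.sum_singleton, Finset.mul_sum,
      mul_assoc]
  have h5 : inner ℝ x v = ∑ j, x j * v j := by
    rw [PiLp.inner_apply]
    simp [mul_comm]
  simp only [ContinuousLinearMap.comp_apply, PiLp.proj_apply, LinearMap.coe_toContinuousLinearMap',
    h3, h4, ← h5]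
  simp only [FunLike.coe_add, FunLike.coe_smul, Pi.add_apply, Pi.smul_apply, smul_eq_mul,
    PiLp.proj_apply, innerSL_apply_apply, nsmul_eq_mul]
  obtain ⟨k, hk⟩ : ∃ k, expo i = k + 1 := ⟨expo i - 1, by have := one_le_expo i; omega⟩
  rw [hk, Nat.add_sub_cancel]
  rcases k with _ | k
  · simp
  · rw [Nat.add_sub_cancel]
    push_cast
    field_simp
    ring

/-- The integral of the kernel over a homogeneous annulus factors into a spherical and a radial
integral. -/
theorem setIntegral_kernel {m : ℕ} {Y : MvPolynomial (Idx s) ℝ} (hY : Y.IsHomogeneous m)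
    {a b : ℝ} (ha : 0 < a) : ∃ c : ℝ, ∫ z in {z : Pt s | a < homNorm z ∧ homNorm z ≤ b}, kernel Y z =
      (∫ ω : Metric.sphere (0 : Pt s) 1, evalE (Y * diagPoly fun i : Idx s => (expo i : ℝ)) ω
        ∂(volume : Measure (Pt s)).toSphere) * c := by
  set S : Set (Pt s) := {x | a < ‖x‖ ∧ ‖x‖ ≤ b} with hS
  have hSm : MeasurableSet S :=
    (measurableSet_lt measurable_const measurable_norm).inter
      (measurableSet_le measurable_norm measurable_const)
  have h0 : ∀ x ∈ S, x ≠ 0 := fun x hx => norm_pos_iff.1 (ha.trans hx.1)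
  set h : ℝ → ℝ := (Set.Ioc a b).indicator fun r =>
    r ^ (∑ i : Idx s, (expo i - 1)) * (r ^ 2)⁻¹ * (r ^ m)⁻¹ * (r ^ (homDim s + 2))⁻¹ with hh
  rw [← polarMap_image ha, integral_image_eq_integral_abs_det_fderiv_smul volume hSm
    (fun x hx => (hasFDerivAt_polarMap (h0 x hx)).hasFDerivWithinAt) (polarMap_injOn ha)]
  refine ⟨_, Eq.trans ?_ (integral_evalE_mul_radial
    (hY.mul (isHomogeneous_diagPoly fun i : Idx s => (expo i : ℝ))) h)⟩
  rw [← integral_indicator hSm]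
  refine integral_congr_ae (Eventually.of_forall fun x => ?_)
  by_cases hx : x ∈ S
  · have hn : 0 < ‖x‖ := norm_pos_iff.2 (h0 x hx)
    have hx' : ‖x‖ ∈ Set.Ioc a b := hx
    have hW : 0 ≤ evalE (diagPoly fun i : Idx s => (expo i : ℝ)) x := by
      rw [evalE, diagPoly, map_sum]
      refine Finset.sum_nonneg fun i _ => ?_
      simp only [map_mul, map_pow, MvPolynomial.eval_C, MvPolynomial.eval_X]
      positivity
    have hdet : (LinearMap.toContinuousLinearMap
        (Matrix.toLin (EuclideanSpace.basisFun (Idx s) ℝ).toBasis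
        (EuclideanSpace.basisFun (Idx s) ℝ).toBasis (polarJac x))).det = (polarJac x).det := by
      rw [LinearMap.det_toContinuousLinearMap, LinearMap.det_toLin]
    have hker : kernel Y (polarMap x) =
        (‖x‖ ^ m)⁻¹ * evalE Y x / ‖x‖ ^ (homDim s + 2) := by
      rw [kernel, homNorm_polarMap (h0 x hx), dil_inv_polarMap (h0 x hx), ← evalE,
        evalE_smul hY, inv_pow]
    simp only [Set.indicator_of_mem hx, hdet, hh, Set.indicator_of_mem hx', hker]
    rw [det_polarJac (h0 x hx), abs_of_nonneg (by positivity), smul_eq_mul,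
      show evalE (Y * _) x = evalE Y x * evalE _ x from map_mul _ _ _]
    ring
  · have hx' : ‖x‖ ∉ Set.Ioc a b := hx
    simp [Set.indicator_of_notMem hx, hh, Set.indicator_of_notMem hx']

end HomogeneousPolar

/-! ### The kernel as a singular kernel -/

section Conclusion

variable {d : ℕ} {s : Fin (d + 1) → ℕ} {B : Matrix (SpaceIdx s) (SpaceIdx s) ℝ}

theorem nontrivial_idx (hB : IsKolmogorovMatrix s B) : Nontrivial (Idx s) :=
  ⟨⟨none, some ⟨0, ⟨0, hB.pos 0⟩⟩, by simp⟩⟩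

/-- The mean of the kernel over homogeneous annuli vanishes; in degree `2`, where the kernel need
not be orthogonal to the Jacobian of homogeneous polar coordinates, this is an assumption. -/
theorem setIntegral_kernel_eq_zero (hB : IsKolmogorovMatrix s B) {m : ℕ} (hm : 1 ≤ m)
    {Y : MvPolynomial (Idx s) ℝ} (hY : Y ∈ harmonicSpace (Idx s) m)
    (h2 : m = 2 → VanishingMean (kernel Y : Pt s → ℝ)) {a b : ℝ} (ha : 0 < a) (hab : a < b) :
    ∫ z in {z : Pt s | a < homNorm z ∧ homNorm z ≤ b}, kernel Y z = 0 := by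
  by_cases h : m = 2
  · obtain ⟨κ, hN⟩ := exists_isGauge_homNorm hB
    have hb : 0 < b := ha.trans hab
    -- the assumption concerns the open annulus, which differs by a null set
    have hnull : volume {z : Pt s | homNorm z = b} = 0 := by
      refine le_antisymm (ge_of_tendsto (f := fun h : ℝ => ENNReal.ofReal
        (3 * (volume (Metric.ball (0 : Pt s) 1)).toReal * (homDim s + 2 : ℕ) *
          2 ^ (homDim s + 2) * b ^ (homDim s + 2) * (h / b))) (x := 𝓝[>] 0) ?_ ?_) bot_le
      · have hc : Continuous fun h : ℝ => ENNReal.ofReal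
            (3 * (volume (Metric.ball (0 : Pt s) 1)).toReal * (homDim s + 2 : ℕ) *
              2 ^ (homDim s + 2) * b ^ (homDim s + 2) * (h / b)) :=
          ENNReal.continuous_ofReal.comp (by fun_prop)
        have := hc.tendsto 0
        simp only [zero_div, mul_zero, ENNReal.ofReal_zero] at this
        exact this.mono_left nhdsWithin_le_nhds
      · have hlt : ∀ᶠ h : ℝ in 𝓝[>] 0, h < b / 2 :=
          nhdsWithin_le_nhds (eventually_lt_nhds (by linarith))
        filter_upwards [self_mem_nhdsWithin, hlt] with h h0 h1
        have h0' : (0 : ℝ) < h := h0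
        refine le_trans (measure_mono fun z hz => ?_)
          (hN.measure_shell_le hb h0' (by linarith))
        have hz' : homNorm z = b := hz
        change |homNorm z - b| ≤ h
        rw [hz', sub_self, abs_zero]
        exact h0'.le
    rw [← h2 h a b ha hab]
    refine setIntegral_congr_set ?_
    have hne : ∀ᵐ z : Pt s, homNorm z ≠ b := measure_eq_zero_iff_ae_notMem.1 hnull
    filter_upwards [hne] with z hz
    refine propext (and_congr_right fun _ => ⟨fun hle => lt_of_le_of_ne hle hz, le_of_lt⟩)
  · obtain ⟨c, hc⟩ := setIntegral_kernel hY.1 ha (b := b)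
    rw [hc, integral_sphere_mul_diagPoly_eq_zero (by omega) h hY, zero_mul]

/-- After normalisation, the kernels are singular kernels on the Kolmogorov group with uniform
constants. -/
theorem exists_isSingularKernel (hB : IsKolmogorovMatrix s B) :
    ∃ C M : ℝ, 1 ≤ C ∧ 1 ≤ M ∧ ∀ m : ℕ, 1 ≤ m → ∀ Y ∈ harmonicSpace (Idx s) m,
      (m = 2 → VanishingMean (kernel Y : Pt s → ℝ)) → ∀ A : ℝ, 0 < A → IsLipschitzOnBall A Y →
        IsSingularKernel (lebesgue B) (homNorm : Pt s → ℝ) (homDim s + 2) M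
          fun u : Pt s => (C * A)⁻¹ * kernel Y u := by
  obtain ⟨C, M, hC, hM, hreg⟩ := exists_kernel_regularity hB
  refine ⟨C, M, hC, hM.le, fun m hm Y hY h2 A hA hYA => ?_⟩
  have hCA : 0 < C * A := by positivity
  have diff : ∀ x y t : ℝ, |x - y| ≤ C * A * t → |(C * A)⁻¹ * x - (C * A)⁻¹ * y| ≤ t := by
    intro x y t h
    rw [← mul_sub, abs_mul, abs_of_pos (inv_pos.2 hCA), inv_mul_le_iff₀ hCA]
    exact h
  refine ⟨(measurable_kernel Y).const_mul _, fun (u : Pt s) => ?_, fun w v h => ?_,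
    fun w v h => ?_, fun a b ha hab => ?_⟩
  · have h1 : 0 ≤ (homNorm u ^ (homDim s + 2))⁻¹ := inv_nonneg.2 (pow_nonneg (homNorm_nonneg u) _)
    rw [abs_mul, abs_of_pos (inv_pos.2 hCA), inv_mul_le_iff₀ hCA]
    refine (abs_kernel_le hYA u).trans (mul_le_mul_of_nonneg_right ?_ h1)
    exact le_mul_of_one_le_left hA.le hC
  · exact diff _ _ _ (hreg A Y hYA w v h).1
  · exact diff _ _ _ (hreg A Y hYA w v h).2
  · have h3 := setIntegral_kernel_eq_zero hB hm hY h2 ha hab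
    have h4 : ∫ u in {u : Pt s | a < homNorm u ∧ homNorm u ≤ b}, (C * A)⁻¹ * kernel Y u = 0 := by
      rw [integral_const_mul, h3, mul_zero]
    exact h4

theorem div_pow_le_of_le_mul {κ v a b : ℝ} (D : ℕ) (hv : 0 ≤ v) (hb : 0 ≤ b) (hκ : 0 < κ)
    (hab : b ≤ κ * a) (h0 : b = 0 → v = 0) : v / a ^ D ≤ κ ^ D * (v / b ^ D) := by
  rcases eq_or_lt_of_le hb with hb | hb
  · simp [h0 hb.symm]
  · have ha : 0 < a := pos_of_mul_pos_right (hb.trans_le hab) hκ.le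
    have h3 : b ^ D ≤ κ ^ D * a ^ D := by
      rw [← mul_pow]
      gcongr
    rw [← mul_div_assoc, div_le_div_iff₀ (by positivity) (by positivity)]
    calc v * b ^ D ≤ v * (κ ^ D * a ^ D) := by gcongr
      _ = _ := by ring

/-- Hörmander's condition with exponent one: both differences are translations by the small element
`ζ⁻¹ ∘ z` or its inverse. -/
theorem exists_hormanderCondition (hB : IsKolmogorovMatrix s B) :
    ∃ C M : ℝ, 0 < C ∧ 1 < M ∧ ∀ (A : ℝ) (Y : MvPolynomial (Idx s) ℝ), IsLipschitzOnBall A Y →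
      HormanderCondition B (kernel Y) (C * A) 1 M := by
  obtain ⟨C, M, hC, hM, hreg⟩ := exists_kernel_regularity hB
  obtain ⟨κ, hN⟩ := exists_isGauge_homNorm hB
  have hκ := hN.one_le
  have hinv : ∀ u : Pt s, homNorm (inv B u) ≤ κ * homNorm u := hN.inv_le
  refine ⟨C * κ ^ (homDim s + 2 + 1), M * κ, by positivity, by nlinarith,
    fun A Y hYA z ζ η hz => ?_⟩
  have hA : 0 ≤ A := (abs_nonneg _).trans (hYA.bound 0 (by simp))
  obtain ⟨w, hw⟩ : ∃ w, w = op B (inv B η) z := ⟨_, rfl⟩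
  obtain ⟨v, hv⟩ : ∃ v, v = op B (inv B ζ) z := ⟨_, rfl⟩
  have e1 : op B (inv B η) ζ = op B w (inv B v) := by
    have : ∀ a b c : KGroup B, a⁻¹ * b = a⁻¹ * c * (b⁻¹ * c)⁻¹ := fun a b c => by group
    rw [hw, hv]
    exact this η ζ z
  have e2 : op B (inv B ζ) η = op B v (inv B w) := by
    have : ∀ a b c : KGroup B, b⁻¹ * a = b⁻¹ * c * (a⁻¹ * c)⁻¹ := fun a b c => by group
    rw [hw, hv]
    exact this η ζ z
  have e3 : op B (inv B z) η = inv B w := by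
    have : ∀ a c : KGroup B, c⁻¹ * a = (a⁻¹ * c)⁻¹ := fun a c => by group
    rw [hw]
    exact this η z
  have e4 : inv B (inv B w) = w := inv_inv (G := KGroup B) w
  rw [e1, e2, e3, ← hw, ← hv]
  rw [← hw, ← hv] at hz
  have hv0 := homNorm_nonneg v
  have hw0 := homNorm_nonneg w
  have hw' : homNorm w ≤ κ * homNorm (inv B w) := by
    have := hinv (inv B w)
    rwa [e4] at this
  have hexp : homNorm v ^ (1 : ℝ) / homNorm w ^ ((homDim s : ℝ) + 2 + 1) =
      homNorm v / homNorm w ^ (homDim s + 2 + 1) := by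
    rw [Real.rpow_one, show (homDim s : ℝ) + 2 + 1 = ((homDim s + 2 + 1 : ℕ) : ℝ) by push_cast; ring,
      Real.rpow_natCast]
  rw [hexp]
  obtain ⟨D, hD⟩ : ∃ D, D = homDim s + 2 + 1 := ⟨_, rfl⟩
  rw [← hD] at hreg ⊢
  have hκD : κ ≤ κ ^ D := le_self_pow₀ hκ (by omega)
  constructor
  · have h1 : M * homNorm (inv B v) ≤ homNorm w :=
      (mul_le_mul_of_nonneg_left (hinv v) (by linarith)).trans (by rwa [← mul_assoc])
    refine ((hreg A Y hYA w (inv B v) h1).1).trans ?_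
    calc C * A * (homNorm (inv B v) / homNorm w ^ D)
        ≤ C * A * (κ ^ D * homNorm v / homNorm w ^ D) := by
          gcongr
          exact (hinv v).trans (mul_le_mul_of_nonneg_right hκD hv0)
      _ = _ := by ring
  · have h1 : M * homNorm v ≤ homNorm (inv B w) := by
      have h2 : κ * (M * homNorm v) ≤ κ * homNorm (inv B w) := by linarith
      exact le_of_mul_le_mul_left h2 (by linarith)
    have h2 : homNorm w = 0 → homNorm v = 0 := fun h0 => by
      rw [h0] at hz
      exact le_antisymm (nonpos_of_mul_nonpos_right hz (by positivity)) hv0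
    refine ((hreg A Y hYA (inv B w) v h1).2).trans ?_
    have h3 := mul_le_mul_of_nonneg_left
      (div_pow_le_of_le_mul D hv0 hw0 (by linarith) hw' h2) (show 0 ≤ C * A by positivity)
    exact h3.trans (le_of_eq (by ring))

theorem HormanderCondition.mono {K : Pt s → ℝ} {C C' β M : ℝ} (h : HormanderCondition B K C β M)
    (hC : C ≤ C') : HormanderCondition B K C' β M := fun z ζ η hz => by
  have h0 : 0 ≤ homNorm (op B (inv B ζ) z) ^ β /
      homNorm (op B (inv B η) z) ^ ((homDim s : ℝ) + 2 + β) :=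
    div_nonneg (Real.rpow_nonneg (homNorm_nonneg _) _) (Real.rpow_nonneg (homNorm_nonneg _) _)
  exact ⟨(h z ζ η hz).1.trans (mul_le_mul_of_nonneg_right hC h0),
    (h z ζ η hz).2.trans (mul_le_mul_of_nonneg_right hC h0)⟩

/-! ### Truncated integrals as convolutions -/

/-- The truncated integrals in terms of the kernel normalised by a constant `α`. -/
theorem truncInt_eq_conv {Y : MvPolynomial (Idx s) ℝ} {α : ℝ} (hα : α ≠ 0) (f : Pt s → ℝ)
    (z : Pt s) (ε : ℝ) :
    truncInt B Y f z ε = α * conv (lebesgue B)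
      (tailK (homNorm : Pt s → ℝ) (fun u : Pt s => α⁻¹ * kernel Y u) ε) f z := by
  have hg : Continuous fun ζ : Pt s => op B (inv B ζ) z :=
    (contDiff_op B).continuous.comp ((contDiff_inv B).continuous.prodMk continuous_const)
  have hm : MeasurableSet {ζ : Pt s | ε < homNorm (op B (inv B ζ) z)} :=
    (isOpen_lt continuous_const (continuous_homNorm.comp hg)).measurableSet
  have h1 : truncInt B Y f z ε = ∫ ζ : Pt s, α *
      (tailK (homNorm : Pt s → ℝ) (fun u : Pt s => α⁻¹ * kernel Y u) ε (op B (inv B ζ) z) * f ζ) := by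
    rw [truncInt, ← integral_indicator hm]
    refine integral_congr_ae (Eventually.of_forall fun ζ => ?_)
    by_cases h : ε < homNorm (op B (inv B ζ) z)
    · have h' : ζ ∈ {ζ : Pt s | ε < homNorm (op B (inv B ζ) z)} := h
      have h'' : op B (inv B ζ) z ∈ {u : Pt s | ε < homNorm u} := h
      simp only [tailK, Set.indicator_of_mem h', Set.indicator_of_mem h'']
      field_simp
    · have h' : ζ ∉ {ζ : Pt s | ε < homNorm (op B (inv B ζ) z)} := h
      have h'' : op B (inv B ζ) z ∉ {u : Pt s | ε < homNorm u} := h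
      simp only [tailK, Set.indicator_of_notMem h', Set.indicator_of_notMem h'', zero_mul, mul_zero]
  rw [h1, integral_const_mul]
  rfl

theorem aestronglyMeasurable_truncInt (B : Matrix (SpaceIdx s) (SpaceIdx s) ℝ)
    (Y : MvPolynomial (Idx s) ℝ) {f : Pt s → ℝ} (hf : AEStronglyMeasurable f volume) (ε : ℝ) :
    AEStronglyMeasurable (fun z => truncInt B Y f z ε) volume := by
  have hg : Continuous fun p : Pt s × Pt s => op B (inv B p.2) p.1 :=
    (contDiff_op B).continuous.comp
      (((contDiff_inv B).continuous.comp continuous_snd).prodMk continuous_fst)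
  have hm : Measurable ({u : Pt s | ε < homNorm u}.indicator (kernel Y)) :=
    (measurable_kernel Y).indicator (isOpen_lt continuous_const continuous_homNorm).measurableSet
  have h1 : AEStronglyMeasurable (fun p : Pt s × Pt s =>
      {u : Pt s | ε < homNorm u}.indicator (kernel Y) (op B (inv B p.2) p.1) * f p.2)
      (volume.prod volume) :=
    (hm.comp hg.measurable).aestronglyMeasurable.mul hf.comp_snd
  refine h1.integral_prod_right'.congr (Eventually.of_forall fun z => ?_)
  have e := truncInt_eq_conv (B := B) (Y := Y) one_ne_zero f z ε
  simp only [inv_one, one_mul] at e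
  exact e.symm

/-- The weak type estimate for principal values of the kernel of a solid harmonic whose Lipschitz
constant on the unit ball is `A`, with a bound proportional to `A`. -/
theorem exists_singInt_weakType (hB : IsKolmogorovMatrix s B) :
    ∃ C : ℝ, 0 < C ∧ ∀ m : ℕ, 1 ≤ m → ∀ Y ∈ harmonicSpace (Idx s) m,
      (m = 2 → VanishingMean (kernel Y : Pt s → ℝ)) → ∀ A : ℝ, 0 < A → IsLipschitzOnBall A Y →
      ∀ f : Pt s → ℝ, Integrable f volume →
        (∀ᵐ z, Tendsto (truncInt B Y f z) (𝓝[>] (0 : ℝ)) (𝓝 (singInt B Y f z))) ∧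
        AEStronglyMeasurable (singInt B Y f) volume ∧
        ∀ t : ℝ, 0 < t → volume {z : Pt s | t < |singInt B Y f z|} ≤
          ENNReal.ofReal (C * A / t * ∫ z, |f z|) := by
  obtain ⟨C, M, hC, hM, hker⟩ := exists_isSingularKernel hB
  obtain ⟨κ, hN⟩ := exists_isGauge_homNorm hB
  have := isMulRightInvariant_lebesgue hB
  have := isInvInvariant_lebesgue hB
  obtain ⟨C₁, hC₁, hmax⟩ := hN.exists_measure_maximal_truncation_le hM
  refine ⟨C₁ * C, by positivity, fun m hm Y hY h2 A hA hYA f hf => ?_⟩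
  have hK := hker m hm Y hY h2 A hA hYA
  have hCA : 0 < C * A := by positivity
  have hT := truncInt_eq_conv (B := B) (Y := Y) hCA.ne' f
  have hlim : ∀ᵐ z, Tendsto (truncInt B Y f z) (𝓝[>] (0 : ℝ)) (𝓝 (singInt B Y f z)) := by
    have h1 := hK.ae_exists_tendsto hN hM (fun g hg η hη => exists_lipschitz_approx (B := B) hg hη)
      (f := f) hf
    have h1' : ∀ᵐ z : Pt s, ∃ l, Tendsto (fun ε => conv (lebesgue B)
      (tailK (homNorm : Pt s → ℝ) (fun u : Pt s => (C * A)⁻¹ * kernel Y u) ε) f z)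
      (𝓝[>] 0) (𝓝 l) := h1
    filter_upwards [h1'] with z hz
    obtain ⟨l, hl⟩ := hz
    refine tendsto_nhds_limUnder ⟨C * A * l, ?_⟩
    refine (hl.const_mul (C * A)).congr fun ε => (hT z ε).symm
  refine ⟨hlim, ?_, fun t ht => ?_⟩
  · refine aestronglyMeasurable_of_tendsto_ae atTop
      (f := fun (n : ℕ) z => truncInt B Y f z (1 / ((n : ℝ) + 1)))
      (fun n => aestronglyMeasurable_truncInt B Y hf.1 _) ?_
    have hseq : Tendsto (fun n : ℕ => 1 / ((n : ℝ) + 1)) atTop (𝓝[>] 0) :=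
      tendsto_nhdsWithin_iff.2 ⟨tendsto_one_div_add_atTop_nhds_zero_nat,
        Eventually.of_forall fun n => show (0 : ℝ) < 1 / ((n : ℝ) + 1) by positivity⟩
    filter_upwards [hlim] with z hz
    exact hz.comp hseq
  · have hsub : {z : Pt s | t < |singInt B Y f z|} ≤ᵐ[volume]
        {z : Pt s | ∃ ε, 0 < ε ∧ t / (C * A) < |conv (lebesgue B)
          (tailK (homNorm : Pt s → ℝ) (fun u : Pt s => (C * A)⁻¹ * kernel Y u) ε) f z|} := by
      filter_upwards [hlim] with z hz hzt
      have h1 : ∀ᶠ ε in 𝓝[>] (0 : ℝ), t < |truncInt B Y f z ε| :=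
        hz.abs.eventually (eventually_gt_nhds hzt)
      obtain ⟨ε, h2, h3⟩ := (h1.and self_mem_nhdsWithin).exists
      refine ⟨ε, h3, ?_⟩
      rw [hT, abs_mul, abs_of_pos hCA] at h2
      rwa [div_lt_iff₀' hCA]
    have h1 := hmax _ hK (t / (C * A)) (by positivity) f hf
    refine (measure_mono_ae hsub).trans (h1.trans (le_of_eq ?_))
    have h2 : ∫⁻ z, ‖f z‖ₑ ∂(lebesgue B) = ENNReal.ofReal (∫ z : Pt s, |f z|) := by
      rw [ofReal_integral_eq_lintegral_ofReal hf.abs (Eventually.of_forall fun z => abs_nonneg _)]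
      refine lintegral_congr fun z => ?_
      rw [Real.enorm_eq_ofReal_abs]
    rw [h2, ← ENNReal.ofReal_mul (by positivity)]
    congr 2
    field_simp

end Conclusion

end KFP

end

theorem mainTheorem7 {d : ℕ} (s : Fin (d + 1) → ℕ)
    (B : Matrix (KFP.SpaceIdx s) (KFP.SpaceIdx s) ℝ) (hB : KFP.IsKolmogorovMatrix s B) :
    ∃ c β M : ℝ, 0 < c ∧ 0 < β ∧ β ≤ 1 ∧ 1 < M ∧
      ∀ (m : ℕ), 1 ≤ m → ∀ Y : MvPolynomial (KFP.Idx s) ℝ,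
        KFP.IsNormalizedSolidHarmonic s m Y →
        KFP.HormanderCondition B (KFP.kernel Y)
          (c * (m : ℝ) ^ (((KFP.spaceDim s : ℝ) + 1) / 2)) β M ∧
        ((m = 2 → KFP.VanishingMean (KFP.kernel Y)) →
          ∀ f : KFP.Pt s → ℝ, Integrable f volume →
            (∀ᵐ z, Tendsto (KFP.truncInt B Y f z) (𝓝[>] (0 : ℝ)) (𝓝 (KFP.singInt B Y f z))) ∧
            AEStronglyMeasurable (KFP.singInt B Y f) volume ∧
            ∀ t : ℝ, 0 < t →
              volume {z : KFP.Pt s | t < |KFP.singInt B Y f z|} ≤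
                ENNReal.ofReal
                  (c * (m : ℝ) ^ (((KFP.spaceDim s : ℝ) + 1) / 2) / t * ∫ z, |f z|)) := by
  have := KFP.nontrivial_idx hB
  obtain ⟨C₀, hC₀, hlip⟩ := KFP.exists_isLipschitzOnBall (KFP.Idx s)
  obtain ⟨C₁, M, hC₁, hM, hhor⟩ := KFP.exists_hormanderCondition hB
  obtain ⟨C₂, hC₂, hweak⟩ := KFP.exists_singInt_weakType hB
  refine ⟨(C₁ + C₂) * C₀, 1, M, by positivity, one_pos, le_rfl, hM, fun m hm Y hY => ?_⟩
  have hYm : Y ∈ KFP.harmonicSpace (KFP.Idx s) m := ⟨hY.homogeneous, hY.harmonic⟩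
  have hA := hlip m hm Y hYm hY.norm_one
  have hcard : (Fintype.card (KFP.Idx s) : ℝ) = (KFP.spaceDim s : ℝ) + 1 := by
    rw [KFP.card_idx]
    push_cast
    rfl
  rw [hcard] at hA
  have hm0 : (0 : ℝ) < m := by exact_mod_cast hm
  obtain ⟨x, hx⟩ : ∃ x : ℝ, x = (m : ℝ) ^ (((KFP.spaceDim s : ℝ) + 1) / 2) := ⟨_, rfl⟩
  rw [← hx] at hA ⊢
  have hx0 : 0 < x := hx ▸ Real.rpow_pos_of_pos hm0 _
  refine ⟨(hhor _ Y hA).mono ?_, fun h2 f hf => ?_⟩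
  · rw [← mul_assoc]
    gcongr
    linarith
  · obtain ⟨h3, h4, h5⟩ := hweak m hm Y hYm h2 _ (by positivity) hA f hf
    refine ⟨h3, h4, fun t ht => (h5 t ht).trans (ENNReal.ofReal_le_ofReal ?_)⟩
    refine mul_le_mul_of_nonneg_right ?_ (integral_nonneg fun z => abs_nonneg _)
    rw [← mul_assoc]
    gcongr
    linarith
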